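/- \textbf{Theorem (Bergman spaces as coorbits).} Let $\mathbb D$ be the unit disc with area measure $dz$. For $1\le p<\infty$ and $\sigma>1$ let $A^p_\sigma(\mathbb D)$ be the space of holomorphic $f$ on $\mathbb D$ with $\|f\|_{A^p_\sigma}=\left(\int_{\mathbb D}|f(z)|^p(1-|z|^2)^{\sigma-2}\,dz\right)^{1/p}<\infty$. Let $s>1$ and $\mathcal H_s=A^2_s(\mathbb D)$ with $\langle u,v\rangle_s=\frac{s-1}{\pi}\int_{\mathbb D}u\bar v(1-|z|^2)^{s-2}\,dz$. For a matrix $\begin{pmatrix}a&b\\c&d\end{pmatrix}\in SL_2(\mathbb R)$ with positive trace put $\alpha=\frac12(a+d+i(b-c))$, $\beta=\frac12(b+c+i(a-d))$ (its Cayley transform in $SU(1,1)$) and \[\pi_s(g)v(z)=(-\bar\beta z+\alpha)^{-s}\,v\!\left(\frac{\bar\alpha z-\beta}{-\bar\beta z+\alpha}\right)\] with the principal power; this is the discrete series representation (of the simply connected covering group of $SL_2(\mathbb R)$) on $\mathcal H_s$. Let $\mathcal H_s^\infty$ be its Fréchet space of smooth vectors and let $\mathcal H_s^{-\infty}$ be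 the space of continuous conjugate-linear functionals on $\mathcal H_s^\infty$. Let $G=\left\{\begin{pmatrix}a&b\\0&a^{-1}\end{pmatrix}: a>0,\ b\in\mathbb R\right\}$ with left Haar measure $\frac{da\,db}{a^2}$, let $w_r(a,b)=2^r[(a+a^{-1})^2+b^2]^{r/2}$ for $r\in\mathbb R$, and $\|F\|_{L^p_r}=\left(\int_G|F w_r|^p\frac{da\,db}{a^2}\right)^{1/p}$. With $u\equiv1$ put $W_u(\phi)(x)=\langle\phi,\pi_s(x)u\rangle$ for $\phi\in\mathcal H_s^{-\infty}$, $x\in G$, and \[\mathrm{Co}^u_{\mathcal H_s^\infty}L^p_r(G)=\{\phi\in\mathcal H_s^{-\infty}: W_u(\phi)\in L^p_r(G)\}, \qquad \|\phi\|_{\mathrm{Co}}=\|W_u(\phi)\|_{L^p_r}.\] Let $s>1$, $1\le p<\infty$, $r\in\mathbb R$ and suppose $1<\frac{(s-r)p}2<(s-1)p+1$. Then for every $f\in A^p_{(s-r)p/2}(\mathbb D)$ and $v\in\mathcal H_s^\infty$ the integral $\phi_f(v)=\frac{s-1}{\pi}\int_{\mathbb D}f\bar v(1-|z|^2)^{s-2}\,dz$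 converges absolutely, and $f\mapsto\phi_f$ is a linear bijection of $A^p_{(s-r)p/2}(\mathbb D)$ onto $\mathrm{Co}^u_{\mathcal H_s^\infty}L^p_r(G)$. Moreover, for every $f\in A^p_{(s-r)p/2}(\mathbb D)$, \[W_u(\phi_f)(a,b)=\bar\alpha^{-s}f(\beta/\bar\alpha),\qquad \alpha=\tfrac12(a+a^{-1}+ib),\ \beta=\tfrac12(b+i(a-a^{-1})),\] and $\|\phi_f\|_{\mathrm{Co}}=\|W_u(\phi_f)\|_{L^p_r}=2^{2r+1/p}\,\|f\|_{A^p_{(s-r)p/2}}$. -/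

import Mathlib

open MeasureTheory Metric Complex
open scoped ENNReal ComplexConjugate ContDiff

noncomputable section

namespace BergmanCoorbit

/-! ### Weighted Bergman spaces -/

/-- The measure `(1 - |z|²)^(σ - 2) dz` on the unit disc, `dz` being the area measure. -/
def diskMeasure (σ : ℝ) : Measure ℂ :=
  (volume.restrict (ball (0 : ℂ) 1)).withDensity
    fun z => ENNReal.ofReal ((1 - ‖z‖ ^ 2) ^ (σ - 2))

/-- The weighted Bergman space `A^p_σ` of the unit disc. A function on the disc is modelled by
its extension by zero to `ℂ`, so that two elements are equal iff they agree on the disc. -/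
def bergmanSpace (p : ℝ≥0∞) (σ : ℝ) : Submodule ℂ (ℂ → ℂ) where
  carrier := {f | (∀ z ∉ ball (0 : ℂ) 1, f z = 0) ∧ DifferentiableOn ℂ f (ball 0 1) ∧
    MemLp f p (diskMeasure σ)}
  add_mem' := fun ⟨h1, h2, h3⟩ ⟨k1, k2, k3⟩ =>
    ⟨fun z hz => by simp [h1 z hz, k1 z hz], h2.add k2, h3.add k3⟩
  zero_mem' := ⟨fun _ _ => rfl, differentiableOn_const 0, MemLp.zero⟩
  smul_mem' := fun c _ ⟨h1, h2, h3⟩ =>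
    ⟨fun z hz => by simp [h1 z hz], h2.const_smul c, h3.const_smul c⟩

/-- The Bergman norm `(∫_D |f(z)|^p (1 - |z|²)^(σ - 2) dz)^(1/p)`. -/
def bergmanNorm (p : ℝ≥0∞) (σ : ℝ) (f : ℂ → ℂ) : ℝ :=
  (eLpNorm f p (diskMeasure σ)).toReal

/-- The measure `(s - 1)/π · (1 - |z|²)^(s - 2) dz` which defines the inner product of
`H_s = A^2_s`. -/
def hilbertMeasure (s : ℝ) : Measure ℂ :=
  ENNReal.ofReal ((s - 1) / Real.pi) • diskMeasure s

/-- The inclusion of `H_s` in `L²` of the disc with its normalized weighted measure. -/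
def toL2 (s : ℝ) : bergmanSpace 2 s →ₗ[ℂ] Lp ℂ 2 (hilbertMeasure s) where
  toFun v := (v.2.2.2.smul_measure ENNReal.ofReal_ne_top).toLp v.1
  map_add' _ _ := rfl
  map_smul' _ _ := rfl

/-! ### The discrete series -/

/-- The entry `α` of the Cayley transform in `SU(1,1)` of a matrix in `SL(2,ℝ)`. -/
def cayleyα (g : Matrix.SpecialLinearGroup (Fin 2) ℝ) : ℂ :=
  ((g 0 0 + g 1 1 : ℝ) + (g 0 1 - g 1 0 : ℝ) * I) / 2

/-- The entry `β` of the Cayley transform in `SU(1,1)` of a matrix in `SL(2,ℝ)`. -/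
def cayleyβ (g : Matrix.SpecialLinearGroup (Fin 2) ℝ) : ℂ :=
  ((g 0 1 + g 1 0 : ℝ) + (g 0 0 - g 1 1 : ℝ) * I) / 2

/-- The function `(-β̄z + α)^(-s) v((ᾱz - β)/(-β̄z + α))` on the disc, with the principal power. -/
def discreteSeriesFun (s : ℝ) (g : Matrix.SpecialLinearGroup (Fin 2) ℝ) (v : ℂ → ℂ) : ℂ → ℂ :=
  (ball (0 : ℂ) 1).indicator fun z =>
    (-conj (cayleyβ g) * z + cayleyα g) ^ (-(s : ℂ)) *
      v ((conj (cayleyα g) * z - cayleyβ g) / (-conj (cayleyβ g) * z + cayleyα g))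

lemma normSq_cayley (g : Matrix.SpecialLinearGroup (Fin 2) ℝ) :
    normSq (cayleyα g) - normSq (cayleyβ g) = 1 := by
  have h := g.det_coe
  rw [Matrix.det_fin_two] at h
  simp [cayleyα, cayleyβ, normSq_apply]
  linarith

lemma re_cayleyα (g : Matrix.SpecialLinearGroup (Fin 2) ℝ) :
    (cayleyα g).re = (g 0 0 + g 1 1) / 2 := by
  simp [cayleyα]

/-- Principal branches are harmless here: `-β̄z + α` stays in the slit plane. -/
lemma mem_slitPlane {α β z : ℂ} (h : normSq α - normSq β = 1) (hα : 0 < α.re) (hz : ‖z‖ < 1) :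
    -conj β * z + α ∈ slitPlane := by
  by_contra hc
  rw [mem_slitPlane_iff, not_or, not_lt, not_not] at hc
  obtain ⟨h1, h2⟩ := hc
  set w := -conj β * z + α with hw
  have e1 : w - α = -(conj β * z) := by rw [hw]; ring
  have e2 : normSq (w - α) ≤ normSq β := by
    rw [e1, normSq_neg, normSq_mul, normSq_conj]
    have : normSq z ≤ 1 := by rw [normSq_eq_norm_sq]; nlinarith [norm_nonneg z]
    nlinarith [normSq_nonneg β]
  rw [normSq_apply, sub_re, sub_im, h2] at e2
  rw [normSq_apply α] at h
  nlinarith [mul_nonneg (neg_nonneg.2 h1) hα.le, mul_self_nonneg w.re]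

lemma moebius_identity {α β z : ℂ} (h : normSq α - normSq β = 1) :
    normSq (-conj β * z + α) - normSq (conj α * z - β) = 1 - normSq z := by
  have : normSq (-conj β * z + α) - normSq (conj α * z - β) =
      (normSq α - normSq β) * (1 - normSq z) := by
    simp [normSq_apply]; ring
  rw [this, h, one_mul]

lemma moebius_mem {α β z : ℂ} (h : normSq α - normSq β = 1) (hα : 0 < α.re)
    (hz : z ∈ ball (0 : ℂ) 1) :
    (conj α * z - β) / (-conj β * z + α) ∈ ball (0 : ℂ) 1 := by
  rw [mem_ball_zero_iff] at hz ⊢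
  have hne := slitPlane_ne_zero (mem_slitPlane h hα hz)
  rw [norm_div, div_lt_one (norm_pos_iff.2 hne)]
  have := moebius_identity (z := z) h
  rw [normSq_eq_norm_sq, normSq_eq_norm_sq, normSq_eq_norm_sq z] at this
  have h3 : ‖z‖ ^ 2 < 1 := by nlinarith [norm_nonneg z]
  exact lt_of_pow_lt_pow_left₀ 2 (norm_nonneg _) (by linarith)

lemma hasDerivAt_moebius {α β z : ℂ} (h : normSq α - normSq β = 1) (hα : 0 < α.re)
    (hz : z ∈ ball (0 : ℂ) 1) :
    HasDerivAt (fun z => (conj α * z - β) / (-conj β * z + α)) (1 / (-conj β * z + α) ^ 2) z := by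
  have hne := slitPlane_ne_zero (mem_slitPlane h hα (mem_ball_zero_iff.1 hz))
  have h1 : HasDerivAt (fun z : ℂ => conj α * z - β) (conj α) z := by
    simpa using ((hasDerivAt_id z).const_mul (conj α)).sub_const β
  have h2 : HasDerivAt (fun z : ℂ => -conj β * z + α) (-conj β) z := by
    simpa using ((hasDerivAt_id z).const_mul (-conj β)).add_const α
  refine (h1.div h2 hne).congr_deriv ?_
  have : (1 : ℂ) = conj α * α - conj β * β := by
    rw [← normSq_eq_conj_mul_self, ← normSq_eq_conj_mul_self, ← ofReal_sub, h, ofReal_one]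
  rw [this]
  congr 1
  ring

lemma differentiableOn_discreteSeries {s : ℝ} {g : Matrix.SpecialLinearGroup (Fin 2) ℝ}
    (hg : 0 < g 0 0 + g 1 1) {v : ℂ → ℂ} (hv : DifferentiableOn ℂ v (ball 0 1)) :
    DifferentiableOn ℂ (discreteSeriesFun s g v) (ball 0 1) := by
  have h := normSq_cayley g
  have hα : 0 < (cayleyα g).re := by rw [re_cayleyα]; positivity
  refine DifferentiableOn.congr (f := fun z =>
    (-conj (cayleyβ g) * z + cayleyα g) ^ (-(s : ℂ)) *
      v ((conj (cayleyα g) * z - cayleyβ g) / (-conj (cayleyβ g) * z + cayleyα g))) ?_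
    (fun z hz => by rw [discreteSeriesFun, Set.indicator_of_mem hz])
  refine DifferentiableOn.mul ?_ ?_
  · intro z hz
    refine DifferentiableWithinAt.cpow ?_ (differentiableWithinAt_const _)
      (mem_slitPlane h hα (mem_ball_zero_iff.1 hz))
    fun_prop
  · refine hv.comp (f := fun z => (conj (cayleyα g) * z - cayleyβ g) /
      (-conj (cayleyβ g) * z + cayleyα g)) ?_ fun z hz => moebius_mem h hα hz
    exact fun z hz => (hasDerivAt_moebius h hα hz).differentiableAt.differentiableWithinAt

lemma injOn_moebius {α β : ℂ} (h : normSq α - normSq β = 1) (hα : 0 < α.re) :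
    Set.InjOn (fun z => (conj α * z - β) / (-conj β * z + α)) (ball 0 1) := by
  intro z hz w hw e
  have hz' := slitPlane_ne_zero (mem_slitPlane h hα (mem_ball_zero_iff.1 hz))
  have hw' := slitPlane_ne_zero (mem_slitPlane h hα (mem_ball_zero_iff.1 hw))
  simp only at e
  rw [div_eq_div_iff hz' hw'] at e
  have : (1 : ℂ) = conj α * α - conj β * β := by
    rw [← normSq_eq_conj_mul_self, ← normSq_eq_conj_mul_self, ← ofReal_sub, h, ofReal_one]
  linear_combination e + (z - w) * this

lemma memLp_discreteSeries {s : ℝ} {g : Matrix.SpecialLinearGroup (Fin 2) ℝ}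
    (hg : 0 < g 0 0 + g 1 1) {v : ℂ → ℂ} (hv : DifferentiableOn ℂ v (ball 0 1))
    (hv2 : MemLp v 2 (diskMeasure s)) : MemLp (discreteSeriesFun s g v) 2 (diskMeasure s) := by
  have h := normSq_cayley g
  have hα : 0 < (cayleyα g).re := by rw [re_cayleyα]; positivity
  have meas : ∀ f : ℂ → ℂ, DifferentiableOn ℂ f (ball 0 1) →
      AEStronglyMeasurable f (volume.restrict (ball (0 : ℂ) 1)) := fun f hf =>
    hf.continuousOn.aestronglyMeasurable measurableSet_ball
  have key : ∀ f : ℂ → ℂ, DifferentiableOn ℂ f (ball 0 1) →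
      ∫⁻ z, ‖f z‖ₑ ^ (2 : ℝ) ∂(diskMeasure s) = ∫⁻ z in ball (0 : ℂ) 1,
        ENNReal.ofReal ((1 - ‖z‖ ^ 2) ^ (s - 2)) * ‖f z‖ₑ ^ (2 : ℝ) := fun f hf => by
    rw [diskMeasure, lintegral_withDensity_eq_lintegral_mul₀ (by fun_prop)
      ((meas f hf).enorm.pow_const _)]
    rfl
  have hd := differentiableOn_discreteSeries (s := s) hg hv
  refine ⟨(meas _ hd).mono_ac (withDensity_absolutelyContinuous _ _), ?_⟩
  rw [eLpNorm_lt_top_iff_lintegral_rpow_enorm_lt_top (by norm_num) (by norm_num)]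
  have hv3 := (eLpNorm_lt_top_iff_lintegral_rpow_enorm_lt_top (by norm_num) (by norm_num)).1 hv2.2
  rw [ENNReal.toReal_ofNat, key _ hv] at hv3
  rw [ENNReal.toReal_ofNat, key _ hd]
  refine lt_of_le_of_lt ?_ hv3
  set T : ℂ → ℂ := fun z =>
    (conj (cayleyα g) * z - cayleyβ g) / (-conj (cayleyβ g) * z + cayleyα g) with hT
  have hsub : T '' ball 0 1 ⊆ ball 0 1 := by
    rintro _ ⟨z, hz, rfl⟩
    exact moebius_mem h hα hz
  refine le_trans (le_of_eq ?_) (lintegral_mono_set hsub)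
  rw [lintegral_image_eq_lintegral_abs_det_fderiv_mul volume measurableSet_ball
    (fun z hz => ((hasDerivAt_moebius h hα hz).hasFDerivAt.restrictScalars ℝ).hasFDerivWithinAt)
    (injOn_moebius h hα)]
  refine setLIntegral_congr_fun measurableSet_ball fun z hz => ?_
  have hz1 : ‖z‖ < 1 := mem_ball_zero_iff.1 hz
  set c := -conj (cayleyβ g) * z + cayleyα g with hc
  have hne : c ≠ 0 := slitPlane_ne_zero (mem_slitPlane h hα hz1)
  have hcp : 0 < ‖c‖ := norm_pos_iff.2 hne
  have hdet : |(ContinuousLinearMap.restrictScalars ℝ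
      (ContinuousLinearMap.toSpanSingleton ℂ (1 / c ^ 2))).det| = (‖c‖ ^ 2)⁻¹ ^ 2 := by
    simp [ContinuousLinearMap.det, LinearMap.det_restrictScalars, Algebra.norm_complex_eq,
      Complex.normSq_eq_norm_sq]
  have hz2 : 0 < 1 - ‖z‖ ^ 2 := by nlinarith [norm_nonneg z]
  have hTz : 1 - ‖T z‖ ^ 2 = (1 - ‖z‖ ^ 2) * (‖c‖ ^ 2)⁻¹ := by
    have := moebius_identity (z := z) h
    rw [normSq_eq_norm_sq, normSq_eq_norm_sq, normSq_eq_norm_sq z] at this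
    have hn : ‖T z‖ = ‖conj (cayleyα g) * z - cayleyβ g‖ / ‖c‖ := norm_div _ _
    rw [← hc] at this
    rw [← this, hn]
    field_simp
  have hE : discreteSeriesFun s g v z = c ^ (-(s : ℂ)) * v (T z) := by
    rw [discreteSeriesFun, Set.indicator_of_mem hz]
  change _ = ENNReal.ofReal |(ContinuousLinearMap.restrictScalars ℝ
    (ContinuousLinearMap.toSpanSingleton ℂ (1 / c ^ 2))).det| *
      (ENNReal.ofReal ((1 - ‖T z‖ ^ 2) ^ (s - 2)) * ‖v (T z)‖ₑ ^ (2 : ℝ))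
  rw [hE, hdet, hTz, enorm_mul, ENNReal.mul_rpow_of_nonneg _ _ (by norm_num), ← mul_assoc,
    ← mul_assoc, ← ofReal_norm (c ^ (-(s : ℂ))), ← ofReal_neg, norm_cpow_real,
    ENNReal.ofReal_rpow_of_nonneg (by positivity) (by norm_num),
    ← ENNReal.ofReal_mul (by positivity), ← ENNReal.ofReal_mul (by positivity)]
  congr 2
  rw [Real.mul_rpow hz2.le (by positivity), mul_comm _ (_ * _), mul_assoc]
  congr 1
  rw [← Real.rpow_natCast, ← Real.rpow_natCast, ← Real.rpow_neg hcp.le, ← Real.rpow_mul hcp.le,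
    ← Real.rpow_mul hcp.le, ← Real.rpow_mul hcp.le, ← Real.rpow_add hcp]
  congr 1
  push_cast
  ring

/-- `π_s(g)` on `H_s`, for `g` in the simply connected open part `{g | tr g > 0}` of `SL(2,ℝ)`;
this contains the group of upper triangular matrices with positive diagonal and is a
neighbourhood of the identity. (For real `s`, `π_s` is a representation of the simply connected
covering group of `SL(2,ℝ)`, and the principal power gives its value on that part.) -/
def discreteSeries (s : ℝ) (g : Matrix.SpecialLinearGroup (Fin 2) ℝ) (hg : 0 < g 0 0 + g 1 1) :
    bergmanSpace 2 s →ₗ[ℂ] bergmanSpace 2 s where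
  toFun v := ⟨discreteSeriesFun s g v.1,
    fun z hz => by rw [discreteSeriesFun, Set.indicator_of_notMem hz],
    differentiableOn_discreteSeries hg v.2.2.1, memLp_discreteSeries hg v.2.2.1 v.2.2.2⟩
  map_add' v w := by
    ext z
    by_cases hz : z ∈ ball (0 : ℂ) 1 <;> simp [discreteSeriesFun, hz, mul_add]
  map_smul' c v := by
    ext z
    by_cases hz : z ∈ ball (0 : ℂ) 1 <;> simp [discreteSeriesFun, hz, mul_left_comm]

/-! ### Smooth vectors -/

/-- The part of the chart `(a, b, c) ↦ (a b; c (1 + bc)/a)` of `SL(2,ℝ)` with positive trace. -/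
def slDomain : Set (ℝ × ℝ × ℝ) := {x | 0 < x.1 ∧ 0 < x.1 + (1 + x.2.1 * x.2.2) / x.1}

def slChart (x : ℝ × ℝ × ℝ) (hx : 0 < x.1) : Matrix.SpecialLinearGroup (Fin 2) ℝ :=
  ⟨!![x.1, x.2.1; x.2.2, (1 + x.2.1 * x.2.2) / x.1], by
    rw [Matrix.det_fin_two_of]; field_simp; ring⟩

open Classical in
/-- The orbit map `g ↦ π_s(g)v`, read in the chart around the identity `(1, 0, 0)`. -/
def orbitMap (s : ℝ) (v : bergmanSpace 2 s) (x : ℝ × ℝ × ℝ) : Lp ℂ 2 (hilbertMeasure s) :=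
  if h : x ∈ slDomain then toL2 s (discreteSeries s (slChart x h.1) h.2 v) else 0

lemma orbitMap_add (s : ℝ) (v w : bergmanSpace 2 s) :
    orbitMap s (v + w) = orbitMap s v + orbitMap s w := by
  funext x
  by_cases h : x ∈ slDomain <;> simp [orbitMap, h]

lemma orbitMap_smul (s : ℝ) (c : ℂ) (v : bergmanSpace 2 s) :
    orbitMap s (c • v) = c • orbitMap s v := by
  funext x
  by_cases h : x ∈ slDomain <;> simp [orbitMap, h]

/-- The smooth vectors of `π_s`: those with a smooth orbit map. -/
def smoothVectors (s : ℝ) : Submodule ℂ (bergmanSpace 2 s) where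
  carrier := {v | ContDiffOn ℝ ∞ (orbitMap s v) slDomain}
  add_mem' {v w} hv hw := by
    simp only [Set.mem_ofPred_eq] at *
    rw [orbitMap_add]; exact hv.add hw
  zero_mem' := by
    have : orbitMap s 0 = 0 := by simpa using orbitMap_smul s 0 0
    simp only [Set.mem_ofPred_eq, this]
    exact contDiffOn_const
  smul_mem' c v hv := by
    simp only [Set.mem_ofPred_eq] at *
    rw [orbitMap_smul]; exact hv.const_smul c

lemma isOpen_slDomain : IsOpen slDomain := by
  have h1 : IsOpen {x : ℝ × ℝ × ℝ | 0 < x.1} := isOpen_lt continuous_const continuous_fst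
  have h2 : ContinuousOn (fun x : ℝ × ℝ × ℝ => x.1 + (1 + x.2.1 * x.2.2) / x.1)
      {x : ℝ × ℝ × ℝ | 0 < x.1} := by
    refine ContinuousOn.add (by fun_prop) (ContinuousOn.div (by fun_prop) (by fun_prop) ?_)
    exact fun x hx => ne_of_gt hx
  exact h2.isOpen_inter_preimage h1 isOpen_Ioi

lemma one_mem_slDomain : ((1, 0, 0) : ℝ × ℝ × ℝ) ∈ slDomain := by
  constructor <;> norm_num

/-- The space `H_s^∞` of smooth vectors, as a type which carries its own topology. -/
def SmoothVector (s : ℝ) : Type := smoothVectors s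

instance (s : ℝ) : AddCommGroup (SmoothVector s) :=
  inferInstanceAs (AddCommGroup (smoothVectors s))

instance (s : ℝ) : Module ℂ (SmoothVector s) :=
  inferInstanceAs (Module ℂ (smoothVectors s))

/-- A smooth vector as a function on the disc. -/
def SmoothVector.toFun {s : ℝ} (v : SmoothVector s) : ℂ → ℂ :=
  (Subtype.val (Subtype.val v : bergmanSpace 2 s) : ℂ → ℂ)

lemma contDiffAt_orbitMap {s : ℝ} (v : smoothVectors s) :
    ContDiffAt ℝ ∞ (orbitMap s v.1) (1, 0, 0) :=
  v.2.contDiffAt (isOpen_slDomain.mem_nhds one_mem_slDomain)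

/-- The norm of the `n`-th derivative of the orbit map at the identity. In any chart, the
derivatives of order at most `n` at the identity are the vectors `dπ_s(D)v` with `D` of order at
most `n` in the universal enveloping algebra, so these seminorms define the usual
topology of `H_s^∞`. -/
def smoothSeminorm (s : ℝ) (n : ℕ) : Seminorm ℂ (SmoothVector s) :=
  show Seminorm ℂ (smoothVectors s) from Seminorm.of
    (fun v => ‖iteratedFDeriv ℝ n (orbitMap s v.1) (1, 0, 0)‖)
    (fun v w => by
      rw [Submodule.coe_add, orbitMap_add, iteratedFDeriv_add_apply
        ((contDiffAt_orbitMap v).of_le (by exact_mod_cast le_top))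
        ((contDiffAt_orbitMap w).of_le (by exact_mod_cast le_top))]
      exact norm_add_le _ _)
    (fun c v => by
      rw [Submodule.coe_smul, orbitMap_smul, iteratedFDeriv_const_smul_apply
        ((contDiffAt_orbitMap v).of_le (by exact_mod_cast le_top)), norm_smul])

instance (s : ℝ) : TopologicalSpace (SmoothVector s) :=
  SeminormFamily.moduleFilterBasis (𝕜 := ℂ) (smoothSeminorm s) |>.topology

/-- The conjugate dual `H_s^{-∞}`: continuous conjugate-linear functionals on `H_s^∞`. -/
abbrev Distribution (s : ℝ) : Type := SmoothVector s →SL[starRingEnd ℂ] ℂ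


/-! ### The wavelet `u = 1` and its translates -/

lemma isFiniteMeasure_diskMeasure {σ : ℝ} (hσ : 1 < σ) : IsFiniteMeasure (diskMeasure σ) := by
  have h1 : IntegrableOn (fun y : ℝ => y * (1 - y ^ 2) ^ (σ - 2)) (Set.Ioc 0 1) := by
    refine intervalIntegral.integrableOn_deriv_of_nonneg
      (g := fun y : ℝ => -((1 - y ^ 2) ^ (σ - 1)) / (2 * (σ - 1))) ?_ ?_ ?_
    · refine ContinuousOn.div_const (ContinuousOn.neg (ContinuousOn.rpow_const (by fun_prop) ?_)) _
      exact fun x _ => Or.inr (by linarith)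
    · intro x hx
      have hx2 : 0 < 1 - x ^ 2 := by nlinarith [hx.1, hx.2]
      have h2 : HasDerivAt (fun y : ℝ => 1 - y ^ 2) (-(2 * x)) x := by
        simpa using (hasDerivAt_pow 2 x).const_sub 1
      refine ((h2.rpow_const (p := σ - 1) (Or.inl hx2.ne')).neg.div_const _).congr_deriv ?_
      have : σ - 1 ≠ 0 := by linarith
      rw [show σ - 1 - 1 = σ - 2 by ring]
      field_simp
    · intro x hx
      exact mul_nonneg hx.1.le (Real.rpow_nonneg (by nlinarith [hx.1, hx.2]) _)
  have h2 : IntegrableOn (fun z : ℂ => (1 - ‖z‖ ^ 2) ^ (σ - 2)) (ball 0 1) := by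
    rw [integrableOn_fun_norm_addHaar volume (f := fun y : ℝ => (1 - y ^ 2) ^ (σ - 2))]
    rw [Complex.finrank_real_complex]
    simpa using h1.mono_set Set.Ioo_subset_Ioc_self
  exact isFiniteMeasure_withDensity_ofReal h2.2

lemma isFiniteMeasure_hilbertMeasure {s : ℝ} (hs : 1 < s) :
    IsFiniteMeasure (hilbertMeasure s) := by
  have := isFiniteMeasure_diskMeasure hs
  exact Measure.smul_finite _ ENNReal.ofReal_ne_top

lemma ae_hilbertMeasure {s : ℝ} {P : ℂ → Prop} (h : ∀ z ∈ ball (0 : ℂ) 1, P z) :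
    ∀ᵐ z ∂(hilbertMeasure s), P z :=
  (Measure.smul_absolutelyContinuous.trans (withDensity_absolutelyContinuous _ _)).ae_le
    (ae_restrict_of_forall_mem measurableSet_ball h)

/-- A bounded holomorphic function on the disc, as an element of `H_s`. -/
def ofBounded {s : ℝ} (hs : 1 < s) (f : ℂ → ℂ) (hf : DifferentiableOn ℂ f (ball 0 1))
    (hb : ∃ C : ℝ, ∀ z ∈ ball (0 : ℂ) 1, ‖f z‖ ≤ C) : bergmanSpace 2 s :=
  ⟨(ball (0 : ℂ) 1).indicator f, fun z hz => Set.indicator_of_notMem hz _,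
    hf.congr fun z hz => Set.indicator_of_mem hz _, by
      have := isFiniteMeasure_diskMeasure hs
      obtain ⟨C, hC⟩ := hb
      have hm : AEStronglyMeasurable f (diskMeasure s) :=
        (hf.continuousOn.aestronglyMeasurable measurableSet_ball).mono_ac
          (withDensity_absolutelyContinuous _ _)
      refine MemLp.of_bound (hm.indicator measurableSet_ball) C ?_
      refine (withDensity_absolutelyContinuous _ _).ae_le
        (ae_restrict_of_forall_mem measurableSet_ball fun z hz => ?_)
      rw [Set.indicator_of_mem hz]
      exact hC z hz⟩

/-- The wavelet `u`, identically `1` on the disc. -/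
def unitVector {s : ℝ} (hs : 1 < s) : bergmanSpace 2 s :=
  ofBounded hs (fun _ => 1) (differentiableOn_const 1) ⟨1, fun _ _ => by simp⟩

lemma one_sub_mul_re_pos {ζ z : ℂ} (hζ : ‖ζ‖ < 1) (hz : ‖z‖ ≤ 1) : 0 < (1 - ζ * z).re := by
  have h1 : ‖ζ * z‖ < 1 := by
    rw [norm_mul]; nlinarith [norm_nonneg ζ, norm_nonneg z]
  have h2 := re_le_norm (ζ * z)
  rw [sub_re, one_re]
  linarith

lemma one_sub_norm_le {ζ z : ℂ} (hz : ‖z‖ ≤ 1) : 1 - ‖ζ‖ ≤ ‖1 - ζ * z‖ := by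
  have h1 : ‖ζ * z‖ ≤ ‖ζ‖ := by
    rw [norm_mul]; nlinarith [norm_nonneg ζ, norm_nonneg z]
  have h2 := norm_sub_norm_le (1 : ℂ) (ζ * z)
  rw [norm_one] at h2
  linarith

lemma norm_kernel_le {t : ℝ} (ht : 0 ≤ t) {ζ z : ℂ} {ρ : ℝ} (hρ : 0 < ρ) (hζ : ‖ζ‖ ≤ 1 - ρ)
    (hz : ‖z‖ ≤ 1) : ‖(1 - ζ * z) ^ (-(t : ℂ))‖ ≤ ρ ^ (-t) := by
  rw [← ofReal_neg, norm_cpow_real]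
  have := one_sub_norm_le (ζ := ζ) hz
  exact Real.rpow_le_rpow_of_nonpos hρ (by linarith) (by linarith)

lemma differentiableOn_kernel (t : ℝ) {ζ : ℂ} (hζ : ‖ζ‖ < 1) :
    DifferentiableOn ℂ (fun z => (1 - ζ * z) ^ (-(t : ℂ))) (ball 0 1) := by
  intro z hz
  refine DifferentiableWithinAt.cpow (by fun_prop) (differentiableWithinAt_const _) ?_
  exact Or.inl (one_sub_mul_re_pos hζ (mem_ball_zero_iff.1 hz).le)

/-- The function `(1 - ζz)^(-s)`, as an element of `H_s`. -/
def kernelVector {s : ℝ} (hs : 1 < s) (ζ : ℂ) (hζ : ‖ζ‖ < 1) : bergmanSpace 2 s :=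
  ofBounded hs (fun z => (1 - ζ * z) ^ (-(s : ℂ))) (differentiableOn_kernel s hζ)
    ⟨_, fun z hz => norm_kernel_le (by linarith : 0 ≤ s) (sub_pos.2 hζ) (by linarith)
      (mem_ball_zero_iff.1 hz).le⟩

open Classical in
/-- The vectors `(1 - ζz)^(-s)` as a function of `ζ`. -/
def kernelMap {s : ℝ} (hs : 1 < s) (ζ : ℂ) : Lp ℂ 2 (hilbertMeasure s) :=
  if h : ‖ζ‖ < 1 then toL2 s (kernelVector hs ζ h) else 0

lemma hasDerivAt_kernel (t : ℝ) {ζ z : ℂ} (hζ : ‖ζ‖ < 1) (hz : ‖z‖ ≤ 1) :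
    HasDerivAt (fun ζ => (1 - ζ * z) ^ (-(t : ℂ)))
      (t * z * (1 - ζ * z) ^ (-((t + 1 : ℝ) : ℂ))) ζ := by
  have h1 : HasDerivAt (fun ζ : ℂ => 1 - ζ * z) (-z) ζ := by
    simpa using ((hasDerivAt_id ζ).mul_const z).const_sub 1
  refine (h1.cpow_const (c := -(t : ℂ)) (Or.inl (one_sub_mul_re_pos hζ hz))).congr_deriv ?_
  rw [show -((t + 1 : ℝ) : ℂ) = -(t : ℂ) - 1 by push_cast; ring]
  ring

lemma kernel_taylor {s : ℝ} (hs : 1 < s) {ζ₀ ζ z : ℂ} {ρ : ℝ} (hρ : 0 < ρ)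
    (h0 : ‖ζ₀‖ + ρ ≤ 1 - ρ) (hζ : ‖ζ - ζ₀‖ ≤ ρ) (hz : ‖z‖ ≤ 1) :
    ‖(1 - ζ * z) ^ (-(s : ℂ)) - (1 - ζ₀ * z) ^ (-(s : ℂ)) -
      (ζ - ζ₀) * (s * z * (1 - ζ₀ * z) ^ (-((s + 1 : ℝ) : ℂ)))‖ ≤
      s * (s + 1) * ρ ^ (-(s + 1 + 1)) * ‖ζ - ζ₀‖ ^ 2 := by
  set M := s * (s + 1) * ρ ^ (-(s + 1 + 1)) with hM
  set d := ‖ζ - ζ₀‖ with hd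
  have hM0 : 0 ≤ M := by positivity
  have hball : ∀ ξ ∈ closedBall ζ₀ d, ‖ξ‖ ≤ 1 - ρ := fun ξ hξ => by
    rw [mem_closedBall, dist_eq_norm] at hξ
    have := norm_add_le ζ₀ (ξ - ζ₀)
    rw [add_sub_cancel] at this
    linarith
  have hζm : ζ ∈ closedBall ζ₀ d := by rw [mem_closedBall, dist_eq_norm]
  have hζ0m : ζ₀ ∈ closedBall ζ₀ d := by simp [hd]
  have step1 : ∀ ξ ∈ closedBall ζ₀ d,
      ‖s * z * (1 - ξ * z) ^ (-((s + 1 : ℝ) : ℂ)) -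
        s * z * (1 - ζ₀ * z) ^ (-((s + 1 : ℝ) : ℂ))‖ ≤ M * d := by
    intro ξ hξ
    refine (Convex.norm_image_sub_le_of_norm_hasDerivWithin_le
      (f := fun ξ => s * z * (1 - ξ * z) ^ (-((s + 1 : ℝ) : ℂ)))
      (fun x hx => ((hasDerivAt_kernel (s + 1)
        (lt_of_le_of_lt (hball x hx) (by linarith)) hz).const_mul _).hasDerivWithinAt)
      (fun x hx => ?_) (convex_closedBall ζ₀ d) hζ0m hξ).trans
      (mul_le_mul_of_nonneg_left (by rwa [mem_closedBall, dist_eq_norm] at hξ) hM0)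
    rw [norm_mul, norm_mul, norm_mul, norm_mul, norm_real, norm_real,
      Real.norm_of_nonneg (by linarith), Real.norm_of_nonneg (by linarith)]
    have h1 := norm_kernel_le (t := s + 1 + 1) (by linarith) hρ (hball x hx) hz
    calc s * ‖z‖ * ((s + 1) * ‖z‖ * ‖(1 - x * z) ^ (-((s + 1 + 1 : ℝ) : ℂ))‖)
        ≤ s * 1 * ((s + 1) * 1 * ρ ^ (-(s + 1 + 1))) := by gcongr
      _ = M := by rw [hM]; ring
  have step2 := Convex.norm_image_sub_le_of_norm_hasDerivWithin_le
      (f := fun ξ => (1 - ξ * z) ^ (-(s : ℂ)) -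
        ξ * (s * z * (1 - ζ₀ * z) ^ (-((s + 1 : ℝ) : ℂ))))
      (f' := fun ξ => s * z * (1 - ξ * z) ^ (-((s + 1 : ℝ) : ℂ)) -
        s * z * (1 - ζ₀ * z) ^ (-((s + 1 : ℝ) : ℂ)))
      (fun x hx => by
        have h2 := (hasDerivAt_id x).mul_const (s * z * (1 - ζ₀ * z) ^ (-((s + 1 : ℝ) : ℂ)))
        rw [one_mul] at h2
        exact ((hasDerivAt_kernel s
          (lt_of_le_of_lt (hball x hx) (by linarith)) hz).sub h2).hasDerivWithinAt)
      step1 (convex_closedBall ζ₀ d) hζ0m hζm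
  rw [show M * d ^ 2 = M * d * ‖ζ - ζ₀‖ by rw [← hd]; ring]
  refine le_trans (le_of_eq ?_) step2
  congr 1
  ring

lemma toL2_coeFn {s : ℝ} (v : bergmanSpace 2 s) :
    (toL2 s v : ℂ → ℂ) =ᵐ[hilbertMeasure s] v.1 :=
  MemLp.coeFn_toLp (v.2.2.2.smul_measure ENNReal.ofReal_ne_top)

lemma differentiableOn_kernelMap {s : ℝ} (hs : 1 < s) :
    DifferentiableOn ℂ (kernelMap hs) (ball 0 1) := by
  intro ζ₀ hζ₀
  have := isFiniteMeasure_hilbertMeasure hs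
  rw [mem_ball_zero_iff] at hζ₀
  set ρ := (1 - ‖ζ₀‖) / 2 with hρd
  have hρ : 0 < ρ := by rw [hρd]; linarith
  have h0 : ‖ζ₀‖ + ρ ≤ 1 - ρ := by rw [hρd]; linarith
  let D : bergmanSpace 2 s := ofBounded hs
    (fun z => s * z * (1 - ζ₀ * z) ^ (-((s + 1 : ℝ) : ℂ)))
    (DifferentiableOn.mul (by fun_prop) (differentiableOn_kernel (s + 1) hζ₀))
    ⟨s * 1 * ρ ^ (-(s + 1)), fun z hz => by
      have hz1 := (mem_ball_zero_iff.1 hz).le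
      have h1 := norm_kernel_le (t := s + 1) (by linarith) hρ (by linarith : ‖ζ₀‖ ≤ 1 - ρ) hz1
      rw [norm_mul, norm_mul, norm_real, Real.norm_of_nonneg (by linarith)]
      gcongr⟩
  let R : ℂ → Lp ℂ 2 (hilbertMeasure s) := fun ζ =>
    kernelMap hs ζ - kernelMap hs ζ₀ - (ζ - ζ₀) • toL2 s D
  have hR : R =O[nhds ζ₀] fun ζ => ‖ζ - ζ₀‖ ^ 2 := by
    refine Asymptotics.IsBigO.of_bound
      ((measureUnivNNReal (hilbertMeasure s) : ℝ) ^ (2 : ℝ≥0∞).toReal⁻¹ *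
        (s * (s + 1) * ρ ^ (-(s + 1 + 1)))) ?_
    filter_upwards [closedBall_mem_nhds ζ₀ hρ] with ζ hζ
    rw [mem_closedBall, dist_eq_norm] at hζ
    have hζ1 : ‖ζ‖ < 1 := by
      have := norm_add_le ζ₀ (ζ - ζ₀)
      rw [add_sub_cancel] at this
      linarith
    have hRe : R ζ = toL2 s (kernelVector hs ζ hζ1 - kernelVector hs ζ₀ hζ₀ - (ζ - ζ₀) • D) := by
      simp only [R, kernelMap, hζ1, hζ₀, dif_pos, map_sub, map_smul]
    rw [hRe, norm_pow, norm_norm, mul_assoc]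
    refine Lp.norm_le_of_ae_bound (by positivity) ?_
    filter_upwards [toL2_coeFn (kernelVector hs ζ hζ1 - kernelVector hs ζ₀ hζ₀ - (ζ - ζ₀) • D),
      ae_hilbertMeasure (s := s) (P := fun z => z ∈ ball (0 : ℂ) 1) fun z hz => hz] with z hz1 hz2
    rw [hz1]
    have := kernel_taylor hs hρ h0 hζ (mem_ball_zero_iff.1 hz2).le
    simpa [D, kernelVector, ofBounded, Set.indicator_of_mem hz2] using this
  have h1 : DifferentiableAt ℂ R ζ₀ := (hR.hasFDerivAt (𝕜 := ℂ) (by norm_num)).differentiableAt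
  have h2 : kernelMap hs = fun ζ => R ζ + kernelMap hs ζ₀ + (ζ - ζ₀) • toL2 s D := by
    funext ζ
    simp only [R]
    abel
  rw [h2]
  refine DifferentiableAt.differentiableWithinAt ?_
  exact (h1.add_const _).add ((differentiableAt_id.sub_const ζ₀).smul_const _)

lemma contDiffOn_kernelMap {s : ℝ} (hs : 1 < s) :
    ContDiffOn ℝ ∞ (kernelMap hs) (ball 0 1) :=
  ((differentiableOn_kernelMap hs).contDiffOn isOpen_ball).restrict_scalars ℝ

/-- The cocycle identity behind `π_s(h) π_s(g) u = const · (1 - ζz)^(-s)`. -/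
lemma cocycle (s : ℝ) {α β α' β' : ℂ} (h : normSq α - normSq β = 1) (hα : 0 < α.re)
    (h' : normSq α' - normSq β' = 1) (hα' : 0 < α'.re) :
    ‖(conj α * conj β' + conj β * α') / (α * α' + β * conj β')‖ < 1 ∧
    ∀ z ∈ ball (0 : ℂ) 1,
      (-conj β * z + α) ^ (-(s : ℂ)) *
        (-conj β' * ((conj α * z - β) / (-conj β * z + α)) + α') ^ (-(s : ℂ)) =
      α ^ (-(s : ℂ)) * (-conj β' * (-β / α) + α') ^ (-(s : ℂ)) *
        (1 - (conj α * conj β' + conj β * α') / (α * α' + β * conj β') * z) ^ (-(s : ℂ)) := by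
  set α₂ := α * α' + β * conj β' with hα₂
  set β₂ := conj α * conj β' + conj β * α' with hβ₂
  have hn : normSq α₂ - normSq β₂ = 1 := by
    have : normSq α₂ - normSq β₂ = (normSq α - normSq β) * (normSq α' - normSq β') := by
      simp [hα₂, hβ₂, normSq_apply]; ring
    rw [this, h, h', one_mul]
  have hα₂0 : α₂ ≠ 0 := by
    intro h0
    rw [h0, map_zero] at hn
    linarith [normSq_nonneg β₂]
  have hζ : ‖β₂ / α₂‖ < 1 := by
    rw [norm_div, div_lt_one (norm_pos_iff.2 hα₂0)]
    rw [normSq_eq_norm_sq, normSq_eq_norm_sq] at hn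
    exact lt_of_pow_lt_pow_left₀ 2 (norm_nonneg _) (by linarith)
  refine ⟨hζ, ?_⟩
  set A : ℂ → ℂ := fun z => -conj β * z + α with hA
  set T : ℂ → ℂ := fun z => (conj α * z - β) / (-conj β * z + α) with hT
  set B : ℂ → ℂ := fun z => -conj β' * T z + α' with hB
  set C : ℂ → ℂ := fun z => 1 - β₂ / α₂ * z with hC
  have hAs : ∀ z ∈ ball (0 : ℂ) 1, A z ∈ slitPlane := fun z hz =>
    mem_slitPlane h hα (mem_ball_zero_iff.1 hz)
  have hBs : ∀ z ∈ ball (0 : ℂ) 1, B z ∈ slitPlane := fun z hz =>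
    mem_slitPlane h' hα' (mem_ball_zero_iff.1 (moebius_mem h hα hz))
  have hCs : ∀ z ∈ ball (0 : ℂ) 1, C z ∈ slitPlane := fun z hz =>
    Or.inl (one_sub_mul_re_pos hζ (mem_ball_zero_iff.1 hz).le)
  have hABC : ∀ z ∈ ball (0 : ℂ) 1, A z * B z = α₂ * C z := fun z hz => by
    have hne : -conj β * z + α ≠ 0 := slitPlane_ne_zero (hAs z hz)
    have e1 : A z * B z = -conj β' * (conj α * z - β) + α' * (-conj β * z + α) := by
      simp only [hA, hB, hT]
      generalize -conj β * z + α = D at hne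
      field_simp
    have e2 : α₂ * C z = α₂ - β₂ * z := by
      simp only [hC]
      field_simp
    rw [e1, e2, hα₂, hβ₂]
    ring
  set L : ℂ → ℂ := fun z => log (A z) + log (B z) - log (C z) with hL
  have hder : ∀ z ∈ ball (0 : ℂ) 1, HasDerivAt L 0 z := by
    intro z hz
    have dA : DifferentiableAt ℂ A z := by simp only [hA]; fun_prop
    have dB : DifferentiableAt ℂ B z :=
      ((hasDerivAt_moebius h hα hz).differentiableAt.const_mul _).add_const _
    have dC : DifferentiableAt ℂ C z := by simp only [hC]; fun_prop
    have e : HasDerivAt (fun z => A z * B z) (α₂ * deriv C z) z :=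
      (dC.hasDerivAt.const_mul α₂).congr_of_eventuallyEq
        (Filter.eventually_of_mem (isOpen_ball.mem_nhds hz) hABC)
    have e3 := (dA.hasDerivAt.mul dB.hasDerivAt).unique e
    refine (((dA.hasDerivAt.clog (hAs z hz)).add (dB.hasDerivAt.clog (hBs z hz))).sub
      (dC.hasDerivAt.clog (hCs z hz))).congr_deriv ?_
    have nA := slitPlane_ne_zero (hAs z hz)
    have nB := slitPlane_ne_zero (hBs z hz)
    have nC := slitPlane_ne_zero (hCs z hz)
    rw [div_add_div _ _ nA nB, sub_eq_zero, div_eq_div_iff (mul_ne_zero nA nB) nC, e3, hABC z hz]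
    ring
  have hconst : ∀ z ∈ ball (0 : ℂ) 1, L z = L 0 := by
    intro z hz
    have := Convex.norm_image_sub_le_of_norm_hasDerivWithin_le (C := 0)
      (fun x hx => (hder x hx).hasDerivWithinAt) (fun x _ => by simp) (convex_ball (0 : ℂ) 1)
      (mem_ball_self one_pos) hz
    rw [zero_mul] at this
    exact sub_eq_zero.1 (norm_le_zero_iff.1 this)
  intro z hz
  have h0 : (0 : ℂ) ∈ ball (0 : ℂ) 1 := mem_ball_self one_pos
  have hA0 : A 0 = α := by simp [hA]
  have hB0 : B 0 = -conj β' * (-β / α) + α' := by simp [hB, hT]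
  have hC0 : C 0 = 1 := by simp [hC]
  have hz0 := hconst z hz
  simp only [hL, hC0, log_one, sub_zero] at hz0
  change A z ^ (-(s : ℂ)) * B z ^ (-(s : ℂ)) = _ * _ * C z ^ (-(s : ℂ))
  rw [← hB0, ← hA0, cpow_def_of_ne_zero (slitPlane_ne_zero (hAs z hz)),
    cpow_def_of_ne_zero (slitPlane_ne_zero (hBs z hz)),
    cpow_def_of_ne_zero (slitPlane_ne_zero (hAs 0 h0)),
    cpow_def_of_ne_zero (slitPlane_ne_zero (hBs 0 h0)),
    cpow_def_of_ne_zero (slitPlane_ne_zero (hCs z hz)), ← exp_add, ← exp_add, ← exp_add]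
  congr 1
  linear_combination (-(s : ℂ)) * hz0

/-- The translates `π_s(g)u` are smooth vectors. -/
lemma translate_mem_smoothVectors {s : ℝ} (hs : 1 < s) (g : Matrix.SpecialLinearGroup (Fin 2) ℝ)
    (hg : 0 < g 0 0 + g 1 1) : discreteSeries s g hg (unitVector hs) ∈ smoothVectors s := by
  have h' := normSq_cayley g
  have hα' : 0 < (cayleyα g).re := by rw [re_cayleyα]; positivity
  set α' := cayleyα g with hα'd
  set β' := cayleyβ g with hβ'd
  let a : ℝ × ℝ × ℝ → ℂ := fun x =>
    ((x.1 + (1 + x.2.1 * x.2.2) / x.1 : ℝ) + (x.2.1 - x.2.2 : ℝ) * I) / 2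
  let b : ℝ × ℝ × ℝ → ℂ := fun x =>
    ((x.2.1 + x.2.2 : ℝ) + (x.1 - (1 + x.2.1 * x.2.2) / x.1 : ℝ) * I) / 2
  have ha : ∀ x (hx : 0 < x.1), cayleyα (slChart x hx) = a x := fun x hx => by
    simp [a, cayleyα, slChart]
  have hb : ∀ x (hx : 0 < x.1), cayleyβ (slChart x hx) = b x := fun x hx => by
    simp [b, cayleyβ, slChart]
  have hn : ∀ x ∈ slDomain, normSq (a x) - normSq (b x) = 1 := fun x hx => by
    rw [← ha x hx.1, ← hb x hx.1, normSq_cayley]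
  have har : ∀ x ∈ slDomain, 0 < (a x).re := fun x hx => by
    have := hx.2
    simp only [a]
    simp
    linarith
  let ζ : ℝ × ℝ × ℝ → ℂ := fun x =>
    (conj (a x) * conj β' + conj (b x) * α') / (a x * α' + b x * conj β')
  let κ : ℝ × ℝ × ℝ → ℂ := fun x =>
    exp (log (a x) * (-(s : ℂ))) * exp (log (-conj β' * (-b x / a x) + α') * (-(s : ℂ)))
  have hslit : ∀ x ∈ slDomain, -conj β' * (-b x / a x) + α' ∈ slitPlane := fun x hx => by
    refine mem_slitPlane h' hα' (mem_ball_zero_iff.1 ?_)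
    simpa using moebius_mem (hn x hx) (har x hx) (mem_ball_self one_pos)
  have hden : ∀ x ∈ slDomain, a x * α' + b x * conj β' ≠ 0 := fun x hx h0 => by
    have e1 : normSq (a x * α' + b x * conj β') -
        normSq (conj (a x) * conj β' + conj (b x) * α') =
        (normSq (a x) - normSq (b x)) * (normSq α' - normSq β') := by
      simp [normSq_apply]; ring
    rw [h0, hn x hx, h', map_zero] at e1
    linarith [normSq_nonneg (conj (a x) * conj β' + conj (b x) * α')]
  have horb : ∀ x ∈ slDomain,
      orbitMap s (discreteSeries s g hg (unitVector hs)) x = κ x • kernelMap hs (ζ x) := by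
    intro x hx
    obtain ⟨h1, h2⟩ := cocycle s (hn x hx) (har x hx) h' hα'
    rw [orbitMap, dif_pos hx, kernelMap, dif_pos h1, ← map_smul]
    congr 1
    ext z
    by_cases hz : z ∈ ball (0 : ℂ) 1
    · have hT := moebius_mem (hn x hx) (har x hx) hz
      have hT' := moebius_mem h' hα' hT
      have e := h2 z hz
      rw [cpow_def_of_ne_zero (slitPlane_ne_zero (Or.inl (har x hx))),
        cpow_def_of_ne_zero (slitPlane_ne_zero (hslit x hx))] at e
      simp only [discreteSeries, discreteSeriesFun, unitVector, ofBounded, kernelVector,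
        LinearMap.coe_mk, AddHom.coe_mk, Submodule.coe_smul, Pi.smul_apply, smul_eq_mul,
        Set.indicator_of_mem hz, ha, hb]
      rw [Set.indicator_of_mem hT, ← hα'd, ← hβ'd, Set.indicator_of_mem hT', mul_one]
      exact e
    · simp [discreteSeries, discreteSeriesFun, kernelVector, ofBounded, Set.indicator_of_notMem hz]
  have hofReal : ContDiff ℝ ∞ (fun t : ℝ => (t : ℂ)) := ofRealCLM.contDiff
  have hd : ContDiffOn ℝ ∞ (fun x : ℝ × ℝ × ℝ => (1 + x.2.1 * x.2.2) / x.1) slDomain :=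
    ContDiffOn.div (by fun_prop) (by fun_prop) fun x hx => hx.1.ne'
  have sa : ContDiffOn ℝ ∞ a slDomain := by
    refine ContDiffOn.div_const (ContDiffOn.add ?_ (ContDiffOn.mul ?_ contDiffOn_const)) 2
    · exact hofReal.comp_contDiffOn (contDiffOn_fst.add hd)
    · exact hofReal.comp_contDiffOn (by fun_prop)
  have sb : ContDiffOn ℝ ∞ b slDomain := by
    refine ContDiffOn.div_const (ContDiffOn.add ?_ (ContDiffOn.mul ?_ contDiffOn_const)) 2
    · exact hofReal.comp_contDiffOn (by fun_prop)
    · exact hofReal.comp_contDiffOn (contDiffOn_fst.sub hd)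
  have hconj : ContDiff ℝ ∞ (fun w : ℂ => conj w) := conjCLE.contDiff
  have sdiv : ∀ f k : ℝ × ℝ × ℝ → ℂ, ContDiffOn ℝ ∞ f slDomain → ContDiffOn ℝ ∞ k slDomain →
      (∀ x ∈ slDomain, k x ≠ 0) → ContDiffOn ℝ ∞ (fun x => f x / k x) slDomain :=
    fun f k hf hk h0 => by
      simp only [div_eq_mul_inv]
      exact hf.mul (hk.inv h0)
  have slog : ∀ f : ℝ × ℝ × ℝ → ℂ, ContDiffOn ℝ ∞ f slDomain →
      (∀ x ∈ slDomain, f x ∈ slitPlane) →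
      ContDiffOn ℝ ∞ (fun x => exp (log (f x) * (-(s : ℂ)))) slDomain := fun f hf h0 => by
    refine Complex.contDiff_exp.comp_contDiffOn (ContDiffOn.mul ?_ contDiffOn_const)
    exact fun x hx => ((contDiffAt_log (h0 x hx)).restrict_scalars ℝ).comp_contDiffWithinAt x
      (hf x hx)
  have sκ : ContDiffOn ℝ ∞ κ slDomain := by
    refine (slog a sa fun x hx => Or.inl (har x hx)).mul (slog _ ?_ hslit)
    refine (contDiffOn_const.mul (sdiv _ _ sb.neg sa fun x hx => ?_)).add contDiffOn_const
    exact slitPlane_ne_zero (Or.inl (har x hx))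
  have sζ : ContDiffOn ℝ ∞ ζ slDomain := by
    refine sdiv _ _ ?_ ((sa.mul contDiffOn_const).add (sb.mul contDiffOn_const)) hden
    exact ((hconj.comp_contDiffOn sa).mul contDiffOn_const).add
      ((hconj.comp_contDiffOn sb).mul contDiffOn_const)
  change ContDiffOn ℝ ∞ _ _
  refine (sκ.smul ((contDiffOn_kernelMap hs).comp sζ fun x hx => ?_)).congr horb
  exact mem_ball_zero_iff.2 (cocycle s (hn x hx) (har x hx) h' hα').1

/-! ### The group `G`, the spaces `L^p_r(G)` and the coorbit spaces -/

/-- The group of upper triangular matrices in `SL(2,ℝ)` with positive diagonal. -/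
def axbGroup : Subgroup (Matrix.SpecialLinearGroup (Fin 2) ℝ) where
  carrier := {g | g 1 0 = 0 ∧ 0 < g 0 0}
  one_mem' := by simp
  mul_mem' := by
    rintro g h ⟨hg, hg'⟩ ⟨hh, hh'⟩
    simp only [Set.mem_ofPred_eq, Matrix.SpecialLinearGroup.coe_mul, Matrix.mul_apply,
      Fin.sum_univ_two, hg, hh]
    constructor
    · ring
    · nlinarith [mul_pos hg' hh']
  inv_mem' := by
    rintro g ⟨hg, hg'⟩
    have h := g.det_coe
    rw [Matrix.det_fin_two, hg] at h
    simp only [Set.mem_ofPred_eq, Matrix.SpecialLinearGroup.coe_inv, Matrix.adjugate_fin_two]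
    simp [hg]
    nlinarith

lemma trace_pos (x : axbGroup) : 0 < x.1 0 0 + x.1 1 1 := by
  have h := x.1.det_coe
  obtain ⟨h1, h2⟩ := x.2
  rw [Matrix.det_fin_two, h1] at h
  have : 0 < x.1 1 1 := by
    by_contra hc
    nlinarith
  linarith

/-- The coordinates `(a, b)` on `G`. -/
def axbCoord (x : axbGroup) : ℝ × ℝ := (x.1 0 0, x.1 0 1)

/-- The Borel structure of `G`, read in the coordinates `(a, b)`. -/
instance : MeasurableSpace axbGroup := MeasurableSpace.comap axbCoord inferInstance

/-- The left Haar measure `da db / a²`. -/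
def axbHaar : Measure axbGroup :=
  Measure.comap axbCoord (volume.withDensity fun x : ℝ × ℝ => ENNReal.ofReal (1 / x.1 ^ 2))

/-- The weight `w_r(a, b) = 2^r ((a + a⁻¹)² + b²)^(r/2)`. -/
def axbWeight (r : ℝ) (x : axbGroup) : ℝ :=
  2 ^ r * (((axbCoord x).1 + (axbCoord x).1⁻¹) ^ 2 + (axbCoord x).2 ^ 2) ^ (r / 2)

/-- Membership in `L^p_r(G)`. -/
def MemWeightedLp (p : ℝ≥0∞) (r : ℝ) (F : axbGroup → ℂ) : Prop :=
  MemLp (fun x => F x * axbWeight r x) p axbHaar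

/-- The norm `(∫_G |F w_r|^p da db / a²)^(1/p)` of `L^p_r(G)`. -/
def weightedLpNorm (p : ℝ≥0∞) (r : ℝ) (F : axbGroup → ℂ) : ℝ :=
  (eLpNorm (fun x => F x * axbWeight r x) p axbHaar).toReal

/-- The smooth vector `π_s(x)u`. -/
def translate {s : ℝ} (hs : 1 < s) (x : axbGroup) : SmoothVector s :=
  ⟨discreteSeries s x.1 (trace_pos x) (unitVector hs),
    translate_mem_smoothVectors hs x.1 (trace_pos x)⟩

/-- The wavelet transform `W_u(φ)(x) = ⟨φ, π_s(x)u⟩`. -/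
def wavelet {s : ℝ} (hs : 1 < s) (φ : Distribution s) (x : axbGroup) : ℂ := φ (translate hs x)

/-- The coorbit space of `L^p_r(G)` for the wavelet `u` and the smooth vectors `H_s^∞`. -/
def coorbit {s : ℝ} (hs : 1 < s) (p : ℝ≥0∞) (r : ℝ) : Submodule ℂ (Distribution s) where
  carrier := {φ | MemWeightedLp p r (wavelet hs φ)}
  add_mem' {φ ψ} hφ hψ := by
    have h := MemLp.add hφ hψ
    refine (memLp_congr_ae (.of_forall fun x => ?_)).1 h
    exact (add_mul (wavelet hs φ x) (wavelet hs ψ x) _).symm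
  zero_mem' := by
    refine (memLp_congr_ae (.of_forall fun x => ?_)).1 (MemLp.zero (ε := ℂ))
    exact (zero_mul (axbWeight r x : ℂ)).symm
  smul_mem' c φ hφ := by
    have h := MemLp.const_smul hφ c
    refine (memLp_congr_ae (.of_forall fun x => ?_)).1 h
    exact (mul_assoc c (wavelet hs φ x) _).symm

/-- The coorbit norm `‖W_u(φ)‖` in `L^p_r(G)`. -/
def coorbitNorm {s : ℝ} (hs : 1 < s) (p : ℝ≥0∞) (r : ℝ) (φ : Distribution s) : ℝ :=
  weightedLpNorm p r (wavelet hs φ)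

end BergmanCoorbit

end

open BergmanCoorbit

noncomputable section

namespace BergmanCoorbit

/-! The proof diagonalises everything on monomials. By rotation invariance the `z ^ k` are
orthogonal for the measure of `H_s`, and `‖z ^ k‖² = 1 / c_k`, where `c_k` is the `k`-th coefficient
of `(1 - w)^(-s)` (`setIntegral_monomial`, `integral_normSq_pow`). So pairing an integrable
holomorphic function `∑ a_k z ^ k` with `z ^ k` gives `a_k / c_k`.

The analytic core is that the Taylor series of a smooth vector converges in the Fréchet topology
(`hasSum_smoothVector`). This needs two estimates. Along the rotation subgroup the `k`-th
coefficient is multiplied by `exp (-i (s + 2k) θ)`, so differentiating `N` times produces a factor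
of size `(s + 2k) ^ N`; hence the coefficients decay faster than any power of `k`, with bounds by
the seminorms (`norm_taylorCoeff_le`). Conversely `π_s(x)v = (v ∘ T_x) · π_s(x)u` with `T_x` a
Möbius map, and `v ∘ T_x = ∑ a_k T_x ^ k` in the Banach algebra `C(ClosedDisk, ℂ)`. Derivatives of
order `n` of `T_x ^ k` grow like `k ^ n`, so a weighted `ℓ¹` norm of the coefficients bounds each
seminorm (`smoothSeminorm_le_tsum`).

Consequently a distribution `φ` is determined by the numbers `φ(z ^ k)`. For `x` in `G` put `w = β /
ᾱ`; then `π_s(x)u = α^(-s) (1 - w̄ z)^(-s)`, and expanding gives `W_u(φ)(x) = ᾱ^(-s) F(w)` with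
`F(w) = ∑ c_k φ(z ^ k) w ^ k` (`hasSum_wavelet`). Since `w` runs through the whole disc, `F` is
holomorphic there and determines `φ`. If `φ = φ_f`, the `c_k` cancel and `F = f`: this is the
reproducing formula.

It remains to compare norms. One has `|α|² = 1 / (1 - |w|²)` and `w_r = 2^(2r) |α|^r`, while `da db
/ a²` becomes `2 (1 - |w|²)^(-2) dw`. Hence the weighted `L^p` norm of `ᾱ^(-s) F(w)` is exactly
`2^(2r + 1/p)` times the Bergman norm of `F`, finite or not (`eLpNorm_wavelet`). For surjectivity,
`F` lies in the Bergman space by this identity, is integrable for the measure of `H_s` by Hölder,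
and `φ_F`, having the same wavelet transform as `φ`, equals `φ`. -/

/-! ### The binomial coefficients of `(1 - w)^(-s)` -/

/-- The coefficient `s(s + 1)⋯(s + k - 1)/k!` of `w^k` in `(1 - w)^(-s)`. -/
def kernelCoeff (s : ℝ) (k : ℕ) : ℝ := ∏ j ∈ Finset.range k, (s + j) / (j + 1)

lemma kernelCoeff_succ (s : ℝ) (k : ℕ) :
    kernelCoeff s (k + 1) = kernelCoeff s k * ((s + k) / (k + 1)) :=
  Finset.prod_range_succ _ _

lemma kernelCoeff_pos {s : ℝ} (hs : 1 < s) (k : ℕ) : 0 < kernelCoeff s k :=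
  Finset.prod_pos fun j _ => by positivity

/-- Each ratio of consecutive coefficients is `1 + (s - 1) / (k + 1)`, at most `(1 + 1 / (k + 1)) ^
m` by Bernoulli's inequality, and the product of these bounds telescopes. Polynomial growth is all
that the decay estimate for Taylor coefficients has to absorb. -/
lemma kernelCoeff_le {s : ℝ} (hs : 1 < s) {m : ℕ} (hm : s - 1 ≤ m) (k : ℕ) :
    kernelCoeff s k ≤ (k + 1 : ℝ) ^ m := by
  induction k with
  | zero => simp [kernelCoeff]
  | succ k ih =>
    have h1 : (s + k) / (k + 1) ≤ (1 + 1 / (k + 1 : ℝ)) ^ m := by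
      have h2 := one_add_mul_le_pow (a := 1 / (k + 1 : ℝ)) (by
        have : 0 ≤ 1 / (k + 1 : ℝ) := by positivity
        linarith) m
      refine le_trans ?_ h2
      rw [div_le_iff₀ (by positivity)]
      field_simp
      linarith
    rw [kernelCoeff_succ]
    calc kernelCoeff s k * ((s + k) / (k + 1))
        ≤ (k + 1 : ℝ) ^ m * (1 + 1 / (k + 1 : ℝ)) ^ m := by
          gcongr
      _ = ((k + 1 : ℕ) + 1 : ℝ) ^ m := by
          rw [← mul_pow]
          congr 1
          push_cast
          field_simp

/-- Bridge to the binomial series of Mathlib, whose coefficients are generalized binomial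
coefficients; both sides times `k!` are the rising factorial of `s`. -/
lemma kernelCoeff_eq_choose (s : ℝ) (k : ℕ) :
    Ring.choose ((s : ℂ) + k - 1) k = (kernelCoeff s k : ℂ) := by
  have h1 := Ring.factorial_nsmul_multichoose_eq_ascPochhammer (s : ℂ) k
  rw [Polynomial.ascPochhammer_smeval_eq_eval] at h1
  rw [Ring.choose, show (s : ℂ) + k - 1 - k + 1 = s by ring]
  have h2 : (ascPochhammer ℂ k).eval (s : ℂ) = k.factorial * (kernelCoeff s k : ℂ) := by
    clear h1
    induction k with
    | zero => simp [kernelCoeff]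
    | succ k ih =>
      have hk : (k + 1 : ℂ) ≠ 0 := by exact_mod_cast k.succ_ne_zero
      rw [ascPochhammer_succ_eval, ih, kernelCoeff_succ, Nat.factorial_succ]
      push_cast
      field_simp
  rw [h2, nsmul_eq_mul] at h1
  exact mul_left_cancel₀ (by exact_mod_cast k.factorial_ne_zero) h1

lemma hasSum_kernel (s : ℝ) {w : ℂ} (hw : ‖w‖ < 1) :
    HasSum (fun k => (kernelCoeff s k : ℂ) * w ^ k) ((1 - w) ^ (-(s : ℂ))) := by
  have h := (one_div_one_sub_cpow_hasFPowerSeriesOnBall_zero (s : ℂ)).hasSum (y := w)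
    (by simpa [Metric.eball, edist_zero_right, ← ofReal_norm, ENNReal.ofReal_lt_one] using hw)
  rw [zero_add, one_div, ← cpow_neg] at h
  simpa only [FormalMultilinearSeries.ofScalars_apply_eq, kernelCoeff_eq_choose, smul_eq_mul]
    using h

/-! ### Moments of the measure of `H_s` -/

lemma integral_hilbertMeasure {s : ℝ} (hs : 1 < s) {E : Type*} [NormedAddCommGroup E]
    [NormedSpace ℝ E] (g : ℂ → E) :
    ∫ z, g z ∂(hilbertMeasure s) =
      ((s - 1) / Real.pi) • ∫ z in ball (0 : ℂ) 1, (1 - ‖z‖ ^ 2) ^ (s - 2) • g z := by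
  rw [hilbertMeasure, integral_smul_measure, ENNReal.toReal_ofReal
    (div_nonneg (by linarith) Real.pi_pos.le), diskMeasure]
  congr 1
  have : (fun z : ℂ => ENNReal.ofReal ((1 - ‖z‖ ^ 2) ^ (s - 2))) =
      fun z => ((Real.toNNReal ((1 - ‖z‖ ^ 2) ^ (s - 2)) : NNReal) : ℝ≥0∞) := rfl
  rw [this, integral_withDensity_eq_integral_smul₀ (by fun_prop)]
  refine setIntegral_congr_fun measurableSet_ball fun z hz => ?_
  have hz2 : 0 ≤ 1 - ‖z‖ ^ 2 := by nlinarith [norm_nonneg z, mem_ball_zero_iff.1 hz]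
  change Real.toNNReal _ • g z = _
  rw [NNReal.smul_def, Real.coe_toNNReal _ (Real.rpow_nonneg hz2 _)]

lemma integral_hilbertMeasure_rotation {s : ℝ} (hs : 1 < s) (c : Circle) (g : ℂ → ℂ) :
    ∫ z, g (c * z) ∂(hilbertMeasure s) = ∫ z, g z ∂(hilbertMeasure s) := by
  rw [integral_hilbertMeasure hs, integral_hilbertMeasure hs]
  congr 1
  have hm := (rotation c).measurePreserving
  rw [← hm.setIntegral_preimage_emb (rotation c).toHomeomorph.measurableEmbedding
    (fun z => (1 - ‖z‖ ^ 2) ^ (s - 2) • g z)]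
  have : (rotation c) ⁻¹' ball 0 1 = ball 0 1 := by
    ext z
    rw [Set.mem_preimage, mem_ball_zero_iff, mem_ball_zero_iff, LinearIsometryEquiv.norm_map]
  rw [this]
  simp only [rotation_apply, norm_mul, Circle.norm_coe, one_mul]

/-- Rotation by the angle `π / (j - k)` preserves the measure and multiplies the integrand by `exp
(iπ) = -1`, so the integral equals its own negative. No integrability is involved. -/
lemma setIntegral_monomial {s : ℝ} (hs : 1 < s) (R : ℝ) {j k : ℕ} (hjk : j ≠ k) :
    ∫ z in ball (0 : ℂ) R, z ^ j * conj z ^ k ∂(hilbertMeasure s) = 0 := by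
  rw [← integral_indicator measurableSet_ball]
  set g : ℂ → ℂ := (ball (0 : ℂ) R).indicator fun z => z ^ j * conj z ^ k with hg
  set t : ℝ := Real.pi / ((j : ℝ) - k) with ht
  have hne : (j : ℝ) - k ≠ 0 := sub_ne_zero.2 (by exact_mod_cast hjk)
  have h1 := integral_hilbertMeasure_rotation hs (Circle.exp t) g
  have h2 : ∀ z, g (Circle.exp t * z) = -g z := by
    intro z
    have h3 : ((Circle.exp t : ℂ)) ^ j * conj (Circle.exp t : ℂ) ^ k = -1 := by
      rw [Circle.coe_exp, ← exp_conj, ← exp_nat_mul, ← exp_nat_mul, ← exp_add, ← exp_pi_mul_I]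
      congr 1
      have hne' : (j : ℂ) - k ≠ 0 := by exact_mod_cast hne
      rw [ht]
      push_cast
      simp only [map_mul, conj_I, map_div₀, map_sub, conj_ofReal, map_natCast]
      field_simp
      ring
    by_cases hz : z ∈ ball (0 : ℂ) R
    · have hz' : (Circle.exp t : ℂ) * z ∈ ball (0 : ℂ) R := by simpa using hz
      rw [hg, Set.indicator_of_mem hz, Set.indicator_of_mem hz', mul_pow, map_mul, mul_pow]
      linear_combination (z ^ j * conj z ^ k) * h3
    · have hz' : (Circle.exp t : ℂ) * z ∉ ball (0 : ℂ) R := by simpa using hz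
      rw [hg, Set.indicator_of_notMem hz, Set.indicator_of_notMem hz', neg_zero]
  simp only [h2, integral_neg] at h1
  exact self_eq_neg.1 h1.symm

/-- Polar coordinates turn the moment into a multiple of `J k`. The function `y ^ (2k+2) (1 -
y²)^(s-1)` vanishes at `0` and `1`, so its derivative integrates to zero; this gives `(k + 1) J k =
(k + s) J (k + 1)`, the recursion of the inverse coefficients. -/
lemma integral_normSq_pow {s : ℝ} (hs : 1 < s) (k : ℕ) :
    ∫ z, ‖z‖ ^ (2 * k) ∂(hilbertMeasure s) = (kernelCoeff s k)⁻¹ := by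
  let J : ℕ → ℝ := fun k => ∫ y in (0 : ℝ)..1, y ^ (2 * k + 1) * (1 - y ^ 2) ^ (s - 2)
  have hJ : ∀ k, ∫ z, ‖z‖ ^ (2 * k) ∂(hilbertMeasure s) = 2 * (s - 1) * J k := by
    intro k
    rw [integral_hilbertMeasure hs, ← integral_indicator measurableSet_ball]
    have e : (ball (0 : ℂ) 1).indicator (fun z => (1 - ‖z‖ ^ 2) ^ (s - 2) • ‖z‖ ^ (2 * k)) =
        fun z => (Set.Iio (1 : ℝ)).indicator
          (fun y => (1 - y ^ 2) ^ (s - 2) * y ^ (2 * k)) ‖z‖ := by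
      funext z
      by_cases hz : ‖z‖ < 1 <;> simp [Set.indicator, hz]
    rw [e, integral_fun_norm_addHaar volume, Complex.finrank_real_complex]
    have h2 : (volume : Measure ℂ).real (ball (0 : ℂ) 1) = Real.pi := by
      simp [Measure.real, Complex.volume_ball]
    have h3 : ∫ y in Set.Ioi (0 : ℝ), y ^ (2 - 1) • (Set.Iio (1 : ℝ)).indicator
          (fun y => (1 - y ^ 2) ^ (s - 2) * y ^ (2 * k)) y = J k := by
      have : ∀ y : ℝ, y ^ (2 - 1) • (Set.Iio (1 : ℝ)).indicator
          (fun y => (1 - y ^ 2) ^ (s - 2) * y ^ (2 * k)) y =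
          (Set.Iio (1 : ℝ)).indicator (fun y => y ^ (2 * k + 1) * (1 - y ^ 2) ^ (s - 2)) y := by
        intro y
        by_cases hy : y < 1
        · simp [Set.indicator, hy]; ring
        · simp [Set.indicator, hy]
      simp only [this]
      rw [setIntegral_indicator measurableSet_Iio, Set.Ioi_inter_Iio,
        ← integral_Ioc_eq_integral_Ioo, ← intervalIntegral.integral_of_le zero_le_one]
    rw [h2, h3]
    simp only [smul_eq_mul, nsmul_eq_mul]
    field_simp
    push_cast
    ring
  have hint : ∀ k, IntervalIntegrable (fun y : ℝ => y ^ (2 * k + 1) * (1 - y ^ 2) ^ (s - 2))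
      volume 0 1 := by
    intro k
    rw [intervalIntegrable_iff_integrableOn_Ioc_of_le zero_le_one]
    -- For `s < 2` the weight is unbounded at `1`; integrability holds because the integrand is the
    -- nonnegative derivative of a function continuous up to the endpoint.
    have h1 : IntegrableOn (fun y : ℝ => y * (1 - y ^ 2) ^ (s - 2)) (Set.Ioc 0 1) := by
      refine intervalIntegral.integrableOn_deriv_of_nonneg
        (g := fun y : ℝ => -((1 - y ^ 2) ^ (s - 1)) / (2 * (s - 1))) ?_ ?_ ?_
      · refine ContinuousOn.div_const (ContinuousOn.neg
          (ContinuousOn.rpow_const (by fun_prop) ?_)) _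
        exact fun x _ => Or.inr (by linarith)
      · intro x hx
        have hx2 : 0 < 1 - x ^ 2 := by nlinarith [hx.1, hx.2]
        have h2 : HasDerivAt (fun y : ℝ => 1 - y ^ 2) (-(2 * x)) x := by
          simpa using (hasDerivAt_pow 2 x).const_sub 1
        refine ((h2.rpow_const (p := s - 1) (Or.inl hx2.ne')).neg.div_const _).congr_deriv ?_
        have : s - 1 ≠ 0 := by linarith
        rw [show s - 1 - 1 = s - 2 by ring]
        field_simp
      · intro x hx
        exact mul_nonneg hx.1.le (Real.rpow_nonneg (by nlinarith [hx.1, hx.2]) _)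
    refine h1.mono' (by fun_prop) (ae_restrict_of_forall_mem measurableSet_Ioc fun y hy => ?_)
    have hy2 : 0 ≤ (1 - y ^ 2) ^ (s - 2) := Real.rpow_nonneg (by nlinarith [hy.1, hy.2]) _
    rw [Real.norm_of_nonneg (mul_nonneg (pow_nonneg hy.1.le _) hy2)]
    refine mul_le_mul_of_nonneg_right ?_ hy2
    rw [pow_succ]
    exact mul_le_of_le_one_left hy.1.le (pow_le_one₀ hy.1.le hy.2)
  have hder : ∀ k : ℕ, ∫ y in (0 : ℝ)..1, ((2 * k + 2) * (y ^ (2 * k + 1) * (1 - y ^ 2) ^ (s - 2)) -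
      (2 * k + 2 * s) * (y ^ (2 * (k + 1) + 1) * (1 - y ^ 2) ^ (s - 2))) = 0 := by
    intro k
    have h0 := intervalIntegral.integral_eq_sub_of_hasDerivAt_of_le (a := 0) (b := 1)
      (f := fun y : ℝ => y ^ (2 * k + 2) * (1 - y ^ 2) ^ (s - 1)) zero_le_one
      (f' := fun y : ℝ => (2 * k + 2) * (y ^ (2 * k + 1) * (1 - y ^ 2) ^ (s - 2)) -
      (2 * k + 2 * s) * (y ^ (2 * (k + 1) + 1) * (1 - y ^ 2) ^ (s - 2))) ?_ ?_
      (((hint k).const_mul _).sub ((hint (k + 1)).const_mul _))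
    · rw [h0]
      have : s - 1 ≠ 0 := by linarith
      simp [Real.zero_rpow this]
    · refine ContinuousOn.mul (by fun_prop) (ContinuousOn.rpow_const (by fun_prop) ?_)
      exact fun x _ => Or.inr (by linarith)
    · intro x hx
      have hx2 : 0 < 1 - x ^ 2 := by nlinarith [hx.1, hx.2]
      have h2 : HasDerivAt (fun y : ℝ => 1 - y ^ 2) (-(2 * x)) x := by
        simpa using (hasDerivAt_pow 2 x).const_sub 1
      have h3 := (hasDerivAt_pow (2 * k + 2) x).mul (h2.rpow_const (p := s - 1) (Or.inl hx2.ne'))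
      refine h3.congr_deriv ?_
      rw [show s - 1 - 1 = s - 2 by ring, show s - 1 = (s - 2) + 1 by ring,
        Real.rpow_add_one hx2.ne', show 2 * k + 2 - 1 = 2 * k + 1 by omega]
      push_cast
      ring
  have hrec : ∀ k : ℕ, (k + 1) * J k = (k + s) * J (k + 1) := by
    intro k
    have := hder k
    rw [intervalIntegral.integral_sub ((hint k).const_mul _) ((hint (k + 1)).const_mul _),
      intervalIntegral.integral_const_mul, intervalIntegral.integral_const_mul] at this
    change (2 * k + 2) * J k - (2 * k + 2 * s) * J (k + 1) = 0 at this
    linarith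
  have hzero : J 0 = 1 / (2 * (s - 1)) := by
    have hs1 : s - 1 ≠ 0 := by linarith
    have h0 := intervalIntegral.integral_eq_sub_of_hasDerivAt_of_le (a := 0) (b := 1)
      (f := fun y : ℝ => -((1 - y ^ 2) ^ (s - 1)) / (2 * (s - 1))) zero_le_one
      (f' := fun y : ℝ => y ^ (2 * 0 + 1) * (1 - y ^ 2) ^ (s - 2)) ?_ ?_ (hint 0)
    · change J 0 = _ at h0
      rw [h0]
      simp [Real.zero_rpow hs1]
      field_simp
    · refine ContinuousOn.div_const (ContinuousOn.neg
          (ContinuousOn.rpow_const (by fun_prop) ?_)) _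
      exact fun x _ => Or.inr (by linarith)
    · intro x hx
      have hx2 : 0 < 1 - x ^ 2 := by nlinarith [hx.1, hx.2]
      have h2 : HasDerivAt (fun y : ℝ => 1 - y ^ 2) (-(2 * x)) x := by
        simpa using (hasDerivAt_pow 2 x).const_sub 1
      refine ((h2.rpow_const (p := s - 1) (Or.inl hx2.ne')).neg.div_const _).congr_deriv ?_
      rw [show s - 1 - 1 = s - 2 by ring]
      field_simp
      ring
  rw [hJ]
  induction k with
  | zero =>
    rw [hzero]
    have : s - 1 ≠ 0 := by linarith
    simp [kernelCoeff]
    field_simp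
  | succ k ih =>
    have h1 : J (k + 1) = (k + 1) / (s + k) * J k := by
      have h2 : (0 : ℝ) < s + k := by positivity
      field_simp
      linarith [hrec k]
    rw [h1, kernelCoeff_succ, mul_inv, ← ih, inv_div]
    ring

lemma integral_monomial {s : ℝ} (hs : 1 < s) (k : ℕ) :
    ∫ z, z ^ k * conj z ^ k ∂(hilbertMeasure s) = ((kernelCoeff s k)⁻¹ : ℝ) := by
  rw [← integral_normSq_pow hs]
  refine Eq.trans ?_ integral_ofReal
  congr 1
  funext z
  rw [← mul_pow, mul_conj, normSq_eq_norm_sq, pow_mul]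
  push_cast
  rfl

/-- On a ball of radius `R < 1` the series is dominated by its absolutely convergent value at `R`,
so it may be integrated term by term, and orthogonality leaves a single term. -/
lemma setIntegral_powerSeries {s : ℝ} (hs : 1 < s) {b : ℕ → ℂ} {f : ℂ → ℂ}
    (hb : ∀ z ∈ ball (0 : ℂ) 1, HasSum (fun k => b k * z ^ k) (f z)) {R : ℝ} (h0 : 0 ≤ R)
    (h1 : R < 1) (k : ℕ) :
    ∫ z in ball (0 : ℂ) R, f z * conj z ^ k ∂(hilbertMeasure s) =
      b k * ∫ z in ball (0 : ℂ) R, z ^ k * conj z ^ k ∂(hilbertMeasure s) := by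
  have := isFiniteMeasure_hilbertMeasure hs
  set ν := (hilbertMeasure s).restrict (ball 0 R) with hν
  have hbd : ∀ j, ∀ᵐ z ∂ν, ‖b j * z ^ j * conj z ^ k‖ ≤ ‖b j * (R : ℂ) ^ j‖ := fun j => by
    refine ae_restrict_of_forall_mem measurableSet_ball fun z hz => ?_
    have hz' := (mem_ball_zero_iff.1 hz).le
    simp only [norm_mul, norm_pow, RCLike.norm_conj, norm_real, Real.norm_of_nonneg h0]
    refine (mul_le_of_le_one_right (by positivity)
      (pow_le_one₀ (norm_nonneg z) (by linarith))).trans (by gcongr)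
  have hint : ∀ j, Integrable (fun z => b j * z ^ j * conj z ^ k) ν := fun j =>
    Integrable.of_bound (by fun_prop) _ (hbd j)
  have hsum : Summable fun j => ‖b j * (R : ℂ) ^ j‖ :=
    (hb R (by simpa [abs_of_nonneg h0] using h1)).summable.norm
  have key := hasSum_integral_of_summable_integral_norm hint (by
    refine Summable.of_nonneg_of_le (fun j => integral_nonneg fun z => norm_nonneg _) (fun j => ?_)
      (hsum.mul_right (ν.real Set.univ))
    have := integral_mono_ae (hint j).norm (integrable_const ‖b j * (R : ℂ) ^ j‖) (hbd j)
    rw [integral_const, smul_eq_mul, mul_comm] at this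
    exact this)
  have e1 : ∫ z, ∑' j, b j * z ^ j * conj z ^ k ∂ν = ∫ z, f z * conj z ^ k ∂ν := by
    refine integral_congr_ae (ae_restrict_of_forall_mem measurableSet_ball fun z hz => ?_)
    exact ((hb z (ball_subset_ball h1.le hz)).mul_right (conj z ^ k)).tsum_eq
  rw [e1] at key
  refine key.unique ?_
  have e2 : ∀ j, ∫ z, b j * z ^ j * conj z ^ k ∂ν = b j * ∫ z, z ^ j * conj z ^ k ∂ν := fun j => by
    rw [← integral_const_mul]
    simp only [mul_assoc]
  simp only [e2]
  refine hasSum_single k fun j hj => ?_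
  rw [hν, setIntegral_monomial hs R hj, mul_zero]

lemma iUnion_ball_eq : ⋃ n : ℕ, ball (0 : ℂ) (1 - 1 / (n + 1)) = ball 0 1 := by
  ext z
  simp only [Set.mem_iUnion, mem_ball_zero_iff]
  constructor
  · rintro ⟨n, hn⟩
    have : (0 : ℝ) < 1 / (n + 1) := by positivity
    linarith
  · intro hz
    obtain ⟨n, hn⟩ := exists_nat_one_div_lt (sub_pos.2 hz)
    exact ⟨n, by linarith⟩

lemma tendsto_setIntegral_ball {s : ℝ} {g : ℂ → ℂ}
    (hg : Integrable g (hilbertMeasure s)) :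
    Filter.Tendsto (fun n : ℕ => ∫ z in ball (0 : ℂ) (1 - 1 / (n + 1)), g z ∂(hilbertMeasure s))
      Filter.atTop (nhds (∫ z, g z ∂(hilbertMeasure s))) := by
  have h := tendsto_setIntegral_of_monotone (μ := hilbertMeasure s) (f := g)
    (s := fun n : ℕ => ball (0 : ℂ) (1 - 1 / (n + 1))) (fun n => measurableSet_ball)
    (fun m n hmn => ball_subset_ball (by gcongr)) hg.integrableOn
  rw [iUnion_ball_eq] at h
  rwa [Measure.restrict_eq_self_of_ae_mem (ae_hilbertMeasure fun z hz => hz)] at h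

/-- The moments of an integrable holomorphic function are its Taylor coefficients. -/
lemma integral_mul_conj_pow {s : ℝ} (hs : 1 < s) {b : ℕ → ℂ} {f : ℂ → ℂ}
    (hb : ∀ z ∈ ball (0 : ℂ) 1, HasSum (fun k => b k * z ^ k) (f z))
    (hf : Integrable f (hilbertMeasure s)) (k : ℕ) :
    ∫ z, f z * conj z ^ k ∂(hilbertMeasure s) = b k / kernelCoeff s k := by
  have := isFiniteMeasure_hilbertMeasure hs
  have hbd : ∀ᵐ z ∂(hilbertMeasure s), ‖conj z ^ k‖ ≤ 1 := ae_hilbertMeasure fun z hz => by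
    rw [norm_pow, RCLike.norm_conj]
    exact pow_le_one₀ (norm_nonneg z) (mem_ball_zero_iff.1 hz).le
  -- The series may diverge on the unit circle, so both integrals over the disc are taken as limits
  -- over balls of radius `1 - 1 / (n + 1)`, on each of which the termwise identity holds.
  have h1 := tendsto_setIntegral_ball (hf.mul_bdd (c := 1) (by fun_prop) hbd)
  have h2 := (tendsto_setIntegral_ball (s := s) (g := fun z => z ^ k * conj z ^ k) (by
    refine Integrable.of_bound (by fun_prop) 1 (ae_hilbertMeasure fun z hz => ?_)
    rw [norm_mul, norm_pow, norm_pow, RCLike.norm_conj]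
    have := pow_le_one₀ (n := k) (norm_nonneg z) (mem_ball_zero_iff.1 hz).le
    exact mul_le_one₀ this (by positivity) this)).const_mul (b k)
  rw [integral_monomial hs] at h2
  have := tendsto_nhds_unique h1 (h2.congr fun n => ?_)
  · rw [this, div_eq_mul_inv, ofReal_inv]
  · refine (setIntegral_powerSeries hs hb ?_ ?_ k).symm
    · rw [sub_nonneg, div_le_one (by positivity)]
      simp
    · simp only [sub_lt_self_iff]; positivity

/-! ### Iterated derivatives of series and powers on open sets -/

section Calculus

variable {E : Type*} [NormedAddCommGroup E] [NormedSpace ℝ E]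

/-- Termwise differentiation, by induction on the order, on an open set because the Möbius maps are
smooth only on the chart. The second conclusion is restricted to `i < n` since differentiating the
`i`-th derivative uses the bound of order `i + 1`. -/
lemma iteratedFDerivWithin_tsum {F : Type*} [NormedAddCommGroup F] [NormedSpace ℝ F]
    [CompleteSpace F] {U : Set E} (hU : IsOpen U)
    (hc : IsPreconnected U) {f : ℕ → E → F} (hf : ∀ k, ContDiffOn ℝ ∞ (f k) U) {v : ℕ → ℕ → ℝ}
    {n : ℕ} (hv : ∀ i ≤ n, Summable (v i))
    (hb : ∀ i ≤ n, ∀ k, ∀ x ∈ U, ‖iteratedFDerivWithin ℝ i (f k) U x‖ ≤ v i k) {i : ℕ}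
    (hi : i ≤ n) {x : E} (hx : x ∈ U) :
    iteratedFDerivWithin ℝ i (fun y => ∑' k, f k y) U x =
        ∑' k, iteratedFDerivWithin ℝ i (f k) U x ∧
      (i < n → HasFDerivAt (iteratedFDerivWithin ℝ i (fun y => ∑' k, f k y) U)
        (∑' k, fderivWithin ℝ (iteratedFDerivWithin ℝ i (f k) U) U x) x) := by
  have hud := hU.uniqueDiffOn (𝕜 := ℝ)
  have key : ∀ i < n, (∀ y ∈ U, iteratedFDerivWithin ℝ i (fun y => ∑' k, f k y) U y =
      ∑' k, iteratedFDerivWithin ℝ i (f k) U y) → ∀ y ∈ U,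
      HasFDerivAt (iteratedFDerivWithin ℝ i (fun y => ∑' k, f k y) U)
        (∑' k, fderivWithin ℝ (iteratedFDerivWithin ℝ i (f k) U) U y) y := by
    intro i hi ih y hy
    have h1 : HasFDerivAt (fun z => ∑' k, iteratedFDerivWithin ℝ i (f k) U z)
        (∑' k, fderivWithin ℝ (iteratedFDerivWithin ℝ i (f k) U) U y) y := by
      refine hasFDerivAt_tsum_of_isPreconnected (hv (i + 1) hi) hU hc (fun k z hz => ?_)
        (fun k z hz => ?_) hy (.of_norm_bounded (hv i hi.le) fun k => hb i hi.le k y hy) hy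
      · have hd := (hf k).differentiableOn_iteratedFDerivWithin (m := i)
          (by exact_mod_cast WithTop.coe_lt_top _) hud
        exact (hd z hz).hasFDerivWithinAt.hasFDerivAt (hU.mem_nhds hz)
      · rw [norm_fderivWithin_iteratedFDerivWithin]
        exact hb (i + 1) hi k z hz
    exact h1.congr_of_eventuallyEq (Filter.eventuallyEq_of_mem (hU.mem_nhds hy) ih)
  suffices H : ∀ i ≤ n, ∀ y ∈ U, iteratedFDerivWithin ℝ i (fun y => ∑' k, f k y) U y =
      ∑' k, iteratedFDerivWithin ℝ i (f k) U y from
    ⟨H i hi x hx, fun h => key i h (H i hi) x hx⟩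
  intro i
  induction i with
  | zero =>
    intro _ y hy
    simp_rw [iteratedFDerivWithin_zero_eq_comp]
    exact (continuousMultilinearCurryFin0 ℝ E F).symm.toContinuousLinearEquiv.map_tsum
  | succ i ih =>
    intro hi y hy
    have h1 := key i hi (ih (Nat.le_of_succ_le hi)) y hy
    simp_rw [iteratedFDerivWithin_succ_eq_comp_left, Function.comp_apply]
    rw [h1.hasFDerivWithinAt.fderivWithin (hud y hy)]
    exact (continuousMultilinearCurryLeftEquiv ℝ
        (fun _ : Fin (i + 1) => E) F).symm.toContinuousLinearEquiv.map_tsum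

/-- One order is lost: smoothness of order `n` is deduced from differentiability of the derivatives
up to order `n`, which needs summable bounds up to order `n + 1`. -/
lemma contDiffOn_tsum {F : Type*} [NormedAddCommGroup F] [NormedSpace ℝ F]
    [CompleteSpace F] {U : Set E} (hU : IsOpen U)
    (hc : IsPreconnected U) {f : ℕ → E → F} (hf : ∀ k, ContDiffOn ℝ ∞ (f k) U) {v : ℕ → ℕ → ℝ}
    {n : ℕ} (hv : ∀ i ≤ n + 1, Summable (v i))
    (hb : ∀ i ≤ n + 1, ∀ k, ∀ x ∈ U, ‖iteratedFDerivWithin ℝ i (f k) U x‖ ≤ v i k) :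
    ContDiffOn ℝ n (fun y => ∑' k, f k y) U := by
  refine contDiffOn_of_differentiableOn (n := (n : ℕ∞)) fun m hm x hx => ?_
  have hm' : m < n + 1 := Nat.lt_succ_of_le (by exact_mod_cast hm)
  exact ((iteratedFDerivWithin_tsum hU hc hf hv hb hm'.le hx).2
    hm').differentiableAt.differentiableWithinAt

set_option maxSynthPendingDepth 3 in
/-- The `n`-th derivatives of the powers of a function with values in the unit ball grow
polynomially. -/
lemma norm_iteratedFDerivWithin_pow_le {A : Type*} [NormedCommRing A] [NormOneClass A]
    [NormedAlgebra ℝ A] {U : Set E} (hU : IsOpen U) {f : E → A} (hf : ContDiffOn ℝ ∞ f U)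
    (h1 : ∀ x ∈ U, ‖f x‖ ≤ 1)
    (hb : ∀ i, ∃ B, ∀ x ∈ U, ‖iteratedFDerivWithin ℝ i f U x‖ ≤ B) (n : ℕ) :
    ∃ C, 0 ≤ C ∧ ∀ k : ℕ, ∀ x ∈ U,
      ‖iteratedFDerivWithin ℝ n (fun y => f y ^ k) U x‖ ≤ C * (k + 1 : ℝ) ^ n := by
  have hud := hU.uniqueDiffOn (𝕜 := ℝ)
  choose B hB using hb
  induction n using Nat.strong_induction_on with
  | _ n ih =>
  rcases n with _ | n
  · refine ⟨1, zero_le_one, fun k x hx => ?_⟩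
    rw [norm_iteratedFDerivWithin_zero]
    simpa using (norm_pow_le (f x) k).trans (pow_le_one₀ (norm_nonneg _) (h1 x hx))
  -- The condition `i ≤ n` is moved under the existential so that the constants can be chosen as one
  -- function of `i`.
  have ih' : ∀ i, ∃ C, i ≤ n → 0 ≤ C ∧ ∀ k : ℕ, ∀ x ∈ U,
      ‖iteratedFDerivWithin ℝ i (fun y => f y ^ k) U x‖ ≤ C * (k + 1 : ℝ) ^ i := fun i => by
    by_cases hi : i ≤ n
    · obtain ⟨C, hC⟩ := ih i (Nat.lt_succ_of_le hi)
      exact ⟨C, fun _ => hC⟩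
    · exact ⟨0, fun h => absurd h hi⟩
  choose C hC using ih'
  -- The bilinear map `(a, T) ↦ a · T`, so that `d(f ^ (k+1)) = (k + 1) L(f ^ k, df)`. Leibniz's
  -- rule for `L` needs only derivatives of `f ^ k` of order at most `n`, and the factor `k + 1`
  -- accounts for the additional power in the bound.
  let L : A →L[ℝ] (E →L[ℝ] A) →L[ℝ] (E →L[ℝ] A) :=
    (ContinuousLinearMap.compL ℝ E A A).comp (ContinuousLinearMap.mul ℝ A)
  have hB0 : ∀ i, ∀ x ∈ U, 0 ≤ B i := fun i x hx => (norm_nonneg _).trans (hB i x hx)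
  -- A point of `U` is needed to know that the bounds `B i` are nonnegative.
  rcases U.eq_empty_or_nonempty with rfl | ⟨x₀, hx₀⟩
  · exact ⟨0, le_rfl, by simp⟩
  set D := ‖L‖ * ∑ i ∈ Finset.range (n + 1), (n.choose i : ℝ) * C i * B (n - i + 1) with hD
  have hD0 : 0 ≤ D := by
    refine mul_nonneg (norm_nonneg _) (Finset.sum_nonneg fun i hi => ?_)
    have := (hC i (Nat.lt_succ_iff.1 (Finset.mem_range.1 hi))).1
    have := hB0 (n - i + 1) x₀ hx₀
    positivity
  refine ⟨D, hD0, fun k x hx => ?_⟩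
  rcases k with _ | k
  · simp only [pow_zero]
    rw [iteratedFDerivWithin_const_of_ne (by simp)]
    simpa using hD0
  have hder : ∀ y ∈ U, fderivWithin ℝ (fun y => f y ^ (k + 1)) U y =
      ((k + 1 : ℕ) : ℝ) • L (f y ^ k) (fderivWithin ℝ f U y) := by
    intro y hy
    have hd : HasFDerivWithinAt f (fderivWithin ℝ f U y) U y :=
      ((hf.differentiableOn (by simp)) y hy).hasFDerivWithinAt
    rw [(hd.pow (k + 1)).fderivWithin (hud y hy)]
    ext v
    simp [L, Algebra.smul_def, mul_assoc]
  rw [← norm_iteratedFDerivWithin_fderivWithin hud hx, iteratedFDerivWithin_congr hder hx]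
  have hfp : ContDiffOn ℝ ∞ (fun y => f y ^ k) U := hf.pow k
  have hfd : ContDiffOn ℝ ∞ (fun y => fderivWithin ℝ f U y) U :=
    hf.fderivWithin hud (by simp)
  have hLc : ContDiffOn ℝ ∞ (fun y => L (f y ^ k) (fderivWithin ℝ f U y)) U :=
    L.isBoundedBilinearMap.contDiff.comp_contDiffOn (hfp.prodMk hfd)
  have hn : (n : WithTop ℕ∞) ≤ (∞ : WithTop ℕ∞) := by exact_mod_cast le_top
  have hsm := iteratedFDerivWithin_const_smul_apply (a := ((k + 1 : ℕ) : ℝ))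
    ((hLc x hx).of_le hn) hud hx
  rw [show iteratedFDerivWithin ℝ n (fun y => ((k + 1 : ℕ) : ℝ) • L (f y ^ k)
    (fderivWithin ℝ f U y)) U x = _ from hsm, norm_smul]
  have h2 := L.norm_iteratedFDerivWithin_le_of_bilinear hfp hfd hud hx hn
  rw [Real.norm_of_nonneg (by positivity)]
  calc ((k + 1 : ℕ) : ℝ) * ‖iteratedFDerivWithin ℝ n
          (fun y => L (f y ^ k) (fderivWithin ℝ f U y)) U x‖
      ≤ ((k + 1 : ℕ) : ℝ) * (‖L‖ * ∑ i ∈ Finset.range (n + 1), (n.choose i : ℝ) *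
          (C i * (k + 1 : ℝ) ^ n) * B (n - i + 1)) := by
        refine mul_le_mul_of_nonneg_left (h2.trans ?_) (by positivity)
        refine mul_le_mul_of_nonneg_left (Finset.sum_le_sum fun i hi => ?_) (norm_nonneg _)
        have hi' := Nat.lt_succ_iff.1 (Finset.mem_range.1 hi)
        have h3 := (hC i hi').2 k x hx
        have h4 : C i * (k + 1 : ℝ) ^ i ≤ C i * (k + 1 : ℝ) ^ n :=
          mul_le_mul_of_nonneg_left (pow_le_pow_right₀ (by linarith [k.cast_nonneg (α := ℝ)]) hi')
            (hC i hi').1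
        rw [norm_iteratedFDerivWithin_fderivWithin hud hx]
        have h5 := (norm_nonneg _).trans h3
        exact mul_le_mul (mul_le_mul_of_nonneg_left (h3.trans h4) (by positivity)) (hB _ x hx)
          (norm_nonneg _) (mul_nonneg (by positivity) (h5.trans h4))
    _ = D * ((k + 1 : ℕ) : ℝ) ^ (n + 1) := by
        rw [hD, Finset.mul_sum, Finset.mul_sum, Finset.mul_sum, Finset.sum_mul]
        refine Finset.sum_congr rfl fun i _ => ?_
        push_cast
        ring
    _ ≤ D * (((k + 1 : ℕ) : ℝ) + 1) ^ (n + 1) := by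
        gcongr
        linarith

end Calculus

/-! ### Möbius transformations as elements of the algebra of continuous functions -/

/-- The closed unit disc, as a type. -/
abbrev ClosedDisk : Type := closedBall (0 : ℂ) 1

/-- The coordinate function on the closed disc. -/
def diskCoord : C(ClosedDisk, ℂ) := ⟨Subtype.val, continuous_subtype_val⟩

/-- The value of `α` at a point of the chart of `SL(2,ℝ)`. -/
def chartα (x : ℝ × ℝ × ℝ) : ℂ :=
  ((x.1 + (1 + x.2.1 * x.2.2) / x.1 : ℝ) + (x.2.1 - x.2.2 : ℝ) * I) / 2

/-- The value of `β` at a point of the chart of `SL(2,ℝ)`. -/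
def chartβ (x : ℝ × ℝ × ℝ) : ℂ :=
  ((x.2.1 + x.2.2 : ℝ) + (x.1 - (1 + x.2.1 * x.2.2) / x.1 : ℝ) * I) / 2

lemma cayleyα_slChart (x : ℝ × ℝ × ℝ) (hx : 0 < x.1) : cayleyα (slChart x hx) = chartα x := by
  simp [chartα, cayleyα, slChart]

lemma cayleyβ_slChart (x : ℝ × ℝ × ℝ) (hx : 0 < x.1) : cayleyβ (slChart x hx) = chartβ x := by
  simp [chartβ, cayleyβ, slChart]

lemma normSq_chart {x : ℝ × ℝ × ℝ} (hx : x ∈ slDomain) :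
    normSq (chartα x) - normSq (chartβ x) = 1 := by
  rw [← cayleyα_slChart x hx.1, ← cayleyβ_slChart x hx.1, normSq_cayley]

lemma re_chartα_pos {x : ℝ × ℝ × ℝ} (hx : x ∈ slDomain) : 0 < (chartα x).re := by
  rw [← cayleyα_slChart x hx.1, re_cayleyα]
  exact div_pos hx.2 two_pos

lemma contDiffOn_slDomain_div :
    ContDiffOn ℝ ∞ (fun x : ℝ × ℝ × ℝ => (1 + x.2.1 * x.2.2) / x.1) slDomain :=
  ContDiffOn.div (by fun_prop) (by fun_prop) fun x hx => hx.1.ne'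

lemma contDiffOn_chartα : ContDiffOn ℝ ∞ chartα slDomain := by
  have hofReal : ContDiff ℝ ∞ (fun t : ℝ => (t : ℂ)) := ofRealCLM.contDiff
  refine ContDiffOn.div_const (ContDiffOn.add ?_ (ContDiffOn.mul ?_ contDiffOn_const)) 2
  · exact hofReal.comp_contDiffOn (contDiffOn_fst.add contDiffOn_slDomain_div)
  · exact hofReal.comp_contDiffOn (by fun_prop)

lemma contDiffOn_chartβ : ContDiffOn ℝ ∞ chartβ slDomain := by
  have hofReal : ContDiff ℝ ∞ (fun t : ℝ => (t : ℂ)) := ofRealCLM.contDiff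
  refine ContDiffOn.div_const (ContDiffOn.add ?_ (ContDiffOn.mul ?_ contDiffOn_const)) 2
  · exact hofReal.comp_contDiffOn (by fun_prop)
  · exact hofReal.comp_contDiffOn (contDiffOn_fst.sub contDiffOn_slDomain_div)

/-- The denominator of a Möbius transformation of the closed disc. -/
def moebiusDenom (x : ℝ × ℝ × ℝ) : C(ClosedDisk, ℂ) :=
  chartα x • 1 - conj (chartβ x) • diskCoord

/-- A Möbius transformation of the closed disc. -/
def moebiusMap (x : ℝ × ℝ × ℝ) : C(ClosedDisk, ℂ) :=
  (conj (chartα x) • diskCoord - chartβ x • 1) * Ring.inverse (moebiusDenom x)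

lemma moebiusDenom_apply (x : ℝ × ℝ × ℝ) (z : ClosedDisk) :
    moebiusDenom x z = -conj (chartβ x) * z + chartα x := by
  simp [moebiusDenom, diskCoord]
  ring

/-- Since `|β| < |α|`, the denominator does not vanish even on the unit circle. This is what makes
it a unit of `C(ClosedDisk, ℂ)`. -/
lemma moebius_denom_ne_zero {α β z : ℂ} (h : normSq α - normSq β = 1) (hz : ‖z‖ ≤ 1) :
    -conj β * z + α ≠ 0 := by
  intro h0
  have h1 : ‖α‖ ≤ ‖β‖ := by
    rw [show α = conj β * z by linear_combination h0, norm_mul, RCLike.norm_conj]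
    exact mul_le_of_le_one_right (norm_nonneg _) hz
  rw [normSq_eq_norm_sq, normSq_eq_norm_sq] at h
  nlinarith [norm_nonneg α]

lemma isUnit_moebiusDenom {x : ℝ × ℝ × ℝ} (hx : x ∈ slDomain) : IsUnit (moebiusDenom x) := by
  rw [ContinuousMap.isUnit_iff_forall_ne_zero]
  intro z
  rw [moebiusDenom_apply]
  exact moebius_denom_ne_zero (normSq_chart hx) (mem_closedBall_zero_iff.1 z.2)

lemma moebiusMap_apply {x : ℝ × ℝ × ℝ} (hx : x ∈ slDomain) (z : ClosedDisk) :
    moebiusMap x z = (conj (chartα x) * z - chartβ x) / (-conj (chartβ x) * z + chartα x) := by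
  have h1 := congrArg (fun f : C(ClosedDisk, ℂ) => f z)
    (Ring.mul_inverse_cancel _ (isUnit_moebiusDenom hx))
  have h0 := moebius_denom_ne_zero (normSq_chart hx) (mem_closedBall_zero_iff.1 z.2)
  simp only [ContinuousMap.mul_apply, ContinuousMap.one_apply, moebiusDenom_apply] at h1
  rw [eq_div_iff h0, moebiusMap]
  simp only [ContinuousMap.mul_apply, ContinuousMap.sub_apply, ContinuousMap.smul_apply,
    ContinuousMap.one_apply, smul_eq_mul, mul_one]
  change (conj (chartα x) * z - chartβ x) * _ * _ = _
  linear_combination (conj (chartα x) * z - chartβ x) * h1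

lemma norm_moebiusMap_le {x : ℝ × ℝ × ℝ} (hx : x ∈ slDomain) : ‖moebiusMap x‖ ≤ 1 := by
  refine (ContinuousMap.norm_le _ zero_le_one).2 fun z => ?_
  have hz := mem_closedBall_zero_iff.1 z.2
  have h0 := moebius_denom_ne_zero (normSq_chart hx) hz
  rw [moebiusMap_apply hx, norm_div, div_le_one (norm_pos_iff.2 h0)]
  have := moebius_identity (z := z) (normSq_chart hx)
  rw [normSq_eq_norm_sq, normSq_eq_norm_sq, normSq_eq_norm_sq (z : ℂ)] at this
  have h3 : ‖(z : ℂ)‖ ^ 2 ≤ 1 := pow_le_one₀ (norm_nonneg _) hz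
  exact le_of_sq_le_sq (by linarith) (norm_nonneg _)

set_option maxSynthPendingDepth 3 in
-- Inversion is smooth at the units of a Banach algebra. Working in `C(ClosedDisk, ℂ)` makes the
-- smoothness in the group parameter uniform in the point of the disc.
lemma contDiffOn_moebiusMap : ContDiffOn ℝ ∞ moebiusMap slDomain := by
  have hconj : ContDiff ℝ ∞ (fun w : ℂ => conj w) := conjCLE.contDiff
  have h1 : ContDiffOn ℝ ∞ moebiusDenom slDomain :=
    (contDiffOn_chartα.smul contDiffOn_const).sub
      ((hconj.comp_contDiffOn contDiffOn_chartβ).smul contDiffOn_const)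
  refine ContDiffOn.mul (((hconj.comp_contDiffOn contDiffOn_chartα).smul contDiffOn_const).sub
      (contDiffOn_chartβ.smul contDiffOn_const)) fun x hx => ?_
  obtain ⟨u, hu⟩ := isUnit_moebiusDenom hx
  have h2 := contDiffAt_ringInverse ℝ (n := ∞) u
  rw [hu] at h2
  exact h2.comp_contDiffWithinAt x (h1 x hx)

/-- A neighbourhood of the identity on which the derivatives of all orders of a smooth function
are bounded. -/
lemma exists_convex_bounded {F : Type*} [NormedAddCommGroup F] [NormedSpace ℝ F]
    {f : ℝ × ℝ × ℝ → F} (hf : ContDiffOn ℝ ∞ f slDomain) {R : ℝ}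
    (hsub : closedBall (1, 0, 0) R ⊆ slDomain) (i : ℕ) :
    ∃ B, ∀ x ∈ ball ((1, 0, 0) : ℝ × ℝ × ℝ) R,
      ‖iteratedFDerivWithin ℝ i f (ball (1, 0, 0) R) x‖ ≤ B := by
  have h1 : ContinuousOn (iteratedFDerivWithin ℝ i f slDomain) slDomain :=
    hf.continuousOn_iteratedFDerivWithin (by exact_mod_cast le_top)
      (isOpen_slDomain.uniqueDiffOn)
  obtain ⟨B, hB⟩ := (isCompact_closedBall ((1, 0, 0) : ℝ × ℝ × ℝ) R).exists_bound_of_continuousOn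
    (h1.mono hsub)
  refine ⟨B, fun x hx => ?_⟩
  rw [iteratedFDerivWithin_of_isOpen i isOpen_ball hx, ← iteratedFDerivWithin_of_isOpen i
    isOpen_slDomain (hsub (ball_subset_closedBall hx))]
  exact hB x (ball_subset_closedBall hx)

/-! ### Multiplication operators -/

open Classical in
/-- The extension by zero of a continuous function on the closed disc. -/
def extendDisk (h : C(ClosedDisk, ℂ)) (z : ℂ) : ℂ :=
  if hz : z ∈ closedBall (0 : ℂ) 1 then h ⟨z, hz⟩ else 0

lemma extendDisk_of_mem (h : C(ClosedDisk, ℂ)) {z : ℂ} (hz : z ∈ closedBall (0 : ℂ) 1) :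
    extendDisk h z = h ⟨z, hz⟩ := dif_pos hz

lemma norm_extendDisk_le (h : C(ClosedDisk, ℂ)) (z : ℂ) : ‖extendDisk h z‖ ≤ ‖h‖ := by
  by_cases hz : z ∈ closedBall (0 : ℂ) 1
  · rw [extendDisk_of_mem h hz]
    exact h.norm_coe_le_norm _
  · rw [extendDisk, dif_neg hz, norm_zero]
    exact norm_nonneg _

lemma measurable_extendDisk (h : C(ClosedDisk, ℂ)) : Measurable (extendDisk h) := by
  classical
  exact Measurable.dite h.continuous.measurable measurable_const measurableSet_closedBall

lemma memLp_extendDisk (μ : Measure ℂ) (h : C(ClosedDisk, ℂ)) : MemLp (extendDisk h) ∞ μ :=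
  memLp_top_of_bound (measurable_extendDisk h).aestronglyMeasurable ‖h‖
    (.of_forall (norm_extendDisk_le h))

/-- Continuous functions on the closed disc as bounded measurable functions on the plane. -/
def extendDiskL (μ : Measure ℂ) : C(ClosedDisk, ℂ) →L[ℝ] Lp ℂ ∞ μ :=
  LinearMap.mkContinuous
    { toFun := fun h => (memLp_extendDisk μ h).toLp
      map_add' := fun h k => by
        rw [← MemLp.toLp_add]
        congr 1
        funext z
        by_cases hz : z ∈ closedBall (0 : ℂ) 1 <;> simp [extendDisk, hz]
      map_smul' := fun c h => by
        rw [RingHom.id_apply, ← MemLp.toLp_const_smul]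
        congr 1
        funext z
        by_cases hz : z ∈ closedBall (0 : ℂ) 1 <;> simp [extendDisk, hz] }
    1 fun h => by
      rw [one_mul]
      refine (congrArg norm rfl).trans_le ?_
      rw [LinearMap.coe_mk, AddHom.coe_mk, Lp.norm_toLp, eLpNorm_exponent_top]
      exact ENNReal.toReal_le_of_le_ofReal (norm_nonneg _)
        (eLpNormEssSup_le_of_ae_bound (.of_forall (norm_extendDisk_le h)))

/-- Multiplication of functions in `L²` by continuous functions on the closed disc. -/
def mulDisk (μ : Measure ℂ) : C(ClosedDisk, ℂ) →L[ℝ] Lp ℂ 2 μ →L[ℝ] Lp ℂ 2 μ :=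
  ((ContinuousLinearMap.mul ℝ ℂ).holderL μ ∞ 2 2).comp (extendDiskL μ)

lemma mulDisk_coeFn (μ : Measure ℂ) (h : C(ClosedDisk, ℂ)) (g : Lp ℂ 2 μ) :
    mulDisk μ h g =ᵐ[μ] fun z => extendDisk h z * g z := by
  refine ((ContinuousLinearMap.mul ℝ ℂ).coeFn_holder (r := 2) (extendDiskL μ h) g).trans ?_
  filter_upwards [(memLp_extendDisk μ h).coeFn_toLp] with z hz
  rw [← hz]
  rfl

/-! ### Upper bounds for the seminorms of smooth vectors -/

lemma tsum_smul_pow_apply {a : ℕ → ℂ} {f : ℂ → ℂ}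
    (hb : ∀ z ∈ ball (0 : ℂ) 1, HasSum (fun k => a k * z ^ k) (f z)) (ha : Summable fun k => ‖a k‖)
    {h : C(ClosedDisk, ℂ)} (h1 : ‖h‖ ≤ 1) {z : ClosedDisk} (hz : h z ∈ ball (0 : ℂ) 1) :
    (∑' k, a k • h ^ k) z = f (h z) := by
  have hs : Summable fun k => a k • h ^ k := by
    refine .of_norm_bounded ha fun k => ?_
    rw [norm_smul]
    exact mul_le_of_le_one_right (norm_nonneg _)
      ((norm_pow_le h k).trans (pow_le_one₀ (norm_nonneg _) h1))
  have h2 := hs.hasSum.mapL (ContinuousMap.evalCLM ℂ z)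
  exact h2.unique (by simpa using hb _ hz)

/-- The automorphy factor of `π_s(x)v` is `π_s(x)u`, so only `v ∘ T_x` depends on `v`. The orbit map
thus factors into the fixed smooth orbit of `u` and a series of powers of `T_x` in the Banach
algebra. -/
lemma orbitMap_eq_mulDisk {s : ℝ} (hs : 1 < s) (v : bergmanSpace 2 s) {a : ℕ → ℂ}
    (hb : ∀ z ∈ ball (0 : ℂ) 1, HasSum (fun k => a k * z ^ k) (v.1 z))
    (ha : Summable fun k => ‖a k‖) {x : ℝ × ℝ × ℝ} (hx : x ∈ slDomain) :
    orbitMap s v x = mulDisk (hilbertMeasure s) (∑' k, a k • moebiusMap x ^ k)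
      (orbitMap s (unitVector hs) x) := by
  rw [orbitMap, orbitMap, dif_pos hx, dif_pos hx]
  refine Lp.ext ?_
  filter_upwards [toL2_coeFn (discreteSeries s (slChart x hx.1) hx.2 v),
    mulDisk_coeFn (hilbertMeasure s) (∑' k, a k • moebiusMap x ^ k)
      (toL2 s (discreteSeries s (slChart x hx.1) hx.2 (unitVector hs))),
    toL2_coeFn (discreteSeries s (slChart x hx.1) hx.2 (unitVector hs)),
    ae_hilbertMeasure (s := s) (P := fun z => z ∈ ball (0 : ℂ) 1) fun z hz => hz]
    with z h1 h2 h3 hz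
  have hT := moebius_mem (normSq_chart hx) (re_chartα_pos hx) hz
  have hm := moebiusMap_apply hx ⟨z, ball_subset_closedBall hz⟩
  rw [h1, h2, h3, extendDisk_of_mem _ (ball_subset_closedBall hz),
    tsum_smul_pow_apply hb ha (norm_moebiusMap_le hx) (by rw [hm]; exact hT), hm]
  simp only [discreteSeries, discreteSeriesFun, unitVector, ofBounded, LinearMap.coe_mk,
    AddHom.coe_mk, Set.indicator_of_mem hz, cayleyα_slChart, cayleyβ_slChart,
    Set.indicator_of_mem hT]
  ring

/-- The identity is a translate of the wavelet. -/
lemma unitVector_mem_smoothVectors {s : ℝ} (hs : 1 < s) : unitVector hs ∈ smoothVectors s := by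
  have h := translate_mem_smoothVectors hs 1 (by norm_num)
  convert h
  ext z
  by_cases hz : z ∈ ball (0 : ℂ) 1
  · simp [discreteSeries, discreteSeriesFun, unitVector, ofBounded, cayleyα, cayleyβ, hz]
  · simp [discreteSeries, discreteSeriesFun, unitVector, ofBounded, hz]

/-- The monomials, as elements of `H_s`. -/
def monomialVector {s : ℝ} (hs : 1 < s) (k : ℕ) : bergmanSpace 2 s :=
  ofBounded hs (fun z => z ^ k) (by fun_prop) ⟨1, fun z hz => by
    rw [norm_pow]
    exact pow_le_one₀ (norm_nonneg z) (mem_ball_zero_iff.1 hz).le⟩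

lemma monomialVector_apply {s : ℝ} (hs : 1 < s) (k : ℕ) {z : ℂ} (hz : z ∈ ball (0 : ℂ) 1) :
    (monomialVector hs k).1 z = z ^ k := Set.indicator_of_mem hz _

set_option maxSynthPendingDepth 3 in
lemma contDiffOn_mulDisk {s : ℝ} {n : ℕ∞} {U : Set (ℝ × ℝ × ℝ)}
    {f : ℝ × ℝ × ℝ → C(ClosedDisk, ℂ)} {g : ℝ × ℝ × ℝ → Lp ℂ 2 (hilbertMeasure s)}
    (hf : ContDiffOn ℝ n f U) (hg : ContDiffOn ℝ n g U) :
    ContDiffOn ℝ n (fun x => mulDisk (hilbertMeasure s) (f x) (g x)) U :=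
  ((mulDisk (hilbertMeasure s)).contDiff.comp_contDiffOn hf).clm_apply hg

lemma hasSum_single_mul_pow (k : ℕ) (z : ℂ) :
    HasSum (fun j => (Pi.single k 1 : ℕ → ℂ) j * z ^ j) (z ^ k) := by
  convert hasSum_single (f := fun j => (Pi.single k 1 : ℕ → ℂ) j * z ^ j) k
    (fun j hj => by simp [hj]) using 1
  simp

lemma monomialVector_mem_smoothVectors {s : ℝ} (hs : 1 < s) (k : ℕ) :
    monomialVector hs k ∈ smoothVectors s := by
  have h1 : ContDiffOn ℝ ∞ (fun x => mulDisk (hilbertMeasure s) (moebiusMap x ^ k)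
      (orbitMap s (unitVector hs) x)) slDomain :=
    contDiffOn_mulDisk (contDiffOn_moebiusMap.pow k) (unitVector_mem_smoothVectors hs)
  refine h1.congr fun x hx => ?_
  rw [orbitMap_eq_mulDisk hs _ (a := Pi.single k 1) ?_ ?_ hx]
  · congr 2
    rw [tsum_eq_single k fun j hj => by simp [hj]]
    simp
  · intro z hz
    rw [monomialVector_apply hs k hz]
    exact hasSum_single_mul_pow k z
  · exact summable_of_ne_finset_zero (s := {k}) fun j hj => by
      simp [Finset.notMem_singleton.1 hj]

/-- The monomials, as smooth vectors. -/
def smoothMonomial {s : ℝ} (hs : 1 < s) (k : ℕ) : SmoothVector s :=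
  ⟨monomialVector hs k, monomialVector_mem_smoothVectors hs k⟩

lemma smoothMonomial_apply {s : ℝ} (hs : 1 < s) (k : ℕ) {z : ℂ} (hz : z ∈ ball (0 : ℂ) 1) :
    (smoothMonomial hs k).toFun z = z ^ k := monomialVector_apply hs k hz

set_option maxSynthPendingDepth 3 in
-- Leibniz's rule for the factorization of the orbit map, with polynomial bounds for the derivatives
-- of `T_x ^ k`. The exponent is `n + 1` rather than `n` because of the order lost in
-- `contDiffOn_tsum`.
lemma smoothSeminorm_le_tsum {s : ℝ} (hs : 1 < s) (n : ℕ) :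
    ∃ C, 0 ≤ C ∧ ∀ (v : SmoothVector s) (a : ℕ → ℂ),
      (∀ z ∈ ball (0 : ℂ) 1, HasSum (fun k => a k * z ^ k) (v.toFun z)) →
      (Summable fun k => ‖a k‖ * (k + 1 : ℝ) ^ (n + 1)) →
      smoothSeminorm s n v ≤ C * ∑' k, ‖a k‖ * (k + 1 : ℝ) ^ (n + 1) := by
  -- The closed ball is compact, which bounds the derivatives of the Möbius map; the open ball is
  -- convex, hence connected, as termwise differentiation requires.
  obtain ⟨R, hR, hsub⟩ := Metric.nhds_basis_closedBall.mem_iff.1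
    (isOpen_slDomain.mem_nhds one_mem_slDomain)
  set U := ball ((1, 0, 0) : ℝ × ℝ × ℝ) R with hU
  have hUo : IsOpen U := isOpen_ball
  have hUs : U ⊆ slDomain := ball_subset_closedBall.trans hsub
  have h1U : ((1, 0, 0) : ℝ × ℝ × ℝ) ∈ U := mem_ball_self hR
  have hUc : IsPreconnected U := (convex_ball _ _).isPreconnected
  have hud := hUo.uniqueDiffOn (𝕜 := ℝ)
  have hm : ContDiffOn ℝ ∞ moebiusMap U := contDiffOn_moebiusMap.mono hUs
  have hu : ContDiffOn ℝ ∞ (orbitMap s (unitVector hs)) U :=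
    (unitVector_mem_smoothVectors hs).mono hUs
  choose C hC0 hC using fun i => norm_iteratedFDerivWithin_pow_le hUo hm
    (fun x hx => norm_moebiusMap_le (hUs hx)) (exists_convex_bounded contDiffOn_moebiusMap hsub) i
  set M := mulDisk (hilbertMeasure s) with hM
  set u := orbitMap s (unitVector hs) with hud'
  refine ⟨‖M‖ * ∑ i ∈ Finset.range (n + 1), (n.choose i : ℝ) * C i *
    ‖iteratedFDerivWithin ℝ (n - i) u U (1, 0, 0)‖, mul_nonneg (norm_nonneg _)
      (Finset.sum_nonneg fun i _ => by have := hC0 i; positivity), fun v a hb ha => ?_⟩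
  set S := ∑' k, ‖a k‖ * (k + 1 : ℝ) ^ (n + 1) with hS
  have hle : ∀ i ≤ n + 1, ∀ k : ℕ, ‖a k‖ * (C i * (k + 1 : ℝ) ^ i) ≤
      C i * (‖a k‖ * (k + 1 : ℝ) ^ (n + 1)) := fun i hi k => by
    have : (k + 1 : ℝ) ^ i ≤ (k + 1 : ℝ) ^ (n + 1) :=
      pow_le_pow_right₀ (by linarith [k.cast_nonneg (α := ℝ)]) hi
    have h2 := mul_le_mul_of_nonneg_left this (mul_nonneg (hC0 i) (norm_nonneg (a k)))
    calc _ = C i * ‖a k‖ * (k + 1 : ℝ) ^ i := by ring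
      _ ≤ _ := h2
      _ = _ := by ring
  have hsm : ∀ i ≤ n + 1, Summable fun k : ℕ => ‖a k‖ * (C i * (k + 1 : ℝ) ^ i) := fun i hi =>
    .of_nonneg_of_le (fun k => by have := hC0 i; positivity) (hle i hi) (ha.mul_left (C i))
  have hf : ∀ k, ContDiffOn ℝ ∞ (fun x => a k • moebiusMap x ^ k) U := fun k =>
    (hm.pow k).const_smul (a k)
  have hbd : ∀ i ≤ n + 1, ∀ k, ∀ x ∈ U,
      ‖iteratedFDerivWithin ℝ i (fun x => a k • moebiusMap x ^ k) U x‖ ≤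
        ‖a k‖ * (C i * (k + 1 : ℝ) ^ i) := fun i _ k x hx => by
    have h2 := iteratedFDerivWithin_const_smul_apply (a := a k)
      (((hm.pow k) x hx).of_le (m := (i : WithTop ℕ∞)) (by exact_mod_cast le_top)) hud hx
    rw [show iteratedFDerivWithin ℝ i (fun x => a k • moebiusMap x ^ k) U x = _ from h2, norm_smul]
    exact mul_le_mul_of_nonneg_left (hC i k x hx) (norm_nonneg _)
  have hG := contDiffOn_tsum hUo hUc hf hsm hbd
  have hGb : ∀ i ≤ n, ‖iteratedFDerivWithin ℝ i (fun x => ∑' k, a k • moebiusMap x ^ k) U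
      (1, 0, 0)‖ ≤ C i * S := fun i hi => by
    rw [(iteratedFDerivWithin_tsum hUo hUc hf hsm hbd (hi.trans n.le_succ) h1U).1, hS,
      ← tsum_mul_left]
    exact tsum_of_norm_bounded ((ha.mul_left (C i)).hasSum) fun k =>
      (hbd i (hi.trans n.le_succ) k _ h1U).trans (hle i (hi.trans n.le_succ) k)
  have hsum : Summable fun k => ‖a k‖ := .of_nonneg_of_le (fun k => norm_nonneg _) (fun k =>
    le_mul_of_one_le_right (norm_nonneg _)
      (one_le_pow₀ (by linarith [k.cast_nonneg (α := ℝ)]))) ha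
  change ‖iteratedFDeriv ℝ n (orbitMap s v.1) (1, 0, 0)‖ ≤ _
  rw [← iteratedFDerivWithin_of_isOpen n hUo h1U, iteratedFDerivWithin_congr
    (fun x hx => orbitMap_eq_mulDisk hs v.1 hb hsum (hUs hx)) h1U]
  refine (M.norm_iteratedFDerivWithin_le_of_bilinear hG
    (hu.of_le (by exact_mod_cast le_top)) hud h1U le_rfl).trans ?_
  rw [mul_assoc, Finset.sum_mul]
  refine mul_le_mul_of_nonneg_left (Finset.sum_le_sum fun i hi => ?_) (norm_nonneg _)
  have := hGb i (Nat.lt_succ_iff.1 (Finset.mem_range.1 hi))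
  calc _ ≤ (n.choose i : ℝ) * (C i * S) * ‖iteratedFDerivWithin ℝ (n - i) u U (1, 0, 0)‖ := by
        gcongr
    _ = _ := by ring

/-! ### Decay of the Taylor coefficients of smooth vectors -/

/-- The Taylor coefficients at the origin. -/
def taylorCoeff (f : ℂ → ℂ) (k : ℕ) : ℂ := (k.factorial : ℂ)⁻¹ * iteratedDeriv k f 0

lemma hasSum_taylorCoeff {f : ℂ → ℂ} (hf : DifferentiableOn ℂ f (ball 0 1)) {z : ℂ}
    (hz : z ∈ ball (0 : ℂ) 1) : HasSum (fun k => taylorCoeff f k * z ^ k) (f z) := by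
  have h := hasSum_taylorSeries_on_ball hf hz
  have e : (fun k => taylorCoeff f k * z ^ k) = fun n : ℕ =>
      (n.factorial : ℂ)⁻¹ • (z - 0) ^ n • iteratedDeriv n f 0 := by
    funext k
    simp only [taylorCoeff, sub_zero, smul_eq_mul]
    ring
  rw [e]
  exact h

/-- The one-parameter group of rotations in the chart of `SL(2,ℝ)`. -/
def rotationChart (θ : ℝ) : ℝ × ℝ × ℝ := (Real.cos θ, Real.sin θ, -Real.sin θ)

lemma rotationChart_snd (θ : ℝ) (hθ : 0 < Real.cos θ) :
    (1 + Real.sin θ * -Real.sin θ) / Real.cos θ = Real.cos θ := by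
  rw [div_eq_iff hθ.ne']
  nlinarith [Real.sin_sq_add_cos_sq θ]

lemma cos_pos_of_mem {θ : ℝ} (hθ : θ ∈ Set.Ioo (-(Real.pi / 2)) (Real.pi / 2)) :
    0 < Real.cos θ := Real.cos_pos_of_mem_Ioo hθ

lemma rotationChart_mem {θ : ℝ} (hθ : θ ∈ Set.Ioo (-(Real.pi / 2)) (Real.pi / 2)) :
    rotationChart θ ∈ slDomain := by
  have h := cos_pos_of_mem hθ
  refine ⟨h, ?_⟩
  simp only [rotationChart]
  rw [rotationChart_snd θ h]
  exact add_pos h h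

lemma chartα_rotationChart {θ : ℝ} (hθ : θ ∈ Set.Ioo (-(Real.pi / 2)) (Real.pi / 2)) :
    chartα (rotationChart θ) = exp (θ * I) := by
  simp only [chartα, rotationChart]
  rw [rotationChart_snd θ (cos_pos_of_mem hθ), exp_mul_I]
  push_cast
  ring

lemma chartβ_rotationChart {θ : ℝ} (hθ : θ ∈ Set.Ioo (-(Real.pi / 2)) (Real.pi / 2)) :
    chartβ (rotationChart θ) = 0 := by
  simp only [chartβ, rotationChart]
  rw [rotationChart_snd θ (cos_pos_of_mem hθ)]
  push_cast
  ring

lemma integrable_bergmanSpace {s : ℝ} (hs : 1 < s) (v : bergmanSpace 2 s) :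
    Integrable v.1 (hilbertMeasure s) := by
  have := isFiniteMeasure_hilbertMeasure hs
  exact MemLp.integrable (μ := hilbertMeasure s) (q := 2) (by norm_num)
    (v.2.2.2.smul_measure ENNReal.ofReal_ne_top)

lemma inner_monomial {s : ℝ} (hs : 1 < s) (v : bergmanSpace 2 s) {b : ℕ → ℂ}
    (hb : ∀ z ∈ ball (0 : ℂ) 1, HasSum (fun k => b k * z ^ k) (v.1 z)) (k : ℕ) :
    inner ℂ (toL2 s (monomialVector hs k)) (toL2 s v) = b k / kernelCoeff s k := by
  rw [← integral_mul_conj_pow hs hb (integrable_bergmanSpace hs v), L2.inner_def]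
  refine integral_congr_ae ?_
  filter_upwards [toL2_coeFn (monomialVector hs k), toL2_coeFn v,
    ae_hilbertMeasure (s := s) (P := fun z => z ∈ ball (0 : ℂ) 1) fun z hz => hz] with z h1 h2 hz
  rw [h1, h2, RCLike.inner_apply, monomialVector_apply hs k hz, map_pow]

/-- A rotation has `β = 0` and `α = exp (iθ)`, so it acts by `v(z) ↦ exp (-isθ) v(exp (-2iθ) z)` and
each monomial is an eigenvector. -/
lemma inner_monomial_orbitMap {s : ℝ} (hs : 1 < s) (v : bergmanSpace 2 s) (k : ℕ) {θ : ℝ}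
    (hθ : θ ∈ Set.Ioo (-(Real.pi / 2)) (Real.pi / 2)) :
    inner ℂ (toL2 s (monomialVector hs k)) (orbitMap s v (rotationChart θ)) =
      taylorCoeff v.1 k / kernelCoeff s k * exp (-((s + 2 * k : ℝ) : ℂ) * I * θ) := by
  have hx := rotationChart_mem hθ
  -- For `|θ| < π / 2` the principal logarithm of `exp (iθ)` is `iθ`.
  have e1 : exp (θ * I) ^ (-(s : ℂ)) = exp (-(s : ℂ) * I * θ) := by
    rw [cpow_def_of_ne_zero (exp_ne_zero _), log_exp]
    · congr 1; ring
    · simpa using by linarith [hθ.1, Real.pi_pos]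
    · simpa using by linarith [hθ.2, Real.pi_pos]
  have e2 : conj (exp (θ * I)) = exp (-θ * I) := by
    rw [← exp_conj]; simp
  rw [orbitMap, dif_pos hx, inner_monomial hs _ (b := fun k => exp (-(s : ℂ) * I * θ) *
    (taylorCoeff v.1 k * exp (-2 * θ * I) ^ k))]
  · rw [← exp_nat_mul, show exp (-(s : ℂ) * I * θ) * (taylorCoeff v.1 k * exp (k * (-2 * θ * I))) =
      taylorCoeff v.1 k * (exp (-(s : ℂ) * I * θ) * exp (k * (-2 * θ * I))) by ring, ← exp_add,
      show (-(s : ℂ) * I * θ + k * (-2 * θ * I)) = -((s + 2 * k : ℝ) : ℂ) * I * θ by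
        push_cast; ring]
    ring
  · intro z hz
    have hz' : exp (-2 * θ * I) * z ∈ ball (0 : ℂ) 1 := by
      rw [mem_ball_zero_iff, norm_mul, show (-2 * θ * I : ℂ) = ((-2 * θ : ℝ) : ℂ) * I by
        push_cast; ring, norm_exp_ofReal_mul_I, one_mul]
      exact mem_ball_zero_iff.1 hz
    have h := (hasSum_taylorCoeff v.2.2.1 hz').mul_left (exp (-(s : ℂ) * I * θ))
    have e3 : (discreteSeries s (slChart (rotationChart θ) hx.1) hx.2 v).1 z =
        exp (-(s : ℂ) * I * θ) * v.1 (exp (-2 * θ * I) * z) := by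
      simp only [discreteSeries, discreteSeriesFun, LinearMap.coe_mk, AddHom.coe_mk,
        Set.indicator_of_mem hz, cayleyα_slChart, cayleyβ_slChart]
      rw [chartα_rotationChart hθ, chartβ_rotationChart hθ, map_zero, neg_zero, zero_mul, zero_add,
        sub_zero, e1, e2, mul_div_right_comm, ← exp_sub,
        show (-θ * I - θ * I : ℂ) = -2 * θ * I by ring]
    rw [e3]
    simpa only [mul_pow, mul_assoc] using h

lemma iteratedDeriv_const_mul_cexp (c w : ℂ) (n : ℕ) :
    iteratedDeriv n (fun θ : ℝ => c * exp (w * θ)) = fun θ : ℝ => c * w ^ n * exp (w * θ) := by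
  induction n with
  | zero => simp
  | succ n ih =>
    rw [iteratedDeriv_succ, ih]
    funext θ
    have h1 : HasDerivAt (fun θ : ℝ => w * (θ : ℂ)) w θ := by
      simpa using (ofRealCLM.hasDerivAt (x := θ)).const_mul w
    rw [(h1.cexp.const_mul (c * w ^ n)).deriv]
    ring

lemma contDiff_rotationChart : ContDiff ℝ ∞ rotationChart :=
  Real.contDiff_cos.prodMk (Real.contDiff_sin.prodMk Real.contDiff_sin.neg)

set_option maxSynthPendingDepth 3 in
/-- The Taylor coefficients of smooth vectors decay rapidly. -/
lemma norm_taylorCoeff_le {s : ℝ} (hs : 1 < s) (n : ℕ) :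
    ∃ C, 0 ≤ C ∧ ∃ N : ℕ, ∀ (v : SmoothVector s) (k : ℕ),
      ‖taylorCoeff v.toFun k‖ * (k + 1 : ℝ) ^ n ≤
        C * ∑ j ∈ Finset.range (N + 1), smoothSeminorm s j v := by
  have := isFiniteMeasure_hilbertMeasure hs
  obtain ⟨m, hm⟩ := exists_nat_ge (s - 1)
  set S := Set.Ioo (-(Real.pi / 2)) (Real.pi / 2) with hS
  have hSo : IsOpen S := isOpen_Ioo
  have h0 : (0 : ℝ) ∈ S := ⟨by linarith [Real.pi_pos], by linarith [Real.pi_pos]⟩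
  have hud := hSo.uniqueDiffOn (𝕜 := ℝ)
  have hr0 : rotationChart 0 = (1, 0, 0) := by simp [rotationChart]
  set N := n + m with hN
  -- The bound for derivatives of a composition asks that the `i`-th derivative of the inner map be
  -- at most `D ^ i`; a number that is at least `1` and at least each of these norms serves for all
  -- `i ≥ 1`.
  set D := 1 + ∑ i ∈ Finset.range (N + 1), ‖iteratedFDerivWithin ℝ i rotationChart S 0‖ with hD
  have hD1 : 1 ≤ D := le_add_of_nonneg_right (Finset.sum_nonneg fun i _ => norm_nonneg _)
  set B := (measureUnivNNReal (hilbertMeasure s) : ℝ) ^ (2 : ℝ≥0∞).toReal⁻¹ with hB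
  refine ⟨B * (N.factorial * D ^ N), by positivity, N, fun v k => ?_⟩
  set T := ∑ j ∈ Finset.range (N + 1), smoothSeminorm s j v with hT
  set a := taylorCoeff v.toFun k with ha
  have hcomp : ‖iteratedFDerivWithin ℝ N (orbitMap s v.1 ∘ rotationChart) S 0‖ ≤
      N.factorial * T * D ^ N := by
    refine norm_iteratedFDerivWithin_comp_le (N := ∞) (t := slDomain) v.2
      contDiff_rotationChart.contDiffOn (by exact_mod_cast le_top) isOpen_slDomain.uniqueDiffOn hud
      (fun θ hθ => rotationChart_mem hθ) h0 (fun i hi => ?_) (fun i hi1 hi => ?_)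
    · rw [hr0, iteratedFDerivWithin_of_isOpen i isOpen_slDomain one_mem_slDomain]
      exact Finset.single_le_sum (f := fun j => smoothSeminorm s j v)
        (fun j _ => apply_nonneg _ _) (Finset.mem_range.2 (Nat.lt_succ_of_le hi))
    · refine le_trans ?_ (le_self_pow₀ hD1 (by omega))
      have := Finset.single_le_sum (f := fun i => ‖iteratedFDerivWithin ℝ i rotationChart S 0‖)
        (fun j _ => norm_nonneg _) (Finset.mem_range.2 (Nat.lt_succ_of_le hi))
      simp only [hD]
      linarith
  -- Pairing with the monomial isolates the `k`-th coefficient. Its norm is bounded independently of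
  -- `k` because monomials are at most `1` on the disc.
  set Λ : Lp ℂ 2 (hilbertMeasure s) →L[ℝ] ℂ :=
    (innerSL ℂ (toL2 s (monomialVector hs k))).restrictScalars ℝ with hΛ
  have hΛn : ‖Λ‖ ≤ B := by
    rw [hΛ, ContinuousLinearMap.norm_restrictScalars, innerSL_apply_norm]
    refine (Lp.norm_le_of_ae_bound zero_le_one (C := 1) ?_).trans (by rw [mul_one])
    filter_upwards [toL2_coeFn (monomialVector hs k),
      ae_hilbertMeasure (s := s) (P := fun z => z ∈ ball (0 : ℂ) 1) fun z hz => hz] with z hz1 hz2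
    rw [hz1, monomialVector_apply hs k hz2, norm_pow]
    exact pow_le_one₀ (norm_nonneg z) (mem_ball_zero_iff.1 hz2).le
  have hsmooth : ContDiffOn ℝ ∞ (orbitMap s v.1 ∘ rotationChart) S :=
    ContDiffOn.comp (t := slDomain) v.2 contDiff_rotationChart.contDiffOn
      fun θ hθ => rotationChart_mem hθ
  have hder : ‖iteratedFDerivWithin ℝ N (Λ ∘ (orbitMap s v.1 ∘ rotationChart)) S 0‖ ≤
      B * (N.factorial * T * D ^ N) := by
    rw [Λ.iteratedFDerivWithin_comp_left (hsmooth 0 h0) hud h0 (by exact_mod_cast le_top)]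
    exact (Λ.norm_compContinuousMultilinearMap_le _).trans
      (mul_le_mul hΛn hcomp (norm_nonneg _) (by positivity))
  have hformula : ∀ θ ∈ S, (Λ ∘ (orbitMap s v.1 ∘ rotationChart)) θ =
      a / kernelCoeff s k * exp (-((s + 2 * k : ℝ) : ℂ) * I * θ) := fun θ hθ =>
    inner_monomial_orbitMap hs v.1 k hθ
  rw [iteratedFDerivWithin_congr hformula h0, iteratedFDerivWithin_of_isOpen N hSo h0,
    norm_iteratedFDeriv_eq_norm_iteratedDeriv, iteratedDeriv_const_mul_cexp] at hder
  have hc := kernelCoeff_pos hs k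
  have hk : (0 : ℝ) ≤ k := k.cast_nonneg
  beta_reduce at hder
  rw [ofReal_zero, mul_zero, exp_zero, mul_one, norm_mul, norm_div, norm_real, norm_pow, norm_mul,
    norm_neg, norm_I, mul_one, norm_real, Real.norm_of_nonneg hc.le,
    Real.norm_of_nonneg (by positivity), div_mul_eq_mul_div, div_le_iff₀ hc] at hder
  have h2 : (k + 1 : ℝ) ^ N ≤ (s + 2 * k) ^ N := by
    gcongr 1
    linarith
  have h3 : ‖a‖ * (k + 1 : ℝ) ^ N ≤ B * (N.factorial * T * D ^ N) * (k + 1 : ℝ) ^ m := by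
    have hT0 : 0 ≤ T := Finset.sum_nonneg fun j _ => apply_nonneg _ _
    calc _ ≤ ‖a‖ * (s + 2 * k) ^ N := by gcongr
      _ ≤ _ := hder
      _ ≤ _ := by
        have := kernelCoeff_le hs hm k
        gcongr
  rw [hN, pow_add, ← mul_assoc] at h3
  refine (le_of_mul_le_mul_right h3 (by positivity)).trans (le_of_eq ?_)
  ring

/-! ### Expansion of smooth vectors in monomials -/

lemma withSeminorms_smoothSeminorm (s : ℝ) : WithSeminorms (smoothSeminorm s) := ⟨rfl⟩

instance (s : ℝ) : IsTopologicalAddGroup (SmoothVector s) :=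
  (withSeminorms_smoothSeminorm s).topologicalAddGroup

/-- Uniqueness of power series coefficients: both families, divided by `c_k`, are the moments of
`f`. -/
lemma taylorCoeff_eq {s : ℝ} (hs : 1 < s) {f : ℂ → ℂ} (hf : DifferentiableOn ℂ f (ball 0 1))
    (hfi : Integrable f (hilbertMeasure s)) {b : ℕ → ℂ}
    (hb : ∀ z ∈ ball (0 : ℂ) 1, HasSum (fun k => b k * z ^ k) (f z)) (k : ℕ) :
    taylorCoeff f k = b k := by
  have h1 := integral_mul_conj_pow hs hb hfi k
  rw [integral_mul_conj_pow hs (fun z hz => hasSum_taylorCoeff hf hz) hfi k] at h1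
  exact (div_left_inj' (by exact_mod_cast (kernelCoeff_pos hs k).ne')).1 h1

lemma SmoothVector.differentiableOn {s : ℝ} (v : SmoothVector s) :
    DifferentiableOn ℂ v.toFun (ball 0 1) := v.1.2.2.1

lemma SmoothVector.integrable {s : ℝ} (hs : 1 < s) (v : SmoothVector s) :
    Integrable v.toFun (hilbertMeasure s) := integrable_bergmanSpace hs v.1

lemma summable_inv_sq : Summable fun k : ℕ => ((k + 1 : ℝ) ^ 2)⁻¹ := by
  have h := (summable_nat_add_iff 1).2 (Real.summable_nat_pow_inv.2 one_lt_two)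
  simpa using h

lemma tsum_taylorCoeff_le {s : ℝ} (hs : 1 < s) (n : ℕ) :
    ∃ C, 0 ≤ C ∧ ∃ N : ℕ, ∀ v : SmoothVector s,
      (Summable fun k => ‖taylorCoeff v.toFun k‖ * (k + 1 : ℝ) ^ n) ∧
      ∑' k, ‖taylorCoeff v.toFun k‖ * (k + 1 : ℝ) ^ n ≤
        C * ∑ j ∈ Finset.range (N + 1), smoothSeminorm s j v := by
  -- Two additional powers of decay leave the summable factor `1 / (k + 1) ^ 2`.
  obtain ⟨C, hC, N, h⟩ := norm_taylorCoeff_le hs (n + 2)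
  refine ⟨C * ∑' k : ℕ, ((k + 1 : ℝ) ^ 2)⁻¹, mul_nonneg hC (tsum_nonneg fun k => by positivity),
    N, fun v => ?_⟩
  set T := ∑ j ∈ Finset.range (N + 1), smoothSeminorm s j v
  have hle : ∀ k : ℕ, ‖taylorCoeff v.toFun k‖ * (k + 1 : ℝ) ^ n ≤
      C * T * ((k + 1 : ℝ) ^ 2)⁻¹ := fun k => by
    rw [← div_eq_mul_inv, le_div_iff₀ (by positivity), mul_assoc, ← pow_add]
    exact h v k
  have hsum := summable_inv_sq.mul_left (C * T)
  have h1 := Summable.of_nonneg_of_le (fun k => by positivity) hle hsum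
  refine ⟨h1, (h1.tsum_le_tsum hle hsum).trans (le_of_eq ?_)⟩
  rw [tsum_mul_left]
  ring

lemma summable_taylorCoeff {s : ℝ} (hs : 1 < s) (v : SmoothVector s) (n : ℕ) :
    Summable fun k => ‖taylorCoeff v.toFun k‖ * (k + 1 : ℝ) ^ n := by
  obtain ⟨C, hC, N, h⟩ := tsum_taylorCoeff_le hs n
  exact (h v).1

lemma toFun_sub_sum {s : ℝ} (hs : 1 < s) (v : SmoothVector s) (a : ℕ → ℂ) (S : Finset ℕ) {z : ℂ}
    (hz : z ∈ ball (0 : ℂ) 1) :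
    (v - ∑ k ∈ S, a k • smoothMonomial hs k).toFun z = v.toFun z - ∑ k ∈ S, a k * z ^ k := by
  have hsub : ∀ u w : SmoothVector s, (u - w).toFun z = u.toFun z - w.toFun z := fun _ _ => rfl
  have hsum : (∑ k ∈ S, a k • smoothMonomial hs k).toFun z = ∑ k ∈ S, a k * z ^ k := by
    induction S using Finset.induction_on with
    | empty => rfl
    | insert j S hj ih =>
      rw [Finset.sum_insert hj, Finset.sum_insert hj, ← ih, ← smoothMonomial_apply hs j hz]
      rfl
  rw [hsub, hsum]

/-- The Taylor series of a smooth vector converges in the space of smooth vectors. -/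
lemma hasSum_smoothVector {s : ℝ} (hs : 1 < s) (v : SmoothVector s) :
    HasSum (fun k => taylorCoeff v.toFun k • smoothMonomial hs k) v := by
  set a := taylorCoeff v.toFun with ha
  refine ((withSeminorms_smoothSeminorm s).tendsto_nhds _ v).2 fun n ε hε => ?_
  obtain ⟨C, hC, h⟩ := smoothSeminorm_le_tsum hs n
  have hsum := summable_taylorCoeff hs v (n + 1)
  -- The remainder is a smooth vector whose coefficients are those of `v` off `S`, so its seminorm
  -- is controlled by the tail of a convergent series.
  have hbound : ∀ S : Finset ℕ, smoothSeminorm s n (∑ k ∈ S, a k • smoothMonomial hs k - v) ≤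
      C * ∑' k : {k // k ∉ S}, ‖a k‖ * ((k : ℕ) + 1 : ℝ) ^ (n + 1) := fun S => by
    have hind : ∀ k, ‖(Sᶜ : Set ℕ).indicator a k‖ * (k + 1 : ℝ) ^ (n + 1) =
        (Sᶜ : Set ℕ).indicator (fun k : ℕ => ‖a k‖ * (k + 1 : ℝ) ^ (n + 1)) k := fun k => by
      by_cases hk : k ∈ S <;> simp [hk]
    rw [map_sub_rev]
    refine (h (v - ∑ k ∈ S, a k • smoothMonomial hs k) ((Sᶜ : Set ℕ).indicator a)
      (fun z hz => ?_) ?_).trans (le_of_eq ?_)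
    · rw [toFun_sub_sum hs v a S hz]
      have h1 := (hasSum_taylorCoeff v.differentiableOn hz).sub
        (hasSum_sum_of_ne_finset_zero (f := fun k => (S : Set ℕ).indicator a k * z ^ k) (s := S)
          fun k hk => by simp [hk])
      have h2 : ∑ k ∈ S, (S : Set ℕ).indicator a k * z ^ k = ∑ k ∈ S, a k * z ^ k :=
        Finset.sum_congr rfl fun k hk => by simp [hk]
      rw [h2] at h1
      have h3 : (fun k => (Sᶜ : Set ℕ).indicator a k * z ^ k) =
          fun k => taylorCoeff v.toFun k * z ^ k - (S : Set ℕ).indicator a k * z ^ k := by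
        funext k
        by_cases hk : k ∈ S <;> simp [hk, ha]
      rw [h3]
      exact h1
    · simp only [hind]
      exact hsum.indicator _
    · simp only [hind]
      rw [← tsum_subtype]
      rfl
  have hlim := (tendsto_tsum_compl_atTop_zero
    fun k : ℕ => ‖a k‖ * (k + 1 : ℝ) ^ (n + 1)).const_mul C
  rw [mul_zero] at hlim
  filter_upwards [hlim.eventually (gt_mem_nhds hε)] with S hS
  exact (hbound S).trans_lt hS

/-- Smooth vectors are bounded on the disc, with bounds by the seminorms. -/
lemma norm_toFun_le {s : ℝ} (hs : 1 < s) :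
    ∃ C, 0 ≤ C ∧ ∃ N : ℕ, ∀ v : SmoothVector s, ∀ z ∈ ball (0 : ℂ) 1,
      ‖v.toFun z‖ ≤ C * ∑ j ∈ Finset.range (N + 1), smoothSeminorm s j v := by
  obtain ⟨C, hC, N, h⟩ := tsum_taylorCoeff_le hs 0
  refine ⟨C, hC, N, fun v z hz => ?_⟩
  obtain ⟨h1, h2⟩ := h v
  rw [← (hasSum_taylorCoeff v.differentiableOn hz).tsum_eq]
  refine le_trans (tsum_of_norm_bounded h1.hasSum fun k => ?_) h2
  rw [norm_mul, norm_pow, pow_zero, mul_one]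
  exact mul_le_of_le_one_right (norm_nonneg _)
    (pow_le_one₀ (norm_nonneg z) (mem_ball_zero_iff.1 hz).le)

/-- Continuity of `φ` applied to the Taylor expansion of `v`. Any power series of `v` may be used,
by uniqueness of the coefficients, and a distribution is therefore determined by its values on
monomials. -/
lemma hasSum_distribution {s : ℝ} (hs : 1 < s) (φ : Distribution s) (v : SmoothVector s)
    {b : ℕ → ℂ} (hb : ∀ z ∈ ball (0 : ℂ) 1, HasSum (fun k => b k * z ^ k) (v.toFun z)) :
    HasSum (fun k => conj (b k) * φ (smoothMonomial hs k)) (φ v) := by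
  have h1 := (hasSum_smoothVector hs v).mapL φ
  simp only [taylorCoeff_eq hs v.differentiableOn (v.integrable hs) hb, map_smulₛₗ, smul_eq_mul]
    at h1
  exact h1

/-! ### Distributions given by integrable functions -/

lemma aestronglyMeasurable_toFun {s : ℝ} (v : SmoothVector s) :
    AEStronglyMeasurable v.toFun (hilbertMeasure s) :=
  (v.1.2.2.2.smul_measure (c := ENNReal.ofReal ((s - 1) / Real.pi)) ENNReal.ofReal_ne_top).1

/-- Smooth vectors are bounded, so integrability of `f` is enough; `f` need not belong to `H_s`. -/
lemma integrable_mul_conj_toFun {s : ℝ} (hs : 1 < s) {f : ℂ → ℂ}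
    (hf : Integrable f (hilbertMeasure s)) (v : SmoothVector s) :
    Integrable (fun z => f z * conj (v.toFun z)) (hilbertMeasure s) := by
  obtain ⟨C, hC, N, h⟩ := norm_toFun_le hs
  refine hf.mul_bdd (c := C * ∑ j ∈ Finset.range (N + 1), smoothSeminorm s j v)
    (continuous_conj.comp_aestronglyMeasurable (aestronglyMeasurable_toFun v))
    (ae_hilbertMeasure fun z hz => ?_)
  rw [RCLike.norm_conj]
  exact h v z hz

/-- The conjugate-linear functional `v ↦ ⟨f, v⟩`. -/
def pairing {s : ℝ} (hs : 1 < s) (f : ℂ → ℂ) (hf : Integrable f (hilbertMeasure s)) :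
    SmoothVector s →ₛₗ[starRingEnd ℂ] ℂ where
  toFun v := ∫ z, f z * conj (v.toFun z) ∂(hilbertMeasure s)
  map_add' v w := by
    rw [← integral_add (integrable_mul_conj_toFun hs hf v) (integrable_mul_conj_toFun hs hf w)]
    congr 1
    funext z
    rw [← mul_add, ← map_add]
    rfl
  map_smul' c v := by
    rw [smul_eq_mul, ← integral_const_mul]
    congr 1
    funext z
    rw [show (c • v).toFun z = c * v.toFun z from rfl, map_mul]
    ring

/-- The distribution `v ↦ ⟨f, v⟩`. -/
def toDistribution {s : ℝ} (hs : 1 < s) (f : ℂ → ℂ) (hf : Integrable f (hilbertMeasure s)) :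
    Distribution s where
  toLinearMap := pairing hs f hf
  cont := by
    obtain ⟨C, hC, N, h⟩ := norm_toFun_le hs
    have h0 : 0 ≤ ∫ z, ‖f z‖ ∂(hilbertMeasure s) := integral_nonneg fun z => norm_nonneg (f z)
    -- The functional is at most the `L¹` norm of `f` times the supremum of `v`. The factor `N + 1`
    -- replaces a sum of `N + 1` seminorms by their maximum.
    refine (withSeminorms_smoothSeminorm s).continuous_normedSpace_rng ℂ (pairing hs f hf)
      ⟨Finset.range (N + 1), ⟨(∫ z, ‖f z‖ ∂(hilbertMeasure s)) * (C * (N + 1)), by positivity⟩,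
        fun v => ?_⟩
    change ‖∫ z, f z * conj (v.toFun z) ∂(hilbertMeasure s)‖ ≤
      ((∫ z, ‖f z‖ ∂(hilbertMeasure s)) * (C * (N + 1))) * ((Finset.range (N + 1)).sup
        (smoothSeminorm s)) v
    have h1 : ∑ j ∈ Finset.range (N + 1), smoothSeminorm s j v ≤
        (N + 1) * ((Finset.range (N + 1)).sup (smoothSeminorm s)) v := by
      refine (Finset.sum_le_card_nsmul _ _ _ fun j hj =>
        Seminorm.le_finset_sup_apply (p := smoothSeminorm s) (x := v) hj).trans (le_of_eq ?_)
      simp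
    refine (norm_integral_le_of_norm_le (hf.norm.mul_const (C * ((N + 1) *
      ((Finset.range (N + 1)).sup (smoothSeminorm s)) v)))
      (ae_hilbertMeasure fun z hz => ?_)).trans (le_of_eq ?_)
    · rw [norm_mul, RCLike.norm_conj]
      refine mul_le_mul_of_nonneg_left ((h v z hz).trans ?_) (norm_nonneg _)
      gcongr
    · rw [integral_mul_const]
      ring

/-! ### Coordinates on the disc -/

/-- The point of the upper half plane given by the coordinates `q = a + ib` of `G`. -/
def halfPlanePoint (q : ℂ) : ℂ := (q.re * q.im : ℝ) + (q.re ^ 2 : ℝ) * I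

/-- The Cayley transform from the upper half plane to the disc. -/
def cayleyMap (τ : ℂ) : ℂ := I * (τ - I) / (τ + I)

/-- The element of `G` with coordinates `q = a + ib`. -/
def axbElement (q : ℂ) (hq : 0 < q.re) : axbGroup :=
  ⟨⟨!![q.re, q.im; 0, q.re⁻¹], by rw [Matrix.det_fin_two_of]; field_simp; ring⟩, by
    refine ⟨?_, ?_⟩ <;> simp [hq]⟩

lemma coe_one_one (x : axbGroup) : x.1 1 1 = (x.1 0 0)⁻¹ := by
  have h := x.1.det_coe
  rw [Matrix.det_fin_two, x.2.1, mul_zero, sub_zero] at h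
  exact eq_inv_of_mul_eq_one_right h

lemma cayleyα_axb (x : axbGroup) :
    cayleyα x.1 = ((x.1 0 0 + (x.1 0 0)⁻¹ : ℝ) + (x.1 0 1 : ℝ) * I) / 2 := by
  rw [cayleyα, coe_one_one, x.2.1, sub_zero]

lemma cayleyβ_axb (x : axbGroup) :
    cayleyβ x.1 = ((x.1 0 1 : ℝ) + (x.1 0 0 - (x.1 0 0)⁻¹ : ℝ) * I) / 2 := by
  rw [cayleyβ, coe_one_one, x.2.1, add_zero]

lemma re_cayleyα_pos (x : axbGroup) : 0 < (cayleyα x.1).re := by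
  rw [re_cayleyα]
  exact div_pos (trace_pos x) two_pos

lemma cayleyα_ne_zero (x : axbGroup) : cayleyα x.1 ≠ 0 := fun h => by
  have := re_cayleyα_pos x
  rw [h, zero_re] at this
  exact this.false

/-- The coordinates of an element of `G` as a complex number. -/
def axbComplex (x : axbGroup) : ℂ := ⟨x.1 0 0, x.1 0 1⟩

lemma halfPlanePoint_add_I_ne_zero {q : ℂ} : halfPlanePoint q + I ≠ 0 := fun h => by
  have := congrArg im h
  simp [halfPlanePoint, -ofReal_pow] at this
  nlinarith [sq_nonneg q.re]

/-- The half plane point `ab + i a²` is the image of `i` under the fractional linear action of `x`,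
and `β / ᾱ` is the image of `0` under `z ↦ (αz + β) / (β̄z + ᾱ)`; the Cayley transform carries one
to the other. -/
lemma cayley_quotient (x : axbGroup) :
    cayleyβ x.1 / conj (cayleyα x.1) = cayleyMap (halfPlanePoint (axbComplex x)) := by
  have h0 : ((x.1 0 0 : ℝ) : ℂ) ≠ 0 := by exact_mod_cast x.2.2.ne'
  have h1 := halfPlanePoint_add_I_ne_zero (q := axbComplex x)
  have h2 : conj (cayleyα x.1) ≠ 0 := (map_ne_zero _).2 (cayleyα_ne_zero x)
  rw [cayleyMap, div_eq_div_iff h2 h1]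
  rw [cayleyα_axb, cayleyβ_axb, halfPlanePoint, axbComplex]
  simp only [map_div₀, map_add, map_mul, conj_ofReal, conj_I, map_inv₀, ofReal_add, ofReal_sub, ofReal_inv,
    ofReal_mul, ofReal_pow, map_ofNat]
  field_simp
  ring_nf
  simp only [I_sq, show I ^ 3 = -I by rw [pow_succ, I_sq]; ring]
  ring

lemma norm_cayley_quotient_lt (x : axbGroup) : ‖cayleyβ x.1 / conj (cayleyα x.1)‖ < 1 := by
  have h := normSq_cayley x.1
  rw [normSq_eq_norm_sq, normSq_eq_norm_sq] at h
  rw [norm_div, RCLike.norm_conj, div_lt_one (norm_pos_iff.2 (cayleyα_ne_zero x))]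
  exact lt_of_pow_lt_pow_left₀ 2 (norm_nonneg _) (by linarith)

lemma exists_halfPlanePoint {w : ℂ} (hw : ‖w‖ < 1) :
    ∃ q : ℂ, 0 < q.re ∧ cayleyMap (halfPlanePoint q) = w := by
  have hne : w - I ≠ 0 := fun h => by
    rw [sub_eq_zero.1 h, norm_I] at hw
    exact hw.false
  -- The inverse Cayley transform of `w`. Solving `ab + i a² = τ` then gives `a = √(Im τ)` and `b =
  -- Re τ / a`.
  set τ : ℂ := (1 - I * w) / (w - I) with hτ
  have him : 0 < τ.im := by
    have h1 : τ.im = (1 - normSq w) / normSq (w - I) := by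
      rw [hτ, div_im]
      simp [normSq_apply]
      ring
    rw [h1]
    refine div_pos ?_ (normSq_pos.2 hne)
    rw [normSq_eq_norm_sq]
    nlinarith [norm_nonneg w]
  have ha : 0 < √τ.im := Real.sqrt_pos.2 him
  refine ⟨⟨√τ.im, τ.re / √τ.im⟩, ha, ?_⟩
  have h2 : halfPlanePoint ⟨√τ.im, τ.re / √τ.im⟩ = τ := by
    simp only [halfPlanePoint]
    rw [Real.sq_sqrt him.le, mul_div_cancel₀ _ ha.ne', re_add_im]
  have h3 : τ * (w - I) = 1 - I * w := div_mul_cancel₀ _ hne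
  have h4 : τ + I ≠ 0 := fun h => by
    have := congrArg im h
    simp at this
    linarith
  rw [h2, cayleyMap, div_eq_iff h4]
  linear_combination (-1) * h3 - I_sq

/-- Transitivity of `G` on the disc: wavelet transforms on `G` see every value of the holomorphic
function behind them. -/
lemma exists_cayley_quotient {w : ℂ} (hw : ‖w‖ < 1) :
    ∃ x : axbGroup, cayleyβ x.1 / conj (cayleyα x.1) = w := by
  obtain ⟨q, hq, h⟩ := exists_halfPlanePoint hw
  refine ⟨axbElement q hq, ?_⟩
  rw [cayley_quotient, ← h]
  rfl

/-! ### The wavelet transform -/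

/-- The denominator factors as `α (1 - w̄ z)` with `w = β / ᾱ`. Both factors have positive real
part, so their arguments add up to less than `π` in absolute value and the principal powers
multiply. -/
lemma translate_apply {s : ℝ} (hs : 1 < s) (x : axbGroup) {z : ℂ} (hz : z ∈ ball (0 : ℂ) 1) :
    (translate hs x).toFun z = cayleyα x.1 ^ (-(s : ℂ)) *
      (1 - conj (cayleyβ x.1 / conj (cayleyα x.1)) * z) ^ (-(s : ℂ)) := by
  have hα := re_cayleyα_pos x
  have hα0 := cayleyα_ne_zero x
  set ζ := conj (cayleyβ x.1 / conj (cayleyα x.1)) with hζ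
  have hζ1 : ‖ζ‖ < 1 := by rw [hζ, RCLike.norm_conj]; exact norm_cayley_quotient_lt x
  have hre := one_sub_mul_re_pos hζ1 (mem_ball_zero_iff.1 hz).le
  have hne : 1 - ζ * z ≠ 0 := fun h => by rw [h, zero_re] at hre; exact hre.false
  have e1 : -conj (cayleyβ x.1) * z + cayleyα x.1 = cayleyα x.1 * (1 - ζ * z) := by
    rw [hζ, map_div₀, conj_conj]
    field_simp
    ring
  have e2 : (translate hs x).toFun z = (-conj (cayleyβ x.1) * z + cayleyα x.1) ^ (-(s : ℂ)) := by
    have hT := moebius_mem (normSq_cayley x.1) hα hz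
    simp only [translate, SmoothVector.toFun, discreteSeries, discreteSeriesFun, unitVector,
      ofBounded, LinearMap.coe_mk, AddHom.coe_mk, Set.indicator_of_mem hz,
      Set.indicator_of_mem hT, mul_one]
  have h1 := abs_lt.1 (abs_arg_lt_pi_div_two_iff.2 (Or.inl hα))
  have h2 := abs_lt.1 (abs_arg_lt_pi_div_two_iff.2 (Or.inl hre))
  rw [e2, e1, cpow_def_of_ne_zero (mul_ne_zero hα0 hne), cpow_def_of_ne_zero hα0,
    cpow_def_of_ne_zero hne, ← exp_add, log_mul hα0 hne ?_]
  · congr 1; ring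
  · exact ⟨by linarith, by linarith⟩

lemma conj_cayleyα_cpow (s : ℝ) (x : axbGroup) :
    conj (cayleyα x.1 ^ (-(s : ℂ))) = conj (cayleyα x.1) ^ (-(s : ℂ)) := by
  have h := abs_lt.1 (abs_arg_lt_pi_div_two_iff.2 (Or.inl (re_cayleyα_pos x)))
  rw [conj_cpow _ _ (by linarith [Real.pi_pos] : (cayleyα x.1).arg < Real.pi).ne]
  simp

/-- The binomial series gives the Taylor coefficients of `π_s(x)u`, on which `φ` acts termwise. Up
to a nonvanishing factor the transform becomes a power series in `w = β / ᾱ`. -/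
lemma hasSum_wavelet {s : ℝ} (hs : 1 < s) (φ : Distribution s) (x : axbGroup) :
    HasSum (fun k => conj (cayleyα x.1) ^ (-(s : ℂ)) * (kernelCoeff s k *
      φ (smoothMonomial hs k) * (cayleyβ x.1 / conj (cayleyα x.1)) ^ k)) (wavelet hs φ x) := by
  set w := cayleyβ x.1 / conj (cayleyα x.1) with hw
  have h := hasSum_distribution hs φ (translate hs x)
    (b := fun k => cayleyα x.1 ^ (-(s : ℂ)) * (kernelCoeff s k * conj w ^ k)) fun z hz => by
      rw [translate_apply hs x hz]
      have h1 : ‖conj w * z‖ < 1 := by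
        rw [norm_mul, RCLike.norm_conj]
        have := norm_cayley_quotient_lt x
        rw [← hw] at this
        nlinarith [norm_nonneg w, norm_nonneg z, mem_ball_zero_iff.1 hz]
      have h2 := (hasSum_kernel s h1).mul_left (cayleyα x.1 ^ (-(s : ℂ)))
      simpa only [mul_pow, mul_assoc] using h2
  have e : (fun k => conj (cayleyα x.1) ^ (-(s : ℂ)) * (kernelCoeff s k *
      φ (smoothMonomial hs k) * w ^ k)) = fun k => conj (cayleyα x.1 ^ (-(s : ℂ)) *
        (kernelCoeff s k * conj w ^ k)) * φ (smoothMonomial hs k) := by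
    funext k
    rw [map_mul, conj_cayleyα_cpow, map_mul, conj_ofReal, map_pow, conj_conj]
    ring
  rw [e]
  exact h

lemma cpow_cayleyα_ne_zero (s : ℝ) (x : axbGroup) :
    conj (cayleyα x.1) ^ (-(s : ℂ)) ≠ 0 := by
  rw [← conj_cayleyα_cpow, map_ne_zero, Ne, cpow_eq_zero_iff, not_and]
  exact fun h => absurd h (cayleyα_ne_zero x)

/-- The reproducing formula: the wavelet transform of the distribution given by a holomorphic
function. -/
lemma wavelet_toDistribution {s : ℝ} (hs : 1 < s) {f : ℂ → ℂ}
    (hd : DifferentiableOn ℂ f (ball 0 1)) (hf : Integrable f (hilbertMeasure s)) (x : axbGroup) :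
    wavelet hs (toDistribution hs f hf) x =
      conj (cayleyα x.1) ^ (-(s : ℂ)) * f (cayleyβ x.1 / conj (cayleyα x.1)) := by
  -- The denominators `c_k` cancel against the coefficients of the kernel, leaving the Taylor series
  -- of `f`.
  have h1 : ∀ k, toDistribution hs f hf (smoothMonomial hs k) =
      taylorCoeff f k / kernelCoeff s k := fun k => by
    rw [← integral_mul_conj_pow hs (fun z hz => hasSum_taylorCoeff hd hz) hf k]
    refine integral_congr_ae (ae_hilbertMeasure fun z hz => ?_)
    change f z * conj _ = _
    rw [smoothMonomial_apply hs k hz, map_pow]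
  have h2 := hasSum_wavelet hs (toDistribution hs f hf) x
  refine h2.unique ?_
  refine HasSum.mul_left _ ?_
  have h3 := hasSum_taylorCoeff hd (mem_ball_zero_iff.2 (norm_cayley_quotient_lt x))
  have e : ∀ k, (kernelCoeff s k : ℂ) * (taylorCoeff f k / kernelCoeff s k) =
      taylorCoeff f k := fun k => mul_div_cancel₀ _ (by exact_mod_cast (kernelCoeff_pos hs k).ne')
  simpa only [h1, e] using h3

/-- A distribution is determined by its wavelet transform. -/
lemma distribution_eq_zero {s : ℝ} (hs : 1 < s) {φ : Distribution s}
    (h : ∀ x, wavelet hs φ x = 0) : φ = 0 := by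
  have h1 : ∀ w ∈ ball (0 : ℂ) 1,
      HasSum (fun k => (kernelCoeff s k * φ (smoothMonomial hs k)) * w ^ k) 0 := fun w hw => by
    obtain ⟨x, rfl⟩ := exists_cayley_quotient (mem_ball_zero_iff.1 hw)
    have h2 := hasSum_wavelet hs φ x
    rw [h x, ← mul_zero (conj (cayleyα x.1) ^ (-(s : ℂ)))] at h2
    exact (hasSum_mul_left_iff (cpow_cayleyα_ne_zero s x)).1 h2
  have h3 : ∀ k, φ (smoothMonomial hs k) = 0 := fun k => by
    -- The power series sums to zero on the disc, so its coefficients are recovered as moments of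
    -- the zero function.
    have h4 := integral_mul_conj_pow hs (f := fun _ => 0) h1 (integrable_zero _ _ _) k
    have hc : (kernelCoeff s k : ℂ) ≠ 0 := by exact_mod_cast (kernelCoeff_pos hs k).ne'
    simp only [zero_mul, integral_zero] at h4
    rw [mul_div_cancel_left₀ _ hc] at h4
    exact h4.symm
  ext v
  have h5 := hasSum_distribution hs φ v fun z hz => hasSum_taylorCoeff v.differentiableOn hz
  simp only [h3, mul_zero] at h5
  exact h5.unique hasSum_zero

lemma differentiableOn_of_hasSum {b : ℕ → ℂ} {f : ℂ → ℂ}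
    (hb : ∀ z ∈ ball (0 : ℂ) 1, HasSum (fun k => b k * z ^ k) (f z)) :
    DifferentiableOn ℂ f (ball 0 1) := by
  intro z hz
  obtain ⟨R, hzR, hR⟩ := exists_between (mem_ball_zero_iff.1 hz)
  have hR0 : 0 ≤ R := (norm_nonneg z).trans hzR.le
  have hsum : Summable fun k => ‖b k * (R : ℂ) ^ k‖ :=
    (hb R (by simpa [abs_of_nonneg hR0] using hR)).summable.norm
  have h1 : DifferentiableOn ℂ (fun w => ∑' k, b k * w ^ k) (ball 0 R) := by
    refine differentiableOn_tsum_of_summable_norm hsum (fun k => by fun_prop) isOpen_ball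
      fun k w hw => ?_
    rw [norm_mul, norm_mul, norm_pow, norm_pow, norm_real, Real.norm_of_nonneg hR0]
    have := (mem_ball_zero_iff.1 hw).le
    gcongr
  have h2 : DifferentiableOn ℂ f (ball 0 R) :=
    h1.congr fun w hw => (hb w (ball_subset_ball hR.le hw)).tsum_eq.symm
  exact (h2.differentiableAt (isOpen_ball.mem_nhds
    (mem_ball_zero_iff.2 hzR))).differentiableWithinAt

/-- The wavelet transform of a distribution comes from a holomorphic function. -/
lemma exists_holomorphic {s : ℝ} (hs : 1 < s) (φ : Distribution s) :
    ∃ f : ℂ → ℂ, (∀ z ∉ ball (0 : ℂ) 1, f z = 0) ∧ DifferentiableOn ℂ f (ball 0 1) ∧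
      ∀ x, wavelet hs φ x =
        conj (cayleyα x.1) ^ (-(s : ℂ)) * f (cayleyβ x.1 / conj (cayleyα x.1)) := by
  set F : ℂ → ℂ := fun w => ∑' k, (kernelCoeff s k * φ (smoothMonomial hs k)) * w ^ k with hF
  -- Convergence at each `w` is inherited from the wavelet series at a group element over `w`, so no
  -- growth estimate for `φ(z ^ k)` is needed.
  have h1 : ∀ w ∈ ball (0 : ℂ) 1,
      HasSum (fun k => (kernelCoeff s k * φ (smoothMonomial hs k)) * w ^ k) (F w) :=
    fun w hw => by
      obtain ⟨x, rfl⟩ := exists_cayley_quotient (mem_ball_zero_iff.1 hw)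
      exact ((summable_mul_left_iff (cpow_cayleyα_ne_zero s x)).1
        (hasSum_wavelet hs φ x).summable).hasSum
  refine ⟨(ball (0 : ℂ) 1).indicator F, fun z hz => Set.indicator_of_notMem hz _,
    (differentiableOn_of_hasSum h1).congr fun z hz => Set.indicator_of_mem hz _, fun x => ?_⟩
  have hx := mem_ball_zero_iff.2 (norm_cayley_quotient_lt x)
  rw [Set.indicator_of_mem hx]
  exact (hasSum_wavelet hs φ x).unique ((h1 _ hx).mul_left _)

/-! ### The Haar measure of `G` in disc coordinates -/

/-- The point of the disc given by the coordinates `q = a + ib` of `G`. -/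
def diskPoint (q : ℂ) : ℂ := cayleyMap (halfPlanePoint q)

lemma measurable_diskPoint : Measurable diskPoint := by
  unfold diskPoint cayleyMap halfPlanePoint
  fun_prop

lemma one_sub_norm_diskPoint (q : ℂ) :
    1 - ‖diskPoint q‖ ^ 2 = 4 * q.re ^ 2 / ‖halfPlanePoint q + I‖ ^ 2 := by
  have h0 : 0 < ‖halfPlanePoint q + I‖ := norm_pos_iff.2 halfPlanePoint_add_I_ne_zero
  rw [diskPoint, cayleyMap, norm_div, norm_mul, norm_I, one_mul, div_pow, eq_div_iff (by positivity),
    sub_mul, div_mul_cancel₀ _ (by positivity), one_mul, ← normSq_eq_norm_sq, ← normSq_eq_norm_sq]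
  simp [halfPlanePoint, normSq_apply, -ofReal_pow]
  ring

lemma diskPoint_mem {q : ℂ} (hq : 0 < q.re) : diskPoint q ∈ ball (0 : ℂ) 1 := by
  rw [mem_ball_zero_iff]
  have h0 : 0 < ‖halfPlanePoint q + I‖ := norm_pos_iff.2 halfPlanePoint_add_I_ne_zero
  have h1 := one_sub_norm_diskPoint q
  have h2 : 0 < 4 * q.re ^ 2 / ‖halfPlanePoint q + I‖ ^ 2 := by positivity
  nlinarith [norm_nonneg (diskPoint q)]

/-- The derivative of `halfPlanePoint`. -/
def halfPlaneDeriv (q : ℂ) : ℂ →L[ℝ] ℂ :=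
  (q.re • imCLM + q.im • reCLM).smulRight 1 + ((2 * q.re) • reCLM).smulRight I

lemma hasFDerivAt_halfPlanePoint (q : ℂ) : HasFDerivAt halfPlanePoint (halfPlaneDeriv q) q := by
  have hre : HasFDerivAt (fun q : ℂ => q.re) reCLM q := reCLM.hasFDerivAt
  have him : HasFDerivAt (fun q : ℂ => q.im) imCLM q := imCLM.hasFDerivAt
  have h1 := (hre.mul him).smul_const (1 : ℂ)
  have h2 := (hre.pow 2).smul_const I
  refine ((h1.add h2).congr_of_eventuallyEq (.of_forall fun z => ?_)).congr_fderiv ?_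
  · simp [halfPlanePoint]
  · ext; simp [halfPlaneDeriv]

lemma det_halfPlaneDeriv (q : ℂ) : (halfPlaneDeriv q).det = -(2 * q.re ^ 2) := by
  rw [ContinuousLinearMap.det, ← LinearMap.det_toMatrix basisOneI, Matrix.det_fin_two]
  simp [LinearMap.toMatrix_apply, halfPlaneDeriv]
  ring

lemma hasDerivAt_cayleyMap {τ : ℂ} (h : τ + I ≠ 0) :
    HasDerivAt cayleyMap (-2 / (τ + I) ^ 2) τ := by
  have h1 : HasDerivAt (fun τ => I * (τ - I)) I τ := by
    simpa using ((hasDerivAt_id τ).sub_const I).const_mul I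
  refine (h1.div ((hasDerivAt_id τ).add_const I) h).congr_deriv ?_
  simp only [id]
  congr 1
  linear_combination (2 : ℂ) * I_sq

/-- The derivative of `diskPoint`. -/
def diskDeriv (q : ℂ) : ℂ →L[ℝ] ℂ :=
  ((ContinuousLinearMap.toSpanSingleton ℂ
    (-2 / (halfPlanePoint q + I) ^ 2)).restrictScalars ℝ).comp (halfPlaneDeriv q)

lemma hasFDerivAt_diskPoint (q : ℂ) : HasFDerivAt diskPoint (diskDeriv q) q :=
  ((hasDerivAt_cayleyMap halfPlanePoint_add_I_ne_zero).hasFDerivAt.restrictScalars ℝ).comp q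
    (hasFDerivAt_halfPlanePoint q)

/-- Product of the Jacobian `4 / |τ + i|⁴` of the Cayley transform and `2a²` of `(a, b) ↦ ab + i
a²`. Equivalently `da db / a² = 2 (1 - |w|²)^(-2) dw`, the origin of the factor `2^(1/p)`. -/
lemma abs_det_diskDeriv {q : ℂ} (hq : 0 < q.re) :
    |(diskDeriv q).det| = (1 - ‖diskPoint q‖ ^ 2) ^ 2 / (2 * q.re ^ 2) := by
  have h0 : 0 < ‖halfPlanePoint q + I‖ := norm_pos_iff.2 halfPlanePoint_add_I_ne_zero
  have h1 : (diskDeriv q).det = ((ContinuousLinearMap.toSpanSingleton ℂ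
      (-2 / (halfPlanePoint q + I) ^ 2)).restrictScalars ℝ).det * (halfPlaneDeriv q).det := by
    simp only [diskDeriv, ContinuousLinearMap.det, ContinuousLinearMap.toLinearMap_comp,
      LinearMap.det_comp]
  have h2 : ((ContinuousLinearMap.toSpanSingleton ℂ
      (-2 / (halfPlanePoint q + I) ^ 2)).restrictScalars ℝ).det =
      ‖-2 / (halfPlanePoint q + I) ^ 2‖ ^ 2 := by
    simp [ContinuousLinearMap.det, LinearMap.det_restrictScalars, Algebra.norm_complex_eq,
      Complex.normSq_eq_norm_sq, div_pow]
  rw [h1, h2, det_halfPlaneDeriv, one_sub_norm_diskPoint, abs_mul, abs_neg,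
    abs_of_nonneg (by positivity), abs_of_nonneg (by positivity), norm_div, norm_neg, norm_pow]
  rw [show ‖(2 : ℂ)‖ = 2 from by simp]
  field_simp
  norm_num

lemma injOn_diskPoint : Set.InjOn diskPoint {q | 0 < q.re} := by
  intro q hq q' hq' h
  have h1 : halfPlanePoint q = halfPlanePoint q' := by
    have e := h
    rw [diskPoint, diskPoint, cayleyMap, cayleyMap, div_eq_div_iff halfPlanePoint_add_I_ne_zero
      halfPlanePoint_add_I_ne_zero] at e
    linear_combination (-1 / 2) * e + (halfPlanePoint q - halfPlanePoint q') * I_sq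
  have hre := congrArg re h1
  have him := congrArg im h1
  simp [halfPlanePoint, -ofReal_pow] at hre him
  have h2 : q.re = q'.re := (pow_left_inj₀ hq.le hq'.le two_ne_zero).1 him
  refine Complex.ext h2 ?_
  rw [h2] at hre
  exact mul_left_cancel₀ (ne_of_gt hq') hre

lemma image_diskPoint : diskPoint '' {q | 0 < q.re} = ball 0 1 := by
  ext w
  constructor
  · rintro ⟨q, hq, rfl⟩
    exact diskPoint_mem hq
  · intro hw
    obtain ⟨q, hq, h⟩ := exists_halfPlanePoint (mem_ball_zero_iff.1 hw)
    exact ⟨q, hq, h⟩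

lemma measurableSet_re_pos : MeasurableSet {q : ℂ | 0 < q.re} :=
  measurableSet_lt measurable_const measurable_re

lemma lintegral_ball_eq (g : ℂ → ℝ≥0∞) :
    ∫⁻ w in ball (0 : ℂ) 1, g w = ∫⁻ q in {q : ℂ | 0 < q.re},
      ENNReal.ofReal ((1 - ‖diskPoint q‖ ^ 2) ^ 2 / (2 * q.re ^ 2)) * g (diskPoint q) := by
  rw [← image_diskPoint, lintegral_image_eq_lintegral_abs_det_fderiv_mul volume
    measurableSet_re_pos (fun q _ => (hasFDerivAt_diskPoint q).hasFDerivWithinAt) injOn_diskPoint]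
  refine setLIntegral_congr_fun measurableSet_re_pos fun q hq => ?_
  simp only [abs_det_diskDeriv hq]

lemma range_axbCoord : Set.range axbCoord = {y | 0 < y.1} := by
  ext y
  constructor
  · rintro ⟨x, rfl⟩
    exact x.2.2
  · intro hy
    exact ⟨axbElement ⟨y.1, y.2⟩ hy, rfl⟩

lemma injective_axbCoord : Function.Injective axbCoord := by
  intro x y h
  have h1 : x.1 0 0 = y.1 0 0 := congrArg Prod.fst h
  have h2 : x.1 0 1 = y.1 0 1 := congrArg Prod.snd h
  refine Subtype.ext (Matrix.SpecialLinearGroup.ext _ _ fun i j => ?_)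
  fin_cases i <;> fin_cases j
  · exact h1
  · exact h2
  · exact x.2.1.trans y.2.1.symm
  · exact (coe_one_one x).trans ((congrArg _ h1).trans (coe_one_one y).symm)

lemma measurableEmbedding_axbCoord : MeasurableEmbedding axbCoord where
  injective := injective_axbCoord
  measurable := comap_measurable axbCoord
  measurableSet_image' := by
    rintro _ ⟨T, hT, rfl⟩
    rw [Set.image_preimage_eq_inter_range, range_axbCoord]
    exact hT.inter (measurableSet_lt measurable_const measurable_fst)

lemma measurable_axbComplex : Measurable axbComplex :=
  measurableEquivRealProd.symm.measurable.comp measurableEmbedding_axbCoord.measurable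

lemma lintegral_axbHaar {H : ℂ → ℝ≥0∞} (hH : Measurable H) :
    ∫⁻ x, H (axbComplex x) ∂axbHaar =
      ∫⁻ q in {q : ℂ | 0 < q.re}, ENNReal.ofReal (1 / q.re ^ 2) * H q := by
  have hm : Measurable fun y : ℝ × ℝ => H (measurableEquivRealProd.symm y) :=
    hH.comp measurableEquivRealProd.symm.measurable
  have hd : Measurable fun y : ℝ × ℝ => ENNReal.ofReal (1 / y.1 ^ 2) := by fun_prop
  change ∫⁻ x, (fun y : ℝ × ℝ => H (measurableEquivRealProd.symm y)) (axbCoord x)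
    ∂(Measure.comap axbCoord _) = _
  have hS : MeasurableSet {y : ℝ × ℝ | 0 < y.1} := measurableSet_lt measurable_const measurable_fst
  rw [← lintegral_map hm measurableEmbedding_axbCoord.measurable,
    measurableEmbedding_axbCoord.map_comap, range_axbCoord, restrict_withDensity hS,
    lintegral_withDensity_eq_lintegral_mul _ hd hm]
  have h := volume_preserving_equiv_real_prod.setLIntegral_comp_preimage hS (hd.mul hm)
  rw [← h]
  refine setLIntegral_congr_fun measurableSet_re_pos fun q _ => ?_
  simp

/-! ### Norms of wavelet transforms -/

lemma cayley_quotient_eq_diskPoint (x : axbGroup) :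
    cayleyβ x.1 / conj (cayleyα x.1) = diskPoint (axbComplex x) := cayley_quotient x

/-- Divide `|α|² - |β|² = 1` by `|α|²`. This converts powers of `|α|` into Bergman weights. -/
lemma norm_cayleyα_sq (x : axbGroup) :
    ‖cayleyα x.1‖ ^ 2 = (1 - ‖diskPoint (axbComplex x)‖ ^ 2)⁻¹ := by
  have h := normSq_cayley x.1
  have h0 : 0 < ‖cayleyα x.1‖ := norm_pos_iff.2 (cayleyα_ne_zero x)
  rw [normSq_eq_norm_sq, normSq_eq_norm_sq] at h
  rw [← cayley_quotient_eq_diskPoint, norm_div, RCLike.norm_conj, div_pow]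
  have h1 : 1 - ‖cayleyβ x.1‖ ^ 2 / ‖cayleyα x.1‖ ^ 2 = (‖cayleyα x.1‖ ^ 2)⁻¹ := by
    field_simp
    linarith
  rw [h1, inv_inv]

/-- Since `(a + a⁻¹)² + b² = 4 |α|²`, the weight is a power of `|α|`; the constant of the norm
identity gets its `2^(2r)` here. -/
lemma axbWeight_eq (r : ℝ) (x : axbGroup) :
    axbWeight r x = 2 ^ (2 * r) * ‖cayleyα x.1‖ ^ r := by
  have h1 : ((axbCoord x).1 + (axbCoord x).1⁻¹) ^ 2 + (axbCoord x).2 ^ 2 =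
      (2 * ‖cayleyα x.1‖) ^ 2 := by
    rw [mul_pow, ← normSq_eq_norm_sq, cayleyα_axb]
    simp [normSq_apply, axbCoord, -ofReal_inv, -ofReal_add]
    ring
  have h2 : 0 ≤ 2 * ‖cayleyα x.1‖ := by positivity
  rw [axbWeight, h1, ← Real.rpow_natCast, ← Real.rpow_mul h2,
    show ((2 : ℕ) : ℝ) * (r / 2) = r by push_cast; ring, Real.mul_rpow two_pos.le (norm_nonneg _),
    ← mul_assoc, ← Real.rpow_add two_pos]
  ring_nf

lemma norm_weight_rpow (s r p : ℝ) (x : axbGroup) :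
    (‖conj (cayleyα x.1) ^ (-(s : ℂ))‖ * axbWeight r x) ^ p =
      2 ^ (2 * r * p) * (1 - ‖diskPoint (axbComplex x)‖ ^ 2) ^ ((s - r) * p / 2) := by
  set t := 1 - ‖diskPoint (axbComplex x)‖ ^ 2 with ht
  have h0 : 0 < ‖cayleyα x.1‖ := norm_pos_iff.2 (cayleyα_ne_zero x)
  have h1 : t = ‖cayleyα x.1‖ ^ (-2 : ℝ) := by
    rw [Real.rpow_neg h0.le, Real.rpow_two, norm_cayleyα_sq, inv_inv]
  rw [axbWeight_eq, ← ofReal_neg, norm_cpow_real, RCLike.norm_conj, mul_left_comm,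
    ← Real.rpow_add h0, Real.mul_rpow (by positivity) (by positivity), ← Real.rpow_mul two_pos.le,
    ← Real.rpow_mul h0.le, h1, ← Real.rpow_mul h0.le]
  ring_nf

lemma measurable_of_bergman {f : ℂ → ℂ} (h0 : ∀ z ∉ ball (0 : ℂ) 1, f z = 0)
    (hd : DifferentiableOn ℂ f (ball 0 1)) : Measurable f := by
  classical
  have h := ContinuousOn.measurable_piecewise (g := fun _ => (0 : ℂ)) hd.continuousOn
    continuousOn_const measurableSet_ball
  have h' : Measurable ((ball (0 : ℂ) 1).indicator f) := by
    rw [← Set.piecewise_eq_indicator]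
    exact h
  rwa [Set.indicator_eq_self.2 fun z hz => by_contra fun h => hz (h0 z h)] at h'

lemma lintegral_diskMeasure (σ : ℝ) {h : ℂ → ℝ≥0∞} (hh : Measurable h) :
    ∫⁻ z, h z ∂(diskMeasure σ) =
      ∫⁻ z in ball (0 : ℂ) 1, ENNReal.ofReal ((1 - ‖z‖ ^ 2) ^ (σ - 2)) * h z := by
  rw [diskMeasure, lintegral_withDensity_eq_lintegral_mul _ (by fun_prop) hh]
  rfl

/-- Stated with extended norms and for every measurable `f`, so that it gives both the norm equality
and the equivalence of finiteness on the two sides. -/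
lemma eLpNorm_wavelet (s r : ℝ) {p : ℝ} (hp : 1 ≤ p) {f : ℂ → ℂ} (hf : Measurable f) :
    eLpNorm (fun x : axbGroup => conj (cayleyα x.1) ^ (-(s : ℂ)) *
        f (cayleyβ x.1 / conj (cayleyα x.1)) * axbWeight r x) (ENNReal.ofReal p) axbHaar =
      ENNReal.ofReal (2 ^ (2 * r + 1 / p)) *
        eLpNorm f (ENNReal.ofReal p) (diskMeasure ((s - r) * p / 2)) := by
  have hp0 : 0 < p := by linarith
  have hp1 : ENNReal.ofReal p ≠ 0 := by simpa using hp0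
  set σ := (s - r) * p / 2 with hσ
  rw [eLpNorm_eq_lintegral_rpow_enorm_toReal hp1 ENNReal.ofReal_ne_top,
    eLpNorm_eq_lintegral_rpow_enorm_toReal hp1 ENNReal.ofReal_ne_top, ENNReal.toReal_ofReal hp0.le]
  set H : ℂ → ℝ≥0∞ := fun q => ENNReal.ofReal (2 ^ (2 * r * p) *
    (1 - ‖diskPoint q‖ ^ 2) ^ σ) * ‖f (diskPoint q)‖ₑ ^ p with hH
  have hHm : Measurable H := by
    have := measurable_diskPoint
    have h2 := hf.comp this
    exact (by fun_prop : Measurable fun q => ENNReal.ofReal (2 ^ (2 * r * p) *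
      (1 - ‖diskPoint q‖ ^ 2) ^ σ)).mul (h2.enorm.pow_const p)
  have e1 : ∀ x : axbGroup, ‖conj (cayleyα x.1) ^ (-(s : ℂ)) *
      f (cayleyβ x.1 / conj (cayleyα x.1)) * axbWeight r x‖ₑ ^ p = H (axbComplex x) := fun x => by
    have hw : 0 ≤ axbWeight r x := by rw [axbWeight_eq]; positivity
    rw [mul_right_comm, enorm_mul, ENNReal.mul_rpow_of_nonneg _ _ hp0.le, ← ofReal_norm, norm_mul,
      norm_real, Real.norm_of_nonneg hw, ENNReal.ofReal_rpow_of_nonneg (by positivity) hp0.le,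
      norm_weight_rpow, cayley_quotient_eq_diskPoint]
  have e2 : ∫⁻ x, H (axbComplex x) ∂axbHaar =
      ENNReal.ofReal (2 ^ (2 * r * p + 1)) * ∫⁻ z, ‖f z‖ₑ ^ p ∂(diskMeasure σ) := by
    rw [lintegral_axbHaar hHm, lintegral_diskMeasure σ (hf.enorm.pow_const p), lintegral_ball_eq,
      ← lintegral_const_mul' _ _ ENNReal.ofReal_ne_top]
    -- The Jacobian contributes `(1 - |w|²)²`, which lowers the exponent `σ` to the `σ - 2` of the
    -- Bergman weight and leaves a factor `2`.
    refine setLIntegral_congr_fun measurableSet_re_pos fun q hq => ?_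
    have ht : 0 < 1 - ‖diskPoint q‖ ^ 2 := by
      have := mem_ball_zero_iff.1 (diskPoint_mem hq)
      nlinarith [norm_nonneg (diskPoint q)]
    have hq' : 0 < q.re := hq
    simp only [hH]
    rw [← mul_assoc, ← mul_assoc, ← mul_assoc, ← ENNReal.ofReal_mul (by positivity),
      ← ENNReal.ofReal_mul (by positivity), ← ENNReal.ofReal_mul (by positivity)]
    congr 2
    rw [Real.rpow_add_one two_ne_zero, Real.rpow_sub ht, Real.rpow_two]
    field_simp
  simp only [e1]
  rw [e2, ENNReal.mul_rpow_of_nonneg _ _ (by positivity),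
    ENNReal.ofReal_rpow_of_nonneg (by positivity) (by positivity), ← Real.rpow_mul two_pos.le]
  congr 3
  field_simp

lemma measurable_wavelet (s r : ℝ) {f : ℂ → ℂ} (hf : Measurable f) :
    Measurable fun x : axbGroup => conj (cayleyα x.1) ^ (-(s : ℂ)) *
        f (cayleyβ x.1 / conj (cayleyα x.1)) * axbWeight r x := by
  have h1 : Measurable fun x : axbGroup => cayleyα x.1 := by
    have e : (fun x : axbGroup => cayleyα x.1) = fun x =>
        (((axbCoord x).1 + (axbCoord x).1⁻¹ : ℝ) + ((axbCoord x).2 : ℝ) * I) / 2 :=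
      funext cayleyα_axb
    have := measurableEmbedding_axbCoord.measurable
    have ha := measurable_fst.comp this
    have hb := measurable_snd.comp this
    rw [e]
    exact ((measurable_ofReal.comp (ha.add ha.inv)).add
      ((measurable_ofReal.comp hb).mul_const I)).div_const 2
  have h2 : Measurable fun x : axbGroup => f (cayleyβ x.1 / conj (cayleyα x.1)) := by
    simp only [cayley_quotient_eq_diskPoint]
    exact hf.comp (measurable_diskPoint.comp measurable_axbComplex)
  have h3 : Measurable fun x : axbGroup => axbWeight r x := by
    simp only [axbWeight_eq]
    fun_prop
  have h4 : Measurable fun x : axbGroup => conj (cayleyα x.1) ^ (-(s : ℂ)) :=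
    (continuous_conj.measurable.comp h1).pow_const _
  exact (h4.mul h2).mul (measurable_ofReal.comp h3)

/-- By Hölder's inequality, the functions in the Bergman space are integrable for the measure of
`H_s`. -/
lemma integrable_of_memLp {s σ p : ℝ} (hp : 1 ≤ p)
    (h2 : σ < (s - 1) * p + 1) {f : ℂ → ℂ} (hfm : Measurable f)
    (hf : MemLp f (ENNReal.ofReal p) (diskMeasure σ)) : Integrable f (hilbertMeasure s) := by
  have hp0 : 0 < p := by linarith
  refine Integrable.smul_measure ⟨hfm.aestronglyMeasurable, ?_⟩ ENNReal.ofReal_ne_top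
  have hf3 := (eLpNorm_lt_top_iff_lintegral_rpow_enorm_lt_top (by simpa using hp0)
    ENNReal.ofReal_ne_top).1 hf.2
  rw [ENNReal.toReal_ofReal hp0.le, lintegral_diskMeasure σ (hfm.enorm.pow_const p)] at hf3
  rw [HasFiniteIntegral, lintegral_diskMeasure s hfm.enorm]
  have ht : ∀ z ∈ ball (0 : ℂ) 1, 0 < 1 - ‖z‖ ^ 2 := fun z hz => by
    nlinarith [norm_nonneg z, mem_ball_zero_iff.1 hz]
  -- For `p = 1` the hypothesis reads `σ < s` and the weights compare pointwise; Hölder's inequality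
  -- is used for `p > 1`.
  rcases hp.eq_or_lt with rfl | hp1
  · refine lt_of_le_of_lt (setLIntegral_mono' measurableSet_ball fun z hz => ?_) hf3
    rw [ENNReal.rpow_one]
    gcongr 1
    refine ENNReal.ofReal_le_ofReal (Real.rpow_le_rpow_of_exponent_ge (ht z hz) ?_ (by linarith))
    linarith [sq_nonneg ‖z‖]
  · have hpq := Real.HolderConjugate.conjExponent hp1
    set q := p.conjExponent with hq
    have hq0 : 0 < q := hpq.symm.pos
    -- The exponent left for the second factor: `(σ - 2) / p + e = s - 2`.
    set e := s - 2 - (σ - 2) / p with he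
    have hkey := ENNReal.lintegral_mul_le_Lp_mul_Lq (volume.restrict (ball (0 : ℂ) 1)) hpq
      (f := fun z => ENNReal.ofReal ((1 - ‖z‖ ^ 2) ^ ((σ - 2) / p)) * ‖f z‖ₑ)
      (g := fun z => ENNReal.ofReal ((1 - ‖z‖ ^ 2) ^ e)) (by fun_prop) (by fun_prop)
    have e1 : ∫⁻ z in ball (0 : ℂ) 1, ENNReal.ofReal ((1 - ‖z‖ ^ 2) ^ (s - 2)) * ‖f z‖ₑ =
        ∫⁻ z in ball (0 : ℂ) 1, ENNReal.ofReal ((1 - ‖z‖ ^ 2) ^ ((σ - 2) / p)) * ‖f z‖ₑ *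
          ENNReal.ofReal ((1 - ‖z‖ ^ 2) ^ e) := by
      refine setLIntegral_congr_fun measurableSet_ball fun z hz => ?_
      have h := ht z hz
      rw [mul_right_comm, ← ENNReal.ofReal_mul (by positivity), ← Real.rpow_add h, he]
      ring_nf
    have e2 : ∫⁻ z in ball (0 : ℂ) 1,
        (ENNReal.ofReal ((1 - ‖z‖ ^ 2) ^ ((σ - 2) / p)) * ‖f z‖ₑ) ^ p =
        ∫⁻ z in ball (0 : ℂ) 1, ENNReal.ofReal ((1 - ‖z‖ ^ 2) ^ (σ - 2)) * ‖f z‖ₑ ^ p := by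
      refine setLIntegral_congr_fun measurableSet_ball fun z hz => ?_
      have h := ht z hz
      rw [ENNReal.mul_rpow_of_nonneg _ _ hp0.le,
        ENNReal.ofReal_rpow_of_nonneg (by positivity) hp0.le, ← Real.rpow_mul h.le,
        div_mul_cancel₀ _ hp0.ne']
    have e3 : ∫⁻ z in ball (0 : ℂ) 1, ENNReal.ofReal ((1 - ‖z‖ ^ 2) ^ e) ^ q =
        diskMeasure (e * q + 2) Set.univ := by
      rw [diskMeasure, withDensity_apply _ MeasurableSet.univ, Measure.restrict_univ]
      refine setLIntegral_congr_fun measurableSet_ball fun z hz => ?_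
      have h := ht z hz
      rw [ENNReal.ofReal_rpow_of_nonneg (by positivity) hq0.le, ← Real.rpow_mul h.le,
        add_sub_cancel_right]
    -- Finiteness of the second Hölder factor. Here `e q + 1 = ((s - 1) p + 1 - σ) / (p - 1)`, so
    -- the condition is exactly the upper bound on `σ`.
    have hexp : 1 < e * q + 2 := by
      have h3 : q = p / (p - 1) := rfl
      have h4 : 0 < p - 1 := by linarith
      rw [h3, he]
      have h5 : (s - 2 - (σ - 2) / p) * (p / (p - 1)) + 2 - 1 =
          ((s - 1) * p + 1 - σ) / (p - 1) := by
        field_simp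
        ring
      have h6 : 0 < ((s - 1) * p + 1 - σ) / (p - 1) := div_pos (by linarith) h4
      linarith
    have := isFiniteMeasure_diskMeasure hexp
    rw [e1]
    refine hkey.trans_lt (ENNReal.mul_lt_top ?_ ?_)
    · refine ENNReal.rpow_lt_top_of_nonneg (by positivity) ?_
      rw [e2]
      exact hf3.ne
    · refine ENNReal.rpow_lt_top_of_nonneg (by positivity) ?_
      rw [e3]
      exact measure_ne_top _ _

/-! ### The isomorphism of Bergman and coorbit spaces -/

lemma bergmanSpace_measurable {p : ℝ≥0∞} {σ : ℝ} (f : bergmanSpace p σ) : Measurable f.1 :=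
  measurable_of_bergman f.2.1 f.2.2.1

/-- The distribution given by a function in the Bergman space, in the coorbit space. -/
def toCoorbit {s r p : ℝ} (hs : 1 < s) (hp : 1 ≤ p)
    (h2 : (s - r) * p / 2 < (s - 1) * p + 1) :
    bergmanSpace (ENNReal.ofReal p) ((s - r) * p / 2) →ₗ[ℂ] coorbit hs (ENNReal.ofReal p) r where
  toFun f := ⟨toDistribution hs f.1
      (integrable_of_memLp hp h2 (bergmanSpace_measurable f) f.2.2.2), by
    refine ⟨?_, ?_⟩ <;> simp only [wavelet_toDistribution hs f.2.2.1]
    · exact (measurable_wavelet s r (bergmanSpace_measurable f)).aestronglyMeasurable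
    · rw [eLpNorm_wavelet s r hp (bergmanSpace_measurable f)]
      exact ENNReal.mul_lt_top ENNReal.ofReal_lt_top f.2.2.2.2⟩
  map_add' f g := by
    refine Subtype.ext (ContinuousLinearMap.ext fun v => ?_)
    have hi := fun f : bergmanSpace (ENNReal.ofReal p) ((s - r) * p / 2) =>
      integrable_mul_conj_toFun hs
        (integrable_of_memLp hp h2 (bergmanSpace_measurable f) f.2.2.2) v
    change ∫ z, (f.1 z + g.1 z) * conj (v.toFun z) ∂(hilbertMeasure s) =
      ∫ z, f.1 z * conj (v.toFun z) ∂(hilbertMeasure s) +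
      ∫ z, g.1 z * conj (v.toFun z) ∂(hilbertMeasure s)
    rw [← integral_add (hi f) (hi g)]
    simp only [add_mul]
  map_smul' c f := by
    refine Subtype.ext (ContinuousLinearMap.ext fun v => ?_)
    change ∫ z, (c * f.1 z) * conj (v.toFun z) ∂(hilbertMeasure s) =
      c * ∫ z, f.1 z * conj (v.toFun z) ∂(hilbertMeasure s)
    rw [← integral_const_mul]
    simp only [mul_assoc]

lemma wavelet_toCoorbit {s r p : ℝ} (hs : 1 < s) (hp : 1 ≤ p)
    (h2 : (s - r) * p / 2 < (s - 1) * p + 1)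
    (f : bergmanSpace (ENNReal.ofReal p) ((s - r) * p / 2)) (x : axbGroup) :
    wavelet hs (toCoorbit hs hp h2 f).1 x =
      conj (cayleyα x.1) ^ (-(s : ℂ)) * f.1 (cayleyβ x.1 / conj (cayleyα x.1)) :=
  wavelet_toDistribution hs f.2.2.1 _ x

/-- The wavelet transform of `φ_f` recovers `f` at every point of the disc, whence injectivity. A
preimage of `φ` is the holomorphic function behind its wavelet transform, and `distribution_eq_zero`
identifies the two distributions. -/
lemma bijective_toCoorbit {s r p : ℝ} (hs : 1 < s) (hp : 1 ≤ p)
    (h2 : (s - r) * p / 2 < (s - 1) * p + 1) :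
    Function.Bijective (toCoorbit (r := r) hs hp h2) := by
  constructor
  · intro f g h
    refine Subtype.ext (funext fun z => ?_)
    by_cases hz : z ∈ ball (0 : ℂ) 1
    · obtain ⟨x, rfl⟩ := exists_cayley_quotient (mem_ball_zero_iff.1 hz)
      refine mul_left_cancel₀ (cpow_cayleyα_ne_zero s x) ?_
      rw [← wavelet_toCoorbit hs hp h2 f, ← wavelet_toCoorbit hs hp h2 g, h]
    · rw [f.2.1 z hz, g.2.1 z hz]
  · intro φ
    obtain ⟨f, hf0, hfd, hf⟩ := exists_holomorphic hs φ.1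
    have hfm := measurable_of_bergman hf0 hfd
    have hφ : MemWeightedLp (ENNReal.ofReal p) r (wavelet hs φ.1) := φ.2
    have hφ2 := hφ.2
    simp only [hf] at hφ2
    rw [eLpNorm_wavelet s r hp hfm] at hφ2
    -- The constant in the norm identity is positive, so an infinite Bergman norm would force an
    -- infinite coorbit norm.
    have hfin : eLpNorm f (ENNReal.ofReal p) (diskMeasure ((s - r) * p / 2)) < ⊤ := by
      refine lt_top_iff_ne_top.2 fun h => ?_
      rw [h, ENNReal.mul_top (by simpa using Real.rpow_pos_of_pos two_pos _)] at hφ2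
      exact hφ2.false
    let F : bergmanSpace (ENNReal.ofReal p) ((s - r) * p / 2) :=
      ⟨f, hf0, hfd, hfm.aestronglyMeasurable, hfin⟩
    refine ⟨F, Subtype.ext (sub_eq_zero.1 (distribution_eq_zero hs fun x => ?_))⟩
    change wavelet hs (toCoorbit hs hp h2 F).1 x - wavelet hs φ.1 x = 0
    rw [wavelet_toCoorbit, hf, sub_self]

end BergmanCoorbit

end

theorem mainTheorem2 (s r p : ℝ) (hs : 1 < s) (hp : 1 ≤ p)
    (h1 : 1 < (s - r) * p / 2) (h2 : (s - r) * p / 2 < (s - 1) * p + 1) :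
    ∃ J : bergmanSpace (ENNReal.ofReal p) ((s - r) * p / 2) ≃ₗ[ℂ]
        coorbit hs (ENNReal.ofReal p) r,
      ∀ f : bergmanSpace (ENNReal.ofReal p) ((s - r) * p / 2),
        (∀ v : SmoothVector s,
          Integrable (fun z => f.1 z * conj (v.toFun z)) (hilbertMeasure s) ∧
          (J f).1 v = ∫ z, f.1 z * conj (v.toFun z) ∂(hilbertMeasure s)) ∧
        (∀ x : axbGroup, wavelet hs (J f).1 x =
          conj (cayleyα x.1) ^ (-(s : ℂ)) * f.1 (cayleyβ x.1 / conj (cayleyα x.1))) ∧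
        coorbitNorm hs (ENNReal.ofReal p) r (J f).1 =
          2 ^ (2 * r + 1 / p) * bergmanNorm (ENNReal.ofReal p) ((s - r) * p / 2) f.1 := by
  refine ⟨LinearEquiv.ofBijective (toCoorbit hs hp h2) (bijective_toCoorbit hs hp h2),
    fun f => ⟨fun v => ⟨integrable_mul_conj_toFun hs
      (integrable_of_memLp hp h2 (bergmanSpace_measurable f) f.2.2.2) v, rfl⟩,
      wavelet_toCoorbit hs hp h2 f, ?_⟩⟩
  change (eLpNorm (fun x => wavelet hs (toCoorbit hs hp h2 f).1 x * axbWeight r x) _ _).toReal = _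
  simp only [wavelet_toCoorbit]
  rw [eLpNorm_wavelet s r hp (bergmanSpace_measurable f), ENNReal.toReal_mul,
    ENNReal.toReal_ofReal (by positivity), bergmanNorm]
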